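/- **Setting.** Let $0<r<1$, $\mathbb{A}_r=\{z\in\mathbb{C}: r<|z|<1\}$, $\mathbb{S}_\rho=\{|z|=\rho\}$, and let $\mathbb{H}^3=\{(x_1,x_2,x_3)\in\mathbb{R}^3 : x_3>0\}$ carry the metric $x_3^{-2}(dx_1^2+dx_2^2+dx_3^2)$. Put $$\vartheta_1(z)=\prod_{k\ge1}(1-r^{2k})\Big(1-\frac1z\Big)\prod_{k\ge1}(1-r^{2k}z)(1-r^{2k}/z),$$ and for $z_0,z_1,z_2\in\,]-1,-r[$ and $j=0,1,2$ $$q_j(z)=-\frac{\vartheta_1'(z_j/z)}{z\,\vartheta_1(z_j/z)}-\frac{z\,\vartheta_1'(z_jz)}{\vartheta_1(z_jz)},\qquad Q_j(z)=\frac{\vartheta_1(z_j/z)}{\vartheta_1(z_jz)}.$$ Assume $z_1\ne z_0$, $z_2\neq z_0$, and let $R=a\,q_0+b$ with real constants $a,b$ such that $R(z_1)=1$, $R(z_2)=0$ and $0<R<1$ on $\mathbb{S}_1\cup\mathbb{S}_r$ (where $R$ is real). Let $c_1=q_1(z_0)$, $c_2=q_2(z_0)$. **Conditions on the data.** Let $\Sigma\subset\mathbb{C}$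 be open, $g$ a meromorphic function on $\Sigma$ with set of poles $\mathcal{P}_g$, and $u:\Sigma\setminus\mathcal{P}_g\to\mathbb{R}$. We say that $(g,u)$ *satisfies the conditions of the conformal representation theorem* on $\Sigma$ if $g$ is non-constant, $u$ is harmonic, and: * (A) for each $p\in\mathcal{P}_g$ there is a local holomorphic coordinate $\zeta$ vanishing at $p$ such that $u+(b_g(p)+1)\log|\zeta|$ extends harmonically to a neighbourhood of $p$, where $b_g(p)$ is the branch number of $g$ at $p$; * (B) there is a holomorphic function $F$ on $\Sigma$ such that $du+i*du=F\,dg$, where $*dx=dy$ and $*dy=-dx$, and such that $g$ and $g-1/F$ have no common branch points; * $ds^2=e^{-4u}\,\big|e^{4u}(dF+F^2dg)-\overline{dg}\,\big|^2$ is positive definite, that is, a Riemannian metric on $\Sigma$. **Proposition.** Suppose that in addition $m\in\mathbb{R}$ and * (C1) $m+c_1z_1-z_1R'(z_1)=-z_2R'(z_2)$, * (C2) $c_1z_1-c_2z_2-2=0$, * (C3) $z_1z_2\,r^{2(m+2)}=1$. Then the formulas $$g(z)=\sqrt{\frac{R(z)}{1-R(z)}\,\frac{Q_1(z)}{Q_2(z)}\,z^{-2}},\qquad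 u(z)=\frac12\log\left|\frac{Q_1(z)}{1-R(z)}\,z^m\right|,$$ extended through their removable singularities, define a single-valued holomorphic function $g:\mathbb{A}_r\to\mathbb{C}$ (for a choice of sign) and a continuous function $u:\mathbb{A}_r\setminus\{z_0\}\to\mathbb{R}$. For either choice of sign, $(g,u)$ satisfies the conditions of the conformal representation theorem on $\mathbb{A}_r\setminus\{z_0\}$. With the function $F$ of (B), the map $\psi=(\psi_1,\psi_2,\psi_3)$ given by $$\psi_1+i\psi_2=g-\psi_3\,e^{2u}\,\overline{F},\qquad \psi_3=\frac{e^{2u}}{1+e^{4u}|F|^2}$$ is a well-defined smooth flat immersion $\mathbb{A}_r\setminus\{z_0\}\to\mathbb{H}^3$ (its induced metric is locally isometric to the Euclidean plane). Moreover $\mathbb{S}_1$ and $\mathbb{S}_r$ are isolated singularities of $\psi$, with images $$\psi(\mathbb{S}_1)=(0,0,1),\qquad \psi(\mathbb{S}_r)=(0,0,|z_1|\,r^{m+1}).$$ Here this means: $\psi(z)$ tends to the given point as $z$ tends to the circle; and if $\mathbb{A}_r\setminus\{z_0\}$ is completed by one point $p$ representing the circle, then in no $C^1$ chart around $p$ (compatible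 with the differentiable structure of $\mathbb{A}_r\setminus\{z_0\}$) is the extended map $C^1$ with injective differential at $p$. -/

import Mathlib

open Filter Topology
open scoped ContDiff

noncomputable section

namespace FlatSurface

/-! ### Conformal data and flat immersions into the half-space model of hyperbolic space -/

/-- Ambient coordinate space `ℝ³`; hyperbolic space is the half-space where the last coordinate is
positive, with the metric `(dx₁² + dx₂² + dx₃²) / x₃²`. -/
abbrev E3 : Type := EuclideanSpace ℝ (Fin 3)

/-- Squared length, for the hyperbolic metric of the half-space, of a tangent vector `v` at `p`. -/
def hypNormSq (p v : E3) : ℝ := ‖v‖ ^ 2 / (p 2) ^ 2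

/-- Induced metric (first fundamental form) of `ψ` at `z`, evaluated on the tangent vector `v`. -/
def inducedMetric (ψ : ℂ → E3) (z v : ℂ) : ℝ := hypNormSq (ψ z) (fderiv ℝ ψ z v)

/-- `ψ` restricted to the open set `U` is a smooth flat immersion into hyperbolic space: it takes
values in the half-space, it is smooth with injective differential, and its induced metric is
flat, i.e. each point has a neighbourhood with a smooth map to the Euclidean plane that pulls the
Euclidean metric back to the induced one (hence is a local isometry). -/
structure IsFlatImmersionOn (ψ : ℂ → E3) (U : Set ℂ) : Prop where
  pos : ∀ z ∈ U, 0 < ψ z 2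
  smooth : ContDiffOn ℝ ∞ ψ U
  immersion : ∀ z ∈ U, Function.Injective (fderiv ℝ ψ z)
  flat : ∀ z ∈ U, ∃ V : Set ℂ, IsOpen V ∧ z ∈ V ∧ V ⊆ U ∧ ∃ φ : ℂ → ℂ, ContDiffOn ℝ ∞ φ V ∧
    ∀ w ∈ V, ∀ v : ℂ, ‖fderiv ℝ φ w v‖ ^ 2 = inducedMetric ψ w v

/-- The set of poles in `U`. -/
def poles (g : ℂ → ℂ) (U : Set ℂ) : Set ℂ := {p ∈ U | meromorphicOrderAt g p < 0}

/-- Branch number (ramification order minus one) at `p` of a meromorphic function, seen as a map to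
the Riemann sphere. It is `⊤` if the function is constant near `p`. -/
def branchNumber (f : ℂ → ℂ) (p : ℂ) : WithTop ℤ :=
  if meromorphicOrderAt f p < 0 then ((-(meromorphicOrderAt f p).untop₀ - 1 : ℤ) : WithTop ℤ)
  else meromorphicOrderAt (deriv f) p

/-- Branch points of a meromorphic function. -/
def IsBranchPoint (f : ℂ → ℂ) (p : ℂ) : Prop := 0 < branchNumber f p

/-- The first fundamental form `exp (-4u) |exp (4u) (dF + F² dg) - conj dg|²` at `z`,
evaluated on the tangent vector `v`. -/
def dataMetric (g : ℂ → ℂ) (u : ℂ → ℝ) (F : ℂ → ℂ) (z v : ℂ) : ℝ :=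
  Real.exp (-4 * u z) *
    ‖(Real.exp (4 * u z) : ℂ) * ((deriv F z + F z ^ 2 * deriv g z) * v)
      - (starRingEnd ℂ) (deriv g z * v)‖ ^ 2

/-- The hypotheses of the conformal representation theorem, for data `g`, `u` on an open set `U` of
the complex plane; `F` is the holomorphic function of condition (B). -/
structure IsConformalData (U : Set ℂ) (g : ℂ → ℂ) (u : ℂ → ℝ) (F : ℂ → ℂ) : Prop where
  /-- `g` is meromorphic on `U` (holomorphic off its poles) -/
  meromorphic : MeromorphicNFOn g U
  nonconstant : ¬ ∃ c : ℂ, ∀ z ∈ U \ poles g U, g z = c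
  harmonic : InnerProductSpace.HarmonicOnNhd u (U \ poles g U)
  /-- condition (A) -/
  condA : ∀ p ∈ poles g U, ∃ ζ : ℂ → ℂ, AnalyticAt ℂ ζ p ∧ ζ p = 0 ∧ deriv ζ p ≠ 0 ∧
    ∃ v : ℂ → ℝ, InnerProductSpace.HarmonicAt v p ∧
      ∀ᶠ z in 𝓝[≠] p, v z = u z + (((branchNumber g p).untop₀ : ℝ) + 1) * Real.log ‖ζ z‖
  holomorphic : DifferentiableOn ℂ F U
  /-- condition (B1): `du + i * du = F dg`, where `(* ω)(v) = - ω (i v)` is the conjugation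
  operator on 1-forms (`* dx = dy`, `* dy = - dx`) -/
  condB1 : ∀ z ∈ U \ poles g U, ∀ v : ℂ,
    ((fderiv ℝ u z v : ℝ) : ℂ) + Complex.I * ((-(fderiv ℝ u z (Complex.I * v)) : ℝ) : ℂ)
      = F z * (deriv g z * v)
  /-- condition (B2) -/
  condB2 : ∀ p ∈ U, ¬ (IsBranchPoint g p ∧ IsBranchPoint (fun z => g z - 1 / F z) p)
  /-- the first fundamental form is positive definite -/
  posDef : ∀ z ∈ U \ poles g U, ∀ v : ℂ, v ≠ 0 → 0 < dataMetric g u F z v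
  /-- it extends as a positive definite form across the poles of `g` -/
  posDef_pole : ∀ p ∈ poles g U, ∃ ε : ℝ, 0 < ε ∧
    ∀ᶠ z in 𝓝[≠] p, ∀ v : ℂ, ε * ‖v‖ ^ 2 ≤ dataMetric g u F z v

/-- The map `ψ` of the conformal representation:
`ψ₃ = exp (2u) / (1 + exp (4u) |F|²)`, `ψ₁ + i ψ₂ = g - ψ₃ exp (2u) conj F`. -/
def surface (g : ℂ → ℂ) (u : ℂ → ℝ) (F : ℂ → ℂ) (z : ℂ) : E3 :=
  let h : ℝ := Real.exp (2 * u z) / (1 + Real.exp (4 * u z) * ‖F z‖ ^ 2)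
  let w : ℂ := g z - ((h * Real.exp (2 * u z) : ℝ) : ℂ) * (starRingEnd ℂ) (F z)
  !₂[w.re, w.im, h]

/-- Let the surface `U` be completed by one point `p`, whose punctured neighbourhoods are the traces
on `U` of the neighbourhoods of the compact set `S` (a boundary circle of `U`). The map `ψ` on `U`
has an isolated singularity at `p` (one says: at `S`) with image `P`: it extends continuously by
`P`, but it is not `C¹`-regular at `p`, i.e. in no `C¹` chart `φ` of the completed surface around
`p` (centred at `p` and defined on the unit disc) does the extended map `Ψ` become a `C¹` map that
is immersive at `p`. -/
structure HasIsolatedSingularity (ψ : ℂ → E3) (U S : Set ℂ) (P : E3) : Prop where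
  tendsto : Tendsto ψ (𝓝ˢ S ⊓ 𝓟 U) (𝓝 P)
  singular : ∀ (φ : ℂ → ℂ) (Ψ : ℂ → E3),
    Set.MapsTo φ (Metric.ball 0 1 \ {0}) U →
    Set.InjOn φ (Metric.ball 0 1 \ {0}) →
    ContDiffOn ℝ 1 φ (Metric.ball 0 1 \ {0}) →
    (∀ w ∈ Metric.ball (0 : ℂ) 1 \ {0}, Function.Injective (fderiv ℝ φ w)) →
    Filter.map φ (𝓝[≠] 0) = 𝓝ˢ S ⊓ 𝓟 U →
    (∀ w ∈ Metric.ball (0 : ℂ) 1 \ {0}, Ψ w = ψ (φ w)) →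
    ContDiffOn ℝ 1 Ψ (Metric.ball 0 1) →
    ¬ Function.Injective (fderiv ℝ Ψ 0)

/-! ### Theta-function data on the annulus -/

/-- The annulus `r < |z| < 1`. -/
def annulus (r : ℝ) : Set ℂ := {z | r < ‖z‖ ∧ ‖z‖ < 1}

/-- The annular Jacobi theta function. -/
def theta (r : ℝ) (z : ℂ) : ℂ :=
  (∏' k : ℕ, (1 - (r : ℂ) ^ (2 * (k + 1)))) * (1 - 1 / z) *
    ∏' k : ℕ, ((1 - (r : ℂ) ^ (2 * (k + 1)) * z) * (1 - (r : ℂ) ^ (2 * (k + 1)) / z))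

/-- The function `q_j` attached to the point `x = z_j`. -/
def q (r x : ℝ) (z : ℂ) : ℂ :=
  -(deriv (theta r) (x / z) / (z * theta r (x / z)))
    - z * deriv (theta r) (x * z) / theta r (x * z)

/-- The quotient `Q_j` attached to the point `x = z_j`. -/
def Q (r x : ℝ) (z : ℂ) : ℂ := theta r (x / z) / theta r (x * z)

/-- `R = a q₀ + b`. -/
def R (r z₀ a b : ℝ) (z : ℂ) : ℂ := a * q r z₀ z + b

/-- `g` is a (single-valued) holomorphic branch on the annulus of
`√(R / (1 - R) · Q₁ / Q₂ · z⁻²)`. The formula is understood through its removable singularities at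
`z₀`, `z₁`, `z₂`. -/
def IsGaussMap (r z₀ z₁ z₂ a b : ℝ) (g : ℂ → ℂ) : Prop :=
  DifferentiableOn ℂ g (annulus r) ∧
  ∀ z ∈ annulus r, z ≠ z₀ → z ≠ z₁ → z ≠ z₂ →
    g z ^ 2 = R r z₀ a b z / (1 - R r z₀ a b z) * (Q r z₁ z / Q r z₂ z) * (z ^ 2)⁻¹

/-- `u` is the function `½ log |Q₁ / (1 - R) · z^m|` on the annulus punctured at `z₀`. The formula
is understood through its removable singularity at `z₁`. -/
def IsPotential (r z₀ z₁ a b m : ℝ) (u : ℂ → ℝ) : Prop :=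
  ContinuousOn u (annulus r \ {(z₀ : ℂ)}) ∧
  ∀ z ∈ annulus r, z ≠ z₀ → z ≠ z₁ →
    u z = 1 / 2 * Real.log (‖Q r z₁ z / (1 - R r z₀ a b z)‖ * ‖z‖ ^ m)

end FlatSurface

end

open FlatSurface

/-!
The functions `R` and `1 - R` are elliptic functions of degree two on the torus `ℂˣ / r^{2ℤ}`, even
with respect to `z ↦ 1/z`, with poles at `z₀^{±1}`. Since `R(z₂) = 0` and `R(z₁) = 1`, Liouville's
theorem on the torus turns them into theta quotients (`qNum_eq_thetaPair`, `R_sub_R_eq`):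
`R = k₂ θ(z₂/z)θ(z₂z) / (θ(z₀/z)θ(z₀z))` and likewise `1 - R` with `z₁`. Therefore the square root in
the definition of `g` can be extracted, `g = s θ(z₂z) / (zθ(z₁z))`, and `e^{2u}` is the modulus of an
explicit theta quotient times `|z|^m`. With `D = z g'/g` (`gaussLog`) one has
`z R' = R (1 - R) (D(z) - D(1/z))`, and the two conditions `C1`, `C2` amount to `du + i*du = F dg` for
`F = R / g` (`potential_log_eq`).

On the boundary circles inversion is complex conjugation up to the period `r²`, so `R` is real and
`D(1/z)` is the conjugate of `D(z)`. By `C2` and the product formulas, `2 Re D = z₁q₁ - z₂q₂ - 2` is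
there a combination of `1 / R` and `1 / (1 - R)` whose two coefficients have the sign opposite to
that of `a`. By the maximum principle `Re D` has this sign on the whole closed annulus
(`re_gaussLog`); in particular `g' ≠ 0`.

The first fundamental form is positive definite as soon as `e^{4u} |F' + F² g'| < |g'|`, and this
inequality reads `|N(1/z)| |z|^{2m+2} < |N(z)|` with `N(z) = D(z) θ(z₁z) θ(z₂z)` (`gaussNum`). Both
sides agree on the boundary, by `C3` on the inner circle, and `N(1/z)` has a zero in the annulus, so
that the strong maximum principle gives the strict inequality (`norm_gaussNum_inv_lt`).
The surface is flat because the form is `|dA - conj dB|²` with local holomorphic functions `A`, `B`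
(`exists_flat_coordinate`).

Finally all data extend smoothly across the boundary circles, where `e^{4u} R (1 - R) = |g|²`. This
relation forces the surface to take the constant value `(0, 0, h)` with `h = e^{2u} (1 - R)`, and
the radial derivative of its height to be `4 h R (1 - R) Re D ≠ 0` (`radial_deriv`). So near each
circle the surface is contained in a half-cone with vertex `(0, 0, h)`, and it cannot have an
injective differential there in any `C¹` chart of the completed surface
(`hasIsolatedSingularity_of_cone`).
-/

namespace FlatSurface

/-! ### The annular theta function -/

/-- The entire function `∏ₖ (1 - r²ᵏ z)`, `k ≥ 1`, of which the theta function is built. -/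
noncomputable def eulerProd (r : ℝ) (z : ℂ) : ℂ := ∏' k : ℕ, (1 - (r : ℂ) ^ (2 * (k + 1)) * z)

section

variable {r : ℝ}

lemma summable_pow_two_mul (hr0 : 0 < r) (hr1 : r < 1) (C : ℝ) :
    Summable fun k : ℕ => r ^ (2 * (k + 1)) * C := by
  have h : Summable fun k : ℕ => (r ^ 2) ^ (k + 1) :=
    (summable_nat_add_iff 1).mpr (summable_geometric_of_lt_one (by positivity) (by nlinarith))
  simpa [pow_mul] using h.mul_right C

lemma norm_eulerProd_factor (hr0 : 0 < r) (z : ℂ) (k : ℕ) :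
    ‖-((r : ℂ) ^ (2 * (k + 1)) * z)‖ = r ^ (2 * (k + 1)) * ‖z‖ := by
  simp [abs_of_pos hr0]

lemma multipliable_eulerProd (hr0 : 0 < r) (hr1 : r < 1) (z : ℂ) :
    Multipliable fun k : ℕ => (1 - (r : ℂ) ^ (2 * (k + 1)) * z) := by
  simp_rw [sub_eq_add_neg]
  apply multipliable_one_add_of_summable
  simp_rw [norm_eulerProd_factor hr0]
  exact summable_pow_two_mul hr0 hr1 _

lemma differentiable_eulerProd (hr0 : 0 < r) (hr1 : r < 1) : Differentiable ℂ (eulerProd r) := by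
  intro z
  have hz : z ∈ Metric.ball (0 : ℂ) (‖z‖ + 1) := by simp
  have h := Summable.hasProdLocallyUniformlyOn_nat_one_add (f := fun (k : ℕ) (w : ℂ) =>
    -((r : ℂ) ^ (2 * (k + 1)) * w)) (K := Metric.ball (0 : ℂ) (‖z‖ + 1)) Metric.isOpen_ball
    (summable_pow_two_mul hr0 hr1 (‖z‖ + 1))
    (Eventually.of_forall fun k w hw => by
      rw [norm_eulerProd_factor hr0]
      have := mem_ball_zero_iff.mp hw
      gcongr) (fun k => by fun_prop)
  have hd : DifferentiableOn ℂ (fun w => ∏' k : ℕ, (1 + -((r : ℂ) ^ (2 * (k + 1)) * w)))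
      (Metric.ball (0 : ℂ) (‖z‖ + 1)) :=
    h.differentiableOn (.of_forall fun _ => by
      simpa [Finset.prod_fn] using DifferentiableOn.finsetProd (fun _ _ => by fun_prop))
      Metric.isOpen_ball
  have := hd.differentiableAt (Metric.isOpen_ball.mem_nhds hz)
  simp only [← sub_eq_add_neg] at this
  exact this

lemma eulerProd_rec (hr0 : 0 < r) (hr1 : r < 1) (z : ℂ) :
    eulerProd r z = (1 - (r : ℂ) ^ 2 * z) * eulerProd r ((r : ℂ) ^ 2 * z) := by
  have h := tprod_eq_zero_mul' (f := fun k : ℕ => (1 - (r : ℂ) ^ (2 * (k + 1)) * z)) (by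
    have := multipliable_eulerProd hr0 hr1 ((r : ℂ) ^ 2 * z)
    refine this.congr fun k => ?_
    ring)
  rw [eulerProd, h, eulerProd]
  congr 1
  refine tprod_congr fun k => ?_
  ring

lemma eulerProd_ne_zero (hr0 : 0 < r) (hr1 : r < 1) {z : ℂ} (hz : r ^ 2 * ‖z‖ < 1) :
    eulerProd r z ≠ 0 := by
  unfold eulerProd
  simp_rw [sub_eq_add_neg]
  refine tprod_one_add_ne_zero_of_summable (fun k h => ?_) ?_
  · have h1 : ‖-((r : ℂ) ^ (2 * (k + 1)) * z)‖ < 1 := by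
      rw [norm_eulerProd_factor hr0]
      have h2 : r ^ (2 * (k + 1)) ≤ r ^ 2 := pow_le_pow_of_le_one hr0.le hr1.le (by omega)
      exact lt_of_le_of_lt (mul_le_mul_of_nonneg_right h2 (norm_nonneg z)) hz
    rw [add_eq_zero_iff_neg_eq] at h
    rw [← h] at h1
    simp at h1
  · simp_rw [norm_eulerProd_factor hr0]
    exact summable_pow_two_mul hr0 hr1 _

lemma eulerProd_conj (hr0 : 0 < r) (hr1 : r < 1) (z : ℂ) :
    eulerProd r ((starRingEnd ℂ) z) = (starRingEnd ℂ) (eulerProd r z) := by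
  unfold eulerProd
  have h := (multipliable_eulerProd hr0 hr1 z).map_tprod (starRingEnd ℂ) Complex.continuous_conj
  rw [h]
  refine tprod_congr fun k => ?_
  simp

lemma theta_eq (hr0 : 0 < r) (hr1 : r < 1) (z : ℂ) :
    theta r z = eulerProd r 1 * (1 - 1 / z) * (eulerProd r z * eulerProd r (1 / z)) := by
  have h := (multipliable_eulerProd hr0 hr1 z).tprod_mul (multipliable_eulerProd hr0 hr1 (1 / z))
  have h' : (∏' k : ℕ, ((1 - (r : ℂ) ^ (2 * (k + 1)) * z) * (1 - (r : ℂ) ^ (2 * (k + 1)) / z)))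
      = eulerProd r z * eulerProd r (1 / z) := by
    rw [eulerProd, eulerProd, ← h]
    refine tprod_congr fun k => ?_
    rw [mul_one_div]
  rw [theta, h']
  simp only [eulerProd, mul_one]

lemma differentiableAt_theta (hr0 : 0 < r) (hr1 : r < 1) {z : ℂ} (hz : z ≠ 0) :
    DifferentiableAt ℂ (theta r) z := by
  have h : theta r = fun z => eulerProd r 1 * (1 - 1 / z) * (eulerProd r z * eulerProd r (1 / z)) :=
    funext (theta_eq hr0 hr1)
  rw [h]
  have h1 : DifferentiableAt ℂ (fun z : ℂ => 1 / z) z := by fun_prop (disch := assumption)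
  have h2 := (differentiable_eulerProd hr0 hr1).differentiableAt (x := 1 / z)
  have h3 : DifferentiableAt ℂ (fun z => eulerProd r (1 / z)) z := h2.comp z h1
  have h4 := (differentiable_eulerProd hr0 hr1).differentiableAt (x := z)
  fun_prop

lemma theta_inv (hr0 : 0 < r) (hr1 : r < 1) {z : ℂ} (hz : z ≠ 0) :
    theta r (1 / z) = -z * theta r z := by
  rw [theta_eq hr0 hr1, theta_eq hr0 hr1]
  field_simp
  ring

/-- Quasi-periodicity of the theta function. -/
lemma theta_sq_mul (hr0 : 0 < r) (hr1 : r < 1) {z : ℂ} (hz : z ≠ 0) :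
    theta r ((r : ℂ) ^ 2 * z) = -theta r z / ((r : ℂ) ^ 2 * z) := by
  have hr : (r : ℂ) ≠ 0 := by exact_mod_cast hr0.ne'
  rw [theta_eq hr0 hr1, theta_eq hr0 hr1, eulerProd_rec hr0 hr1 z,
    eulerProd_rec hr0 hr1 (1 / ((r : ℂ) ^ 2 * z))]
  have h : (r : ℂ) ^ 2 * (1 / ((r : ℂ) ^ 2 * z)) = 1 / z := by field_simp
  rw [h]
  field_simp
  ring

lemma deriv_theta_sq_mul (hr0 : 0 < r) (hr1 : r < 1) {z : ℂ} (hz : z ≠ 0) :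
    (r : ℂ) ^ 2 * z * deriv (theta r) ((r : ℂ) ^ 2 * z)
      = (theta r z - z * deriv (theta r) z) / ((r : ℂ) ^ 2 * z) := by
  have hr : (r : ℂ) ≠ 0 := by exact_mod_cast hr0.ne'
  have hrz : (r : ℂ) ^ 2 * z ≠ 0 := by positivity
  have h1 : HasDerivAt (fun w => theta r ((r : ℂ) ^ 2 * w))
      (deriv (theta r) ((r : ℂ) ^ 2 * z) * ((r : ℂ) ^ 2 * 1)) z :=
    (differentiableAt_theta hr0 hr1 hrz).hasDerivAt.comp z ((hasDerivAt_id z).const_mul _)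
  have h2 : HasDerivAt (fun w => -theta r w / ((r : ℂ) ^ 2 * w))
      ((-deriv (theta r) z * ((r : ℂ) ^ 2 * z) - -theta r z * ((r : ℂ) ^ 2 * 1))
        / ((r : ℂ) ^ 2 * z) ^ 2) z :=
    (differentiableAt_theta hr0 hr1 hz).hasDerivAt.neg.div ((hasDerivAt_id z).const_mul _) hrz
  have h3 : (fun w => theta r ((r : ℂ) ^ 2 * w)) =ᶠ[𝓝 z]
      fun w => -theta r w / ((r : ℂ) ^ 2 * w) := by
    filter_upwards [isOpen_ne.mem_nhds hz] with w hw using theta_sq_mul hr0 hr1 hw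
  have h4 := h1.unique (h2.congr_of_eventuallyEq h3)
  have h5 : (r : ℂ) ^ 2 * z * deriv (theta r) ((r : ℂ) ^ 2 * z)
      = z * (deriv (theta r) ((r : ℂ) ^ 2 * z) * ((r : ℂ) ^ 2 * 1)) := by ring
  rw [h5, h4]
  field_simp
  ring

lemma theta_eq_zero_iff (hr0 : 0 < r) (hr1 : r < 1) {z : ℂ} (h1 : r ^ 2 < ‖z‖)
    (h2 : r ^ 2 * ‖z‖ < 1) : theta r z = 0 ↔ z = 1 := by
  have hz : 0 < ‖z‖ := lt_trans (by positivity) h1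
  have hz0 : z ≠ 0 := norm_pos_iff.mp hz
  have e1 : eulerProd r 1 ≠ 0 := eulerProd_ne_zero hr0 hr1 (by rw [norm_one]; nlinarith)
  have e2 : eulerProd r z ≠ 0 := eulerProd_ne_zero hr0 hr1 h2
  have e3 : eulerProd r (1 / z) ≠ 0 := eulerProd_ne_zero hr0 hr1 (by
    rw [norm_div, norm_one, mul_one_div, div_lt_one hz]; exact h1)
  rw [theta_eq hr0 hr1]
  simp only [mul_eq_zero, e1, e2, e3, or_self, or_false, false_or, sub_eq_zero]
  rw [eq_div_iff hz0, one_mul]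

lemma theta_one (hr0 : 0 < r) (hr1 : r < 1) : theta r 1 = 0 := by
  simp [theta_eq hr0 hr1]

lemma deriv_theta_one (hr0 : 0 < r) (hr1 : r < 1) :
    deriv (theta r) 1 = eulerProd r 1 ^ 3 := by
  have h : theta r = fun z => (1 - 1 / z) * (eulerProd r 1 * (eulerProd r z * eulerProd r (1 / z))) := by
    funext z
    rw [theta_eq hr0 hr1]
    ring
  have hd : ∀ z, DifferentiableAt ℂ (eulerProd r) z := differentiable_eulerProd hr0 hr1
  have h1 : HasDerivAt (fun z : ℂ => 1 - 1 / z) 1 1 := by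
    have := ((hasDerivAt_inv (one_ne_zero : (1 : ℂ) ≠ 0)).const_sub 1)
    simpa using this
  have h2 : DifferentiableAt ℂ (fun z : ℂ => 1 / z) 1 := by
    fun_prop (disch := norm_num)
  have h3 : DifferentiableAt ℂ (fun z => eulerProd r (1 / z)) 1 := (hd (1 / 1)).comp 1 h2
  have h4 : DifferentiableAt ℂ (fun z => eulerProd r 1 * (eulerProd r z * eulerProd r (1 / z))) 1 :=
    ((hd 1).mul h3).const_mul _
  rw [h, (h1.fun_mul h4.hasDerivAt).deriv]
  simp
  ring

lemma theta_conj (hr0 : 0 < r) (hr1 : r < 1) (z : ℂ) :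
    theta r ((starRingEnd ℂ) z) = (starRingEnd ℂ) (theta r z) := by
  rw [theta_eq hr0 hr1, theta_eq hr0 hr1]
  have h1 : (1 : ℂ) / (starRingEnd ℂ) z = (starRingEnd ℂ) (1 / z) := by simp
  have h2 : eulerProd r 1 = (starRingEnd ℂ) (eulerProd r 1) := by
    rw [← eulerProd_conj hr0 hr1, map_one]
  rw [h1, eulerProd_conj hr0 hr1, eulerProd_conj hr0 hr1]
  simp only [map_mul, map_sub, map_one]
  rw [← h2]

lemma deriv_theta_conj (hr0 : 0 < r) (hr1 : r < 1) (z : ℂ) :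
    deriv (theta r) ((starRingEnd ℂ) z) = (starRingEnd ℂ) (deriv (theta r) z) := by
  have h : theta r = (starRingEnd ℂ) ∘ theta r ∘ (starRingEnd ℂ) := by
    funext w
    simp [theta_conj hr0 hr1]
  conv_lhs => rw [h, deriv_conj_conj]
  simp

/-- The Euler product is positive on the real interval `[0, 1/r²)`. -/
lemma exists_eulerProd_ofReal (hr0 : 0 < r) (hr1 : r < 1) {x : ℝ} (hx0 : 0 ≤ x)
    (hx : r ^ 2 * x < 1) : ∃ t : ℝ, 0 < t ∧ eulerProd r x = t := by
  have hne := eulerProd_ne_zero hr0 hr1 (z := x) (by simpa [abs_of_nonneg hx0] using hx)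
  have hm := multipliable_eulerProd hr0 hr1 (x : ℂ)
  have hlim := hm.hasProd.tendsto_prod_nat
  have hre := (Complex.continuous_re.tendsto _).comp hlim
  have him : (eulerProd r x).im = 0 := by
    rw [← Complex.conj_eq_iff_im, ← eulerProd_conj hr0 hr1, Complex.conj_ofReal]
  have h0 : 0 ≤ (eulerProd r x).re := by
    refine ge_of_tendsto' hre fun n => ?_
    have : (∏ k ∈ Finset.range n, (1 - (r : ℂ) ^ (2 * (k + 1)) * x))
        = ((∏ k ∈ Finset.range n, (1 - r ^ (2 * (k + 1)) * x) : ℝ) : ℂ) := by push_cast; rfl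
    simp only [Function.comp_apply, this, Complex.ofReal_re]
    refine Finset.prod_nonneg fun k _ => ?_
    have : r ^ (2 * (k + 1)) ≤ r ^ 2 := pow_le_pow_of_le_one hr0.le hr1.le (by omega)
    nlinarith
  have heq : eulerProd r x = ((eulerProd r x).re : ℂ) := Complex.ext (by simp) (by simp [him])
  refine ⟨(eulerProd r x).re, lt_of_le_of_ne h0 fun h => hne ?_, heq⟩
  rw [heq, ← h]
  simp

lemma exists_deriv_theta_one (hr0 : 0 < r) (hr1 : r < 1) :
    ∃ t : ℝ, 0 < t ∧ deriv (theta r) 1 = t := by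
  obtain ⟨t, ht, h⟩ := exists_eulerProd_ofReal hr0 hr1 (x := 1) (by norm_num) (by nlinarith)
  refine ⟨t ^ 3, by positivity, ?_⟩
  rw [deriv_theta_one hr0 hr1, ← Complex.ofReal_one, h]
  push_cast
  rfl

lemma exists_theta_neg (hr0 : 0 < r) (hr1 : r < 1) {x : ℝ} (hx : r ^ 2 < x) (hx1 : x < 1) :
    ∃ t : ℝ, t < 0 ∧ theta r x = t := by
  have hx0 : 0 < x := lt_trans (by positivity) hx
  obtain ⟨t, ht, h⟩ := exists_eulerProd_ofReal hr0 hr1 (x := 1) (by norm_num) (by nlinarith)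
  obtain ⟨t', ht', h'⟩ := exists_eulerProd_ofReal hr0 hr1 (x := x) hx0.le (by nlinarith)
  obtain ⟨s, hs, h''⟩ := exists_eulerProd_ofReal hr0 hr1 (x := 1 / x) (by positivity)
    (by rw [mul_one_div, div_lt_one hx0]; exact hx)
  refine ⟨t * (1 - 1 / x) * (t' * s), ?_, ?_⟩
  · have : 1 - 1 / x < 0 := by rw [sub_neg, lt_div_iff₀ hx0]; linarith
    exact mul_neg_of_neg_of_pos (mul_neg_of_pos_of_neg ht this) (by positivity)
  · rw [theta_eq hr0 hr1]
    push_cast at h h''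
    rw [h, h', h'']
    push_cast
    rfl

lemma exists_theta_ofReal (hr0 : 0 < r) (hr1 : r < 1) (x : ℝ) : ∃ t : ℝ, theta r x = t := by
  have h := theta_conj hr0 hr1 x
  rw [Complex.conj_ofReal] at h
  obtain ⟨t, ht⟩ := Complex.conj_eq_iff_real.mp h.symm
  exact ⟨t, ht⟩

end

/-! ### Liouville's theorem on the torus and the product formula for `q` -/

section

variable {r : ℝ}

/-- A property invariant under `z ↦ r² z` holds on the punctured plane as soon as it holds on the
fundamental annulus `r < |z| ≤ 1 / r`. -/
lemma annular_induction (hr0 : 0 < r) (hr1 : r < 1) {p : ℂ → Prop}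
    (hp : ∀ z ≠ 0, (p z ↔ p ((r : ℂ) ^ 2 * z)))
    (h0 : ∀ z : ℂ, r < ‖z‖ → ‖z‖ ≤ 1 / r → p z) : ∀ z ≠ 0, p z := by
  have hr : (r : ℂ) ≠ 0 := by exact_mod_cast hr0.ne'
  have hpow : ∀ (n : ℤ) (z : ℂ), z ≠ 0 → (p z ↔ p (((r : ℂ) ^ 2) ^ n * z)) := by
    intro n
    induction n using Int.induction_on with
    | zero => intro z _; simp
    | succ n ih =>
      intro z hz
      rw [ih z hz, hp _ (by positivity), zpow_add₀ (by positivity), zpow_one, ← mul_assoc,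
        mul_comm ((r : ℂ) ^ 2)]
    | pred n ih =>
      intro z hz
      rw [ih z hz, hp (((r : ℂ) ^ 2) ^ (-(n : ℤ) - 1) * z) (by positivity), zpow_sub₀ (by positivity),
        zpow_one]
      have : (r : ℂ) ^ 2 * (((r : ℂ) ^ 2) ^ (-(n : ℤ)) / (r : ℂ) ^ 2 * z)
        = ((r : ℂ) ^ 2) ^ (-(n : ℤ)) * z := by field_simp
      rw [this]
  intro z hz
  have hy : 1 < 1 / r ^ 2 := by
    rw [lt_div_iff₀ (by positivity)]; nlinarith
  obtain ⟨n, hn1, hn2⟩ := exists_mem_Ioc_zpow (div_pos (norm_pos_iff.mpr hz) hr0) hy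
  have hnorm : ‖((r : ℂ) ^ 2) ^ n * z‖ = (r ^ 2) ^ n * ‖z‖ := by
    simp [abs_of_pos hr0]
  have hpos : 0 < (r ^ 2) ^ n := by positivity
  rw [one_div, inv_zpow, lt_div_iff₀ hr0, inv_mul_lt_iff₀ hpos] at hn1
  rw [one_div, zpow_add₀ (by positivity), zpow_one, inv_zpow, div_le_iff₀ hr0, mul_assoc,
    le_inv_mul_iff₀ hpos] at hn2
  refine (hpow n z hz).mpr (h0 _ (by rw [hnorm]; exact hn1) ?_)
  rw [hnorm]
  refine hn2.trans (le_of_eq ?_)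
  field_simp

/-- Liouville's theorem for the torus `ℂˣ / r^{2ℤ}`; the classical theorem is applied to `h ∘ exp`. -/
lemma eq_of_differentiableOn_of_periodic (hr0 : 0 < r) (hr1 : r < 1) {h : ℂ → ℂ}
    (hd : DifferentiableOn ℂ h {0}ᶜ) (hp : ∀ z ≠ 0, h ((r : ℂ) ^ 2 * z) = h z) :
    ∀ z ≠ 0, ∀ w ≠ 0, h z = h w := by
  have hK : IsCompact (Metric.closedBall (0 : ℂ) (1 / r) \ Metric.ball 0 r) :=
    (isCompact_closedBall _ _).diff Metric.isOpen_ball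
  obtain ⟨C, hC⟩ := hK.exists_bound_of_continuousOn (f := h) (hd.continuousOn.mono fun z hz => by
    rintro rfl
    exact hz.2 (Metric.mem_ball_self hr0))
  have hb : ∀ z ≠ 0, ‖h z‖ ≤ C := by
    refine annular_induction hr0 hr1 (fun z hz => by rw [hp z hz]) fun z h1 h2 => hC z ⟨?_, ?_⟩
    · simpa using h2
    · simpa using h1.le
  have he : Differentiable ℂ (fun w => h (Complex.exp w)) := fun w =>
    (hd.differentiableAt (isOpen_compl_singleton.mem_nhds (Complex.exp_ne_zero w))).comp w
      Complex.differentiable_exp.differentiableAt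
  have hbd : Bornology.IsBounded (Set.range fun w => h (Complex.exp w)) := by
    refine (Metric.isBounded_closedBall (x := (0 : ℂ)) (r := C)).subset ?_
    rintro _ ⟨w, rfl⟩
    simpa using hb _ (Complex.exp_ne_zero w)
  intro z hz w hw
  have := he.apply_eq_apply_of_bounded hbd (Complex.log z) (Complex.log w)
  simpa [Complex.exp_log hz, Complex.exp_log hw] using this

/-- A holomorphic function is divisible by another one that has only simple zeros and whose zeros
it shares. -/
lemma exists_differentiableOn_mul_eq {N D : ℂ → ℂ} {U : Set ℂ} (hU : IsOpen U)
    (hN : DifferentiableOn ℂ N U) (hD : DifferentiableOn ℂ D U)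
    (h0 : ∀ z ∈ U, D z = 0 → N z = 0 ∧ deriv D z ≠ 0) :
    ∃ h : ℂ → ℂ, DifferentiableOn ℂ h U ∧ ∀ z ∈ U, N z = h z * D z := by
  classical
  refine ⟨fun z => if D z = 0 then deriv N z / deriv D z else N z / D z, ?_, ?_⟩
  · intro z hz
    refine DifferentiableAt.differentiableWithinAt ?_
    have hUz := hU.mem_nhds hz
    by_cases hDz : D z = 0
    · obtain ⟨hNz, hD'⟩ := h0 z hz hDz
      have dN : DifferentiableAt ℂ (dslope N z) z :=
        ((Complex.differentiableOn_dslope hUz).mpr hN).differentiableAt hUz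
      have dD : DifferentiableAt ℂ (dslope D z) z :=
        ((Complex.differentiableOn_dslope hUz).mpr hD).differentiableAt hUz
      have hDs : dslope D z z ≠ 0 := by rwa [dslope_same]
      refine (dN.div dD hDs).congr_of_eventuallyEq ?_
      filter_upwards [dD.continuousAt.eventually_ne hDs] with w hw
      by_cases hwz : w = z
      · subst hwz
        simp [hDz]
      · have hw0 : w - z ≠ 0 := sub_ne_zero.mpr hwz
        have eD : D w = (w - z) * dslope D z w := by
          have := sub_smul_dslope D z w
          rw [hDz, sub_zero, smul_eq_mul] at this
          exact this.symm
        have eN : N w = (w - z) * dslope N z w := by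
          have := sub_smul_dslope N z w
          rw [hNz, sub_zero, smul_eq_mul] at this
          exact this.symm
        have hDw : D w ≠ 0 := by rw [eD]; exact mul_ne_zero hw0 hw
        rw [if_neg hDw, eD, eN, Pi.div_apply]
        field_simp
    · have dN := hN.differentiableAt hUz
      have dD := hD.differentiableAt hUz
      refine (dN.div dD hDz).congr_of_eventuallyEq ?_
      filter_upwards [dD.continuousAt.eventually_ne hDz] with w hw
      rw [if_neg hw, Pi.div_apply]
  · intro z hz
    by_cases hDz : D z = 0
    · simp [hDz, (h0 z hz hDz).1]
    · simp [hDz]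

/-- The product `θ(y/z) θ(yz)`; its quotients are the functions of degree two on the torus that are
invariant under `z ↦ 1/z`. -/
noncomputable def thetaPair (r y : ℝ) (z : ℂ) : ℂ := theta r (y / z) * theta r (y * z)

/-- The numerator of `x (q_x - c)` over the denominator `θ(x/z) θ(xz)`. -/
noncomputable def qNum (r x : ℝ) (c z : ℂ) : ℂ :=
  -(x / z * deriv (theta r) (x / z) * theta r (x * z)
    + x * z * deriv (theta r) (x * z) * theta r (x / z)) - x * c * thetaPair r x z

lemma qNum_eq {x : ℝ} (hx : x ≠ 0) (c : ℂ) {z : ℂ} (hz : z ≠ 0) (h : thetaPair r x z ≠ 0) :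
    qNum r x c z = x * (q r x z - c) * thetaPair r x z := by
  have h1 : theta r (x / z) ≠ 0 := left_ne_zero_of_mul h
  have h2 : theta r (x * z) ≠ 0 := right_ne_zero_of_mul h
  have hx' : (x : ℂ) ≠ 0 := by exact_mod_cast hx
  rw [qNum, q, thetaPair]
  field_simp
  ring

lemma q_inv (x : ℝ) (z : ℂ) : q r x (1 / z) = q r x z := by
  rw [q, q]
  simp only [div_div_eq_mul_div, div_one, mul_one_div]
  rcases eq_or_ne z 0 with rfl | hz
  · simp
  · field_simp
    ring

lemma thetaPair_inv (x : ℝ) (z : ℂ) : thetaPair r x (1 / z) = thetaPair r x z := by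
  rw [thetaPair, thetaPair]
  simp only [div_div_eq_mul_div, div_one, mul_one_div]
  ring

lemma qNum_inv (x : ℝ) (c z : ℂ) : qNum r x c (1 / z) = qNum r x c z := by
  rw [qNum, qNum, thetaPair_inv]
  simp only [div_div_eq_mul_div, div_one, mul_one_div]
  ring

lemma theta_div_sq (hr0 : 0 < r) (hr1 : r < 1) {w : ℂ} (hw : w ≠ 0) :
    theta r (w / (r : ℂ) ^ 2) = -w * theta r w := by
  have hr : (r : ℂ) ≠ 0 := by exact_mod_cast hr0.ne'
  have h := theta_sq_mul hr0 hr1 (z := w / (r : ℂ) ^ 2) (by positivity)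
  have e : (r : ℂ) ^ 2 * (w / (r : ℂ) ^ 2) = w := by field_simp
  rw [e] at h
  rw [h]
  field_simp

lemma deriv_theta_div_sq (hr0 : 0 < r) (hr1 : r < 1) {w : ℂ} (hw : w ≠ 0) :
    w / (r : ℂ) ^ 2 * deriv (theta r) (w / (r : ℂ) ^ 2)
      = -w * (theta r w + w * deriv (theta r) w) := by
  have hr : (r : ℂ) ≠ 0 := by exact_mod_cast hr0.ne'
  have h := deriv_theta_sq_mul hr0 hr1 (z := w / (r : ℂ) ^ 2) (by positivity)
  have e : (r : ℂ) ^ 2 * (w / (r : ℂ) ^ 2) = w := by field_simp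
  rw [e, theta_div_sq hr0 hr1 hw, eq_div_iff hw] at h
  linear_combination h

lemma thetaPair_sq_mul (hr0 : 0 < r) (hr1 : r < 1) {x : ℝ} (hx : x ≠ 0) {z : ℂ} (hz : z ≠ 0) :
    thetaPair r x ((r : ℂ) ^ 2 * z) = thetaPair r x z / ((r : ℂ) ^ 2 * z ^ 2) := by
  have hr : (r : ℂ) ≠ 0 := by exact_mod_cast hr0.ne'
  have hx' : (x : ℂ) ≠ 0 := by exact_mod_cast hx
  have e1 : (x : ℂ) / ((r : ℂ) ^ 2 * z) = x / z / (r : ℂ) ^ 2 := by field_simp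
  have e2 : (x : ℂ) * ((r : ℂ) ^ 2 * z) = (r : ℂ) ^ 2 * (x * z) := by ring
  rw [thetaPair, thetaPair, e1, e2, theta_div_sq hr0 hr1 (by positivity),
    theta_sq_mul hr0 hr1 (by positivity)]
  field_simp

lemma qNum_sq_mul (hr0 : 0 < r) (hr1 : r < 1) {x : ℝ} (hx : x ≠ 0) (c : ℂ) {z : ℂ} (hz : z ≠ 0) :
    qNum r x c ((r : ℂ) ^ 2 * z) = qNum r x c z / ((r : ℂ) ^ 2 * z ^ 2) := by
  have hr : (r : ℂ) ≠ 0 := by exact_mod_cast hr0.ne'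
  have hx' : (x : ℂ) ≠ 0 := by exact_mod_cast hx
  have e1 : (x : ℂ) / ((r : ℂ) ^ 2 * z) = x / z / (r : ℂ) ^ 2 := by field_simp
  have e2 : (x : ℂ) * ((r : ℂ) ^ 2 * z) = (r : ℂ) ^ 2 * (x * z) := by ring
  rw [qNum, qNum, thetaPair_sq_mul hr0 hr1 hx hz, e1, e2,
    deriv_theta_div_sq hr0 hr1 (by positivity), deriv_theta_sq_mul hr0 hr1 (by positivity),
    theta_div_sq hr0 hr1 (by positivity), theta_sq_mul hr0 hr1 (by positivity)]
  field_simp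
  ring

lemma differentiableAt_theta_div (hr0 : 0 < r) (hr1 : r < 1) {x : ℝ} (hx : x ≠ 0) {z : ℂ}
    (hz : z ≠ 0) : DifferentiableAt ℂ (fun z : ℂ => theta r (x / z)) z := by
  have hx' : (x : ℂ) ≠ 0 := by exact_mod_cast hx
  have h1 : DifferentiableAt ℂ (fun z : ℂ => (x : ℂ) / z) z := by fun_prop (disch := assumption)
  exact (differentiableAt_theta hr0 hr1 (by positivity : (x : ℂ) / z ≠ 0)).comp z h1

lemma differentiableAt_theta_mul (hr0 : 0 < r) (hr1 : r < 1) {x : ℝ} (hx : x ≠ 0) {z : ℂ}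
    (hz : z ≠ 0) : DifferentiableAt ℂ (fun z : ℂ => theta r (x * z)) z := by
  have hx' : (x : ℂ) ≠ 0 := by exact_mod_cast hx
  have h1 : DifferentiableAt ℂ (fun z : ℂ => (x : ℂ) * z) z := by fun_prop
  exact (differentiableAt_theta hr0 hr1 (by positivity : (x : ℂ) * z ≠ 0)).comp z h1

lemma differentiableAt_thetaPair (hr0 : 0 < r) (hr1 : r < 1) {x : ℝ} (hx : x ≠ 0) {z : ℂ}
    (hz : z ≠ 0) : DifferentiableAt ℂ (thetaPair r x) z :=
  (differentiableAt_theta_div hr0 hr1 hx hz).mul (differentiableAt_theta_mul hr0 hr1 hx hz)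

lemma differentiableAt_deriv_theta (hr0 : 0 < r) (hr1 : r < 1) {z : ℂ} (hz : z ≠ 0) :
    DifferentiableAt ℂ (deriv (theta r)) z := by
  have h : DifferentiableOn ℂ (theta r) {0}ᶜ := fun w hw =>
    (differentiableAt_theta hr0 hr1 hw).differentiableWithinAt
  exact (h.deriv isOpen_compl_singleton).differentiableAt (isOpen_compl_singleton.mem_nhds hz)

lemma differentiableAt_qNum (hr0 : 0 < r) (hr1 : r < 1) {x : ℝ} (hx : x ≠ 0) (c : ℂ) {z : ℂ}
    (hz : z ≠ 0) : DifferentiableAt ℂ (qNum r x c) z := by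
  have hx' : (x : ℂ) ≠ 0 := by exact_mod_cast hx
  have h1 : DifferentiableAt ℂ (fun z : ℂ => (x : ℂ) / z) z := by fun_prop (disch := assumption)
  have h2 : DifferentiableAt ℂ (fun z : ℂ => (x : ℂ) * z) z := by fun_prop
  have h3 : DifferentiableAt ℂ (fun z : ℂ => deriv (theta r) (x / z)) z :=
    (differentiableAt_deriv_theta hr0 hr1 (by positivity : (x : ℂ) / z ≠ 0)).comp z h1
  have h4 : DifferentiableAt ℂ (fun z : ℂ => deriv (theta r) (x * z)) z :=
    (differentiableAt_deriv_theta hr0 hr1 (by positivity : (x : ℂ) * z ≠ 0)).comp z h2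
  have h5 := differentiableAt_theta_div hr0 hr1 hx hz
  have h6 := differentiableAt_theta_mul hr0 hr1 hx hz
  have h7 := differentiableAt_thetaPair hr0 hr1 hx hz
  unfold qNum
  fun_prop

/-- A neighbourhood of the closed annulus in which `θ(xz)` has no zeros and `θ(x/z)` vanishes at
`x` only. -/
def dom (r x : ℝ) : Set ℂ := {z | r ^ 2 < |x| * ‖z‖ ∧ |x| * ‖z‖ < 1}

lemma isOpen_dom (r x : ℝ) : IsOpen (dom r x) := by
  have h1 : IsOpen {z : ℂ | r ^ 2 < |x| * ‖z‖} := isOpen_lt continuous_const (by fun_prop)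
  have h2 : IsOpen {z : ℂ | |x| * ‖z‖ < 1} := isOpen_lt (by fun_prop) continuous_const
  exact h1.inter h2

lemma mem_dom_of_mem_closure (hr0 : 0 < r) {x : ℝ} (hx : x ∈ Set.Ioo (-1) (-r))
    {z : ℂ} (h1 : r ≤ ‖z‖) (h2 : ‖z‖ ≤ 1) : z ∈ dom r x := by
  have hx0 : x < 0 := by linarith [hx.2]
  have hx1 : |x| < 1 := by rw [abs_of_neg hx0]; linarith [hx.1]
  have hx2 : r < |x| := by rw [abs_of_neg hx0]; linarith [hx.2]
  constructor
  · nlinarith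
  · nlinarith

lemma mem_dom_self (hr0 : 0 < r) {x y : ℝ} (hx : x ∈ Set.Ioo (-1) (-r))
    (hy : y ∈ Set.Ioo (-1) (-r)) : (y : ℂ) ∈ dom r x := by
  have hy0 : y < 0 := by linarith [hy.2]
  have e : ‖(y : ℂ)‖ = -y := by rw [Complex.norm_real, Real.norm_eq_abs, abs_of_neg hy0]
  exact mem_dom_of_mem_closure hr0 hx (by rw [e]; linarith [hy.2]) (by rw [e]; linarith [hy.1])

lemma ne_zero_of_mem_dom {x : ℝ} {z : ℂ} (hz : z ∈ dom r x) : z ≠ 0 := by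
  rintro rfl
  have := hz.1
  simp only [norm_zero, mul_zero] at this
  nlinarith [sq_nonneg r]

lemma ne_zero_of_mem_Ioo (hr0 : 0 < r) {x : ℝ} (hx : x ∈ Set.Ioo (-1) (-r)) : x ≠ 0 := by
  have := hx.2
  intro h
  linarith

lemma theta_mul_ne_zero (hr0 : 0 < r) (hr1 : r < 1) {x : ℝ} {z : ℂ} (hz : z ∈ dom r x) :
    theta r (x * z) ≠ 0 := by
  have e : ‖(x : ℂ) * z‖ = |x| * ‖z‖ := by simp
  have h := theta_eq_zero_iff hr0 hr1 (z := x * z) (by rw [e]; exact hz.1)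
    (by rw [e]; nlinarith [hz.1, hz.2])
  intro h0
  have h2 := hz.2
  rw [← e, h.mp h0] at h2
  simp at h2

lemma theta_div_eq_zero_iff (hr0 : 0 < r) (hr1 : r < 1) {x : ℝ} (hx : x ∈ Set.Ioo (-1) (-r)) {z : ℂ}
    (hz : z ∈ dom r x) : theta r (x / z) = 0 ↔ z = x := by
  have hz0 := ne_zero_of_mem_dom hz
  have hpos : 0 < ‖z‖ := norm_pos_iff.mpr hz0
  have hx0 : x < 0 := by linarith [hx.2]
  have e : ‖(x : ℂ) / z‖ = -x / ‖z‖ := by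
    rw [norm_div, Complex.norm_real, Real.norm_eq_abs, abs_of_neg hx0]
  have h1 := hz.1
  have h2 := hz.2
  rw [abs_of_neg hx0] at h1 h2
  have hx1 := hx.1
  have hx2 := hx.2
  have hzu : ‖z‖ < 1 / -x := by rw [lt_div_iff₀ (by linarith)]; linarith
  rw [theta_eq_zero_iff hr0 hr1 (by
      rw [e, lt_div_iff₀ hpos]
      -- `r² |z| < x² |z| < |x|`
      have h3 : r ^ 2 < x ^ 2 := by nlinarith
      nlinarith)
    (by
      rw [e, mul_div_assoc', div_lt_one hpos]
      have : r ^ 2 * -x < r ^ 2 := by nlinarith [pow_pos hr0 2]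
      nlinarith), div_eq_one_iff_eq hz0, eq_comm]

lemma thetaPair_eq_zero_iff (hr0 : 0 < r) (hr1 : r < 1) {x : ℝ} (hx : x ∈ Set.Ioo (-1) (-r)) {z : ℂ}
    (hz : z ∈ dom r x) : thetaPair r x z = 0 ↔ z = x := by
  rw [thetaPair, mul_eq_zero, theta_div_eq_zero_iff hr0 hr1 hx hz]
  simp [theta_mul_ne_zero hr0 hr1 hz]

lemma hasDerivAt_theta_div (hr0 : 0 < r) (hr1 : r < 1) {x : ℝ} (hx : x ≠ 0) {z : ℂ}
    (hz : z ≠ 0) : HasDerivAt (fun z : ℂ => theta r (x / z))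
      (-(x / z * deriv (theta r) (x / z)) / z) z := by
  have hx' : (x : ℂ) ≠ 0 := by exact_mod_cast hx
  have h1 : HasDerivAt (fun z : ℂ => (x : ℂ) / z) (-x / z ^ 2) z := by
    simpa [div_eq_mul_inv] using (hasDerivAt_inv hz).const_mul (x : ℂ)
  have h2 := (differentiableAt_theta hr0 hr1 (by positivity : (x : ℂ) / z ≠ 0)).hasDerivAt.comp z h1
  refine h2.congr_deriv ?_
  field_simp

lemma hasDerivAt_theta_mul (hr0 : 0 < r) (hr1 : r < 1) {x : ℝ} (hx : x ≠ 0) {z : ℂ}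
    (hz : z ≠ 0) : HasDerivAt (fun z : ℂ => theta r (x * z))
      (x * z * deriv (theta r) (x * z) / z) z := by
  have hx' : (x : ℂ) ≠ 0 := by exact_mod_cast hx
  have h1 : HasDerivAt (fun z : ℂ => (x : ℂ) * z) (x * 1) z := (hasDerivAt_id z).const_mul _
  have h2 := (differentiableAt_theta hr0 hr1 (by positivity : (x : ℂ) * z ≠ 0)).hasDerivAt.comp z h1
  refine h2.congr_deriv ?_
  field_simp

lemma hasDerivAt_thetaPair (hr0 : 0 < r) (hr1 : r < 1) {x : ℝ} (hx : x ≠ 0) {z : ℂ}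
    (hz : z ≠ 0) : HasDerivAt (thetaPair r x)
      ((x * z * deriv (theta r) (x * z) * theta r (x / z)
        - x / z * deriv (theta r) (x / z) * theta r (x * z)) / z) z := by
  refine ((hasDerivAt_theta_div hr0 hr1 hx hz).mul (hasDerivAt_theta_mul hr0 hr1 hx hz)).congr_deriv
    ?_
  ring

lemma theta_mul_self_ne_zero (hr0 : 0 < r) (hr1 : r < 1) {x y : ℝ} (hx : x ∈ Set.Ioo (-1) (-r))
    (hy : y ∈ Set.Ioo (-1) (-r)) : theta r ((x : ℂ) * y) ≠ 0 :=
  theta_mul_ne_zero hr0 hr1 (mem_dom_self hr0 hx hy)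

lemma deriv_theta_one_ne_zero (hr0 : 0 < r) (hr1 : r < 1) : deriv (theta r) 1 ≠ 0 := by
  obtain ⟨t, ht, h⟩ := exists_deriv_theta_one hr0 hr1
  rw [h]
  exact_mod_cast ht.ne'

/-- The zeros of `θ(y/z) θ(yz)` are simple, and the numerator of `q_x - q_x(y)` vanishes there. It is
enough to check this at `y` and `1/y`, the only zeros in a fundamental annulus. -/
lemma zeros_thetaPair (hr0 : 0 < r) (hr1 : r < 1) {x y : ℝ} (hx : x ∈ Set.Ioo (-1) (-r))
    (hy : y ∈ Set.Ioo (-1) (-r)) (hxy : x ≠ y) :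
    ∀ z ≠ 0, thetaPair r y z = 0 → qNum r x (q r x y) z = 0 ∧ deriv (thetaPair r y) z ≠ 0 := by
  have hr : (r : ℂ) ≠ 0 := by exact_mod_cast hr0.ne'
  have hx0 : x ≠ 0 := ne_zero_of_mem_Ioo hr0 hx
  have hy0 : y ≠ 0 := ne_zero_of_mem_Ioo hr0 hy
  have hy0' : (y : ℂ) ≠ 0 := by exact_mod_cast hy0
  have hyneg : y < 0 := by linarith [hy.2]
  have hNy : qNum r x (q r x y) y = 0 := by
    rw [qNum_eq hx0 _ hy0', sub_self, mul_zero, zero_mul]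
    rw [Ne, thetaPair_eq_zero_iff hr0 hr1 hx (mem_dom_self hr0 hx hy)]
    exact_mod_cast hxy.symm
  have hyy := theta_mul_self_ne_zero hr0 hr1 hy hy
  have hθ' := deriv_theta_one_ne_zero hr0 hr1
  refine annular_induction hr0 hr1 (fun z hz => ?_) fun z h1 h2 h => ?_
  · have hd1 : HasDerivAt (fun w => thetaPair r y ((r : ℂ) ^ 2 * w))
        (deriv (thetaPair r y) ((r : ℂ) ^ 2 * z) * ((r : ℂ) ^ 2 * 1)) z :=
      (differentiableAt_thetaPair hr0 hr1 hy0
        (by positivity : (r : ℂ) ^ 2 * z ≠ 0)).hasDerivAt.comp z ((hasDerivAt_id z).const_mul _)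
    have hd2 := (differentiableAt_thetaPair hr0 hr1 hy0 hz).hasDerivAt.div
      (((hasDerivAt_id z).pow 2).const_mul ((r : ℂ) ^ 2)) (by simp [hr, hz])
    have heq : (fun w => thetaPair r y ((r : ℂ) ^ 2 * w)) =ᶠ[𝓝 z]
        fun w => thetaPair r y w / ((r : ℂ) ^ 2 * w ^ 2) := by
      filter_upwards [isOpen_ne.mem_nhds hz] with w hw using thetaPair_sq_mul hr0 hr1 hy0 hw
    have hd := hd1.unique (hd2.congr_of_eventuallyEq heq)
    have e0 : thetaPair r y ((r : ℂ) ^ 2 * z) = 0 ↔ thetaPair r y z = 0 := by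
      rw [thetaPair_sq_mul hr0 hr1 hy0 hz, div_eq_zero_iff]
      simp [hr, hz]
    have e1 : qNum r x (q r x y) ((r : ℂ) ^ 2 * z) = 0 ↔ qNum r x (q r x y) z = 0 := by
      rw [qNum_sq_mul hr0 hr1 hx0 _ hz, div_eq_zero_iff]
      simp [hr, hz]
    rw [e0, e1]
    refine imp_congr_right fun h0 => and_congr_right fun _ => not_congr ?_
    rw [h0] at hd
    constructor
    · intro h
      rw [h] at hd
      simpa [hr] using hd
    · intro h
      rw [h, zero_mul] at hd
      simpa [hr, hz] using hd.symm
  · have hz0 : z ≠ 0 := norm_pos_iff.mp (lt_trans hr0 h1)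
    have hpos : 0 < ‖z‖ := norm_pos_iff.mpr hz0
    have ny : ‖(y : ℂ)‖ = -y := by rw [Complex.norm_real, Real.norm_eq_abs, abs_of_neg hyneg]
    have hyl := hy.1
    have hyu := hy.2
    rw [le_div_iff₀ hr0] at h2
    have a1 : theta r (y / z) = 0 ↔ y / z = 1 := theta_eq_zero_iff hr0 hr1
      (by rw [norm_div, ny, lt_div_iff₀ hpos]; nlinarith)
      (by rw [norm_div, ny, mul_div_assoc', div_lt_one hpos]; nlinarith [pow_pos hr0 2])
    have a2 : theta r (y * z) = 0 ↔ y * z = 1 := theta_eq_zero_iff hr0 hr1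
      (by rw [norm_mul, ny]; nlinarith)
      (by
        rw [norm_mul, ny]
        have : r ^ 2 * (-y * ‖z‖) = r * (-y) * (‖z‖ * r) := by ring
        nlinarith [mul_pos hr0 (by linarith : 0 < -y)])
    rw [(hasDerivAt_thetaPair hr0 hr1 hy0 hz0).deriv]
    rcases mul_eq_zero.mp h with h | h
    · have hzy : z = y := ((div_eq_one_iff_eq hz0).mp (a1.mp h)).symm
      subst hzy
      refine ⟨hNy, ?_⟩
      rw [div_self hz0, theta_one hr0 hr1]
      simp [hz0, hyy, hθ']
    · have hzy : z = 1 / y := by rw [eq_div_iff hy0', mul_comm]; exact a2.mp h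
      subst hzy
      refine ⟨by rw [qNum_inv]; exact hNy, ?_⟩
      rw [mul_one_div_cancel hy0', theta_one hr0 hr1, div_div_eq_mul_div, div_one]
      simp [hy0', hyy, hθ']

/-- The product formula: `q_x - q_x(y)` is a quotient of theta products. -/
lemma qNum_eq_thetaPair (hr0 : 0 < r) (hr1 : r < 1) {x y : ℝ} (hx : x ∈ Set.Ioo (-1) (-r))
    (hy : y ∈ Set.Ioo (-1) (-r)) (hxy : x ≠ y) {z : ℂ} (hz : z ≠ 0) :
    qNum r x (q r x y) z
      = -(deriv (theta r) 1 * theta r (x * x)) / thetaPair r y x * thetaPair r y z := by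
  have hr : (r : ℂ) ≠ 0 := by exact_mod_cast hr0.ne'
  have hx0 : x ≠ 0 := ne_zero_of_mem_Ioo hr0 hx
  have hy0 : y ≠ 0 := ne_zero_of_mem_Ioo hr0 hy
  have hx0' : (x : ℂ) ≠ 0 := by exact_mod_cast hx0
  have hzeros := zeros_thetaPair hr0 hr1 hx hy hxy
  obtain ⟨h, hd, hh⟩ := exists_differentiableOn_mul_eq (U := {0}ᶜ) isOpen_compl_singleton
    (fun z hz => (differentiableAt_qNum hr0 hr1 hx0 (q r x y) hz).differentiableWithinAt)
    (fun z hz => (differentiableAt_thetaPair hr0 hr1 hy0 hz).differentiableWithinAt) hzeros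
  have hcont : ∀ z ≠ 0, ContinuousAt h z := fun z hz =>
    (hd.differentiableAt (isOpen_compl_singleton.mem_nhds hz)).continuousAt
  have hper : ∀ z ≠ 0, h ((r : ℂ) ^ 2 * z) = h z := by
    intro z hz
    have hgen : ∀ w ≠ 0, thetaPair r y w ≠ 0 → h ((r : ℂ) ^ 2 * w) = h w := by
      intro w hw hne
      have hrw : (r : ℂ) ^ 2 * w ≠ 0 := by positivity
      have e := hh _ hrw
      rw [qNum_sq_mul hr0 hr1 hx0 _ hw, thetaPair_sq_mul hr0 hr1 hy0 hw, hh w hw] at e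
      field_simp at e
      exact e.symm
    by_cases hDz : thetaPair r y z = 0
    · have hev : ∀ᶠ w in 𝓝[≠] z, thetaPair r y w ≠ 0 := by
        have := ((differentiableAt_thetaPair hr0 hr1 hy0 hz).hasDerivAt).eventually_ne
          (c := 0) (hzeros z hz hDz).2
        exact this
      have hev2 : ∀ᶠ w in 𝓝[≠] z, h ((r : ℂ) ^ 2 * w) = h w := by
        filter_upwards [hev, mem_nhdsWithin_of_mem_nhds (isOpen_ne.mem_nhds hz)] with w h1 h2
        exact hgen w h2 h1
      have c1 : ContinuousAt (fun w => h ((r : ℂ) ^ 2 * w)) z :=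
        (hcont ((r : ℂ) ^ 2 * z) (by positivity)).comp (by fun_prop)
      exact tendsto_nhds_unique_of_eventuallyEq
        (c1.tendsto.mono_left nhdsWithin_le_nhds)
        ((hcont z hz).tendsto.mono_left nhdsWithin_le_nhds) hev2
    · exact hgen z hz hDz
  have hconst := eq_of_differentiableOn_of_periodic hr0 hr1 hd hper
  have hDx : thetaPair r y x ≠ 0 := by
    rw [Ne, thetaPair_eq_zero_iff hr0 hr1 hy (mem_dom_self hr0 hy hx)]
    exact_mod_cast hxy
  have hNx : qNum r x (q r x y) x = -(deriv (theta r) 1 * theta r (x * x)) := by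
    rw [qNum, thetaPair, div_self hx0', theta_one hr0 hr1]
    ring
  rw [hh z hz, hconst z hz x hx0', ← hNx, hh x hx0']
  field_simp

end

/-! ### The function `R` and its relation to `q₁` and `q₂` -/

section

variable {r : ℝ}

lemma thetaPair_ne_zero_of_ne (hr0 : 0 < r) (hr1 : r < 1) {x y : ℝ} (hx : x ∈ Set.Ioo (-1) (-r))
    (hy : y ∈ Set.Ioo (-1) (-r)) (hxy : x ≠ y) : thetaPair r x y ≠ 0 := by
  rw [Ne, thetaPair_eq_zero_iff hr0 hr1 hx (mem_dom_self hr0 hx hy)]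
  exact_mod_cast hxy.symm

lemma q_sub_q_eq (hr0 : 0 < r) (hr1 : r < 1) {x y : ℝ} (hx : x ∈ Set.Ioo (-1) (-r))
    (hy : y ∈ Set.Ioo (-1) (-r)) (hxy : x ≠ y) {z : ℂ} (hz : z ≠ 0) (h : thetaPair r x z ≠ 0) :
    q r x z - q r x y = -(deriv (theta r) 1 * theta r (x * x)) / (x * thetaPair r y x)
      * (thetaPair r y z / thetaPair r x z) := by
  have hx0 : x ≠ 0 := ne_zero_of_mem_Ioo hr0 hx
  have hx0' : (x : ℂ) ≠ 0 := by exact_mod_cast hx0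
  have e := qNum_eq_thetaPair hr0 hr1 hx hy hxy hz
  rw [qNum_eq hx0 _ hz h] at e
  have hne := thetaPair_ne_zero_of_ne hr0 hr1 hy hx hxy.symm
  field_simp
  field_simp at e
  linear_combination e

/-- The factor `k` of the product formula `R(z) - R(y) = k θ(y/z) θ(yz) / (θ(z₀/z) θ(z₀z))`. -/
noncomputable def factor (r z₀ a y : ℝ) : ℂ :=
  a * (-(deriv (theta r) 1 * theta r (z₀ * z₀)) / (z₀ * thetaPair r y z₀))

lemma factor_ne_zero (hr0 : 0 < r) (hr1 : r < 1) {z₀ y a : ℝ} (h0 : z₀ ∈ Set.Ioo (-1) (-r))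
    (hy : y ∈ Set.Ioo (-1) (-r)) (h : y ≠ z₀) (ha : a ≠ 0) : factor r z₀ a y ≠ 0 := by
  have h1 := deriv_theta_one_ne_zero hr0 hr1
  have h2 := theta_mul_self_ne_zero hr0 hr1 h0 h0
  have h3 := thetaPair_ne_zero_of_ne hr0 hr1 hy h0 h
  have h4 := ne_zero_of_mem_Ioo hr0 h0
  simp [factor, h1, h2, h3, h4, ha]

lemma R_sub_R_eq (hr0 : 0 < r) (hr1 : r < 1) {z₀ y : ℝ} (a b : ℝ) (h0 : z₀ ∈ Set.Ioo (-1) (-r))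
    (hy : y ∈ Set.Ioo (-1) (-r)) (h : y ≠ z₀) {z : ℂ} (hz : z ≠ 0) (hz' : thetaPair r z₀ z ≠ 0) :
    R r z₀ a b z - R r z₀ a b y
      = factor r z₀ a y * (thetaPair r y z / thetaPair r z₀ z) := by
  have := q_sub_q_eq hr0 hr1 h0 hy h.symm hz hz'
  rw [factor, mul_assoc, ← this, R, R]
  ring

lemma hasDerivAt_R_self (hr0 : 0 < r) (hr1 : r < 1) {z₀ y : ℝ} (a b : ℝ)
    (h0 : z₀ ∈ Set.Ioo (-1) (-r)) (hy : y ∈ Set.Ioo (-1) (-r)) (h : y ≠ z₀) :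
    HasDerivAt (R r z₀ a b) (factor r z₀ a y *
      (-(deriv (theta r) 1 * theta r (y * y)) / (y * thetaPair r z₀ y))) y := by
  have hy0 : y ≠ 0 := ne_zero_of_mem_Ioo hr0 hy
  have hy0' : (y : ℂ) ≠ 0 := by exact_mod_cast hy0
  have hne := thetaPair_ne_zero_of_ne hr0 hr1 h0 hy h.symm
  have d0 := differentiableAt_thetaPair hr0 hr1 (ne_zero_of_mem_Ioo hr0 h0) hy0'
  have d1 := hasDerivAt_thetaPair hr0 hr1 hy0 hy0'
  have d := ((d1.div d0.hasDerivAt hne).const_mul (factor r z₀ a y)).add_const (R r z₀ a b y)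
  have ev : R r z₀ a b =ᶠ[𝓝 (y : ℂ)] fun z =>
      factor r z₀ a y * (thetaPair r y / thetaPair r z₀) z + R r z₀ a b y := by
    filter_upwards [d0.continuousAt.eventually_ne hne, isOpen_ne.mem_nhds hy0'] with z h1 h2
    rw [Pi.div_apply, ← R_sub_R_eq hr0 hr1 a b h0 hy h h2 h1]
    ring
  refine (d.congr_of_eventuallyEq ev).congr_deriv ?_
  have e0 : thetaPair r y y = 0 := (thetaPair_eq_zero_iff hr0 hr1 hy (mem_dom_self hr0 hy hy)).mpr rfl
  rw [e0, div_self hy0', theta_one hr0 hr1]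
  field_simp
  ring

/-- `q_y - q_y(z₀)` and `R - R(y)` are inverse to each other up to a constant. -/
lemma q_sub_mul_R_sub (hr0 : 0 < r) (hr1 : r < 1) {z₀ y : ℝ} (a b : ℝ)
    (h0 : z₀ ∈ Set.Ioo (-1) (-r)) (hy : y ∈ Set.Ioo (-1) (-r)) (h : y ≠ z₀) {z : ℂ} (hz : z ≠ 0)
    (hz0 : thetaPair r z₀ z ≠ 0) (hzy : thetaPair r y z ≠ 0) :
    (q r y z - q r y z₀) * (R r z₀ a b z - R r z₀ a b y) = deriv (R r z₀ a b) y := by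
  rw [q_sub_q_eq hr0 hr1 hy h0 h hz hzy, R_sub_R_eq hr0 hr1 a b h0 hy h hz hz0,
    (hasDerivAt_R_self hr0 hr1 a b h0 hy h).deriv]
  field_simp

/-- `y R'(y)` is real and its sign, that of `a`, does not depend on `y`. -/
lemma exists_mul_deriv_R (hr0 : 0 < r) (hr1 : r < 1) {z₀ y : ℝ} (a b : ℝ)
    (h0 : z₀ ∈ Set.Ioo (-1) (-r)) (hy : y ∈ Set.Ioo (-1) (-r)) (h : y ≠ z₀) :
    ∃ t : ℝ, 0 < t ∧ y * deriv (R r z₀ a b) y = ((a * t : ℝ) : ℂ) := by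
  have hy0 : y ≠ 0 := ne_zero_of_mem_Ioo hr0 hy
  have hz0 : z₀ ≠ 0 := ne_zero_of_mem_Ioo hr0 h0
  have hy0' : (y : ℂ) ≠ 0 := by exact_mod_cast hy0
  have hz0' : (z₀ : ℂ) ≠ 0 := by exact_mod_cast hz0
  have hneg : ∀ x ∈ Set.Ioo (-1) (-r), ∃ t : ℝ, t < 0 ∧ theta r ((x : ℂ) * x) = t := by
    intro x hx
    have := exists_theta_neg hr0 hr1 (x := x * x) (by nlinarith [hx.1, hx.2])
      (by nlinarith [hx.1, hx.2])
    simpa using this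
  obtain ⟨d, hd, ed⟩ := exists_deriv_theta_one hr0 hr1
  obtain ⟨t0, ht0, et0⟩ := hneg z₀ h0
  obtain ⟨t1, ht1, et1⟩ := hneg y hy
  obtain ⟨s, es⟩ := exists_theta_ofReal hr0 hr1 (y / z₀)
  obtain ⟨s', es'⟩ := exists_theta_ofReal hr0 hr1 (y * z₀)
  push_cast at es es'
  have n1 := theta_mul_self_ne_zero hr0 hr1 hy h0
  have n2 := left_ne_zero_of_mul (thetaPair_ne_zero_of_ne hr0 hr1 hy h0 h)
  have es2 : theta r ((z₀ : ℂ) / y) = -(y / z₀) * s := by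
    rw [← es, ← theta_inv hr0 hr1 (by positivity), one_div_div]
  rw [es'] at n1
  rw [es] at n2
  have hs : s ≠ 0 := by exact_mod_cast n2
  have hs' : s' ≠ 0 := by exact_mod_cast n1
  refine ⟨d * t0 * (d * t1) / (-y * (s * s') ^ 2), ?_, ?_⟩
  · have hy1 : 0 < -y := by linarith [hy.2]
    have : 0 < d * t0 * (d * t1) := mul_pos_of_neg_of_neg (by nlinarith) (by nlinarith)
    positivity
  · rw [(hasDerivAt_R_self hr0 hr1 a b h0 hy h).deriv, factor, thetaPair, thetaPair,
      mul_comm (z₀ : ℂ) (y : ℂ), es, es', es2, ed, et0, et1]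
    have a1 : (s : ℂ) ≠ 0 := by exact_mod_cast hs
    have a2 : (s' : ℂ) ≠ 0 := by exact_mod_cast hs'
    push_cast
    field_simp

lemma q_conj (hr0 : 0 < r) (hr1 : r < 1) (x : ℝ) (z : ℂ) :
    q r x ((starRingEnd ℂ) z) = (starRingEnd ℂ) (q r x z) := by
  have e1 : (x : ℂ) / (starRingEnd ℂ) z = (starRingEnd ℂ) (x / z) := by simp
  have e2 : (x : ℂ) * (starRingEnd ℂ) z = (starRingEnd ℂ) (x * z) := by simp
  rw [q, q, e1, e2, deriv_theta_conj hr0 hr1, deriv_theta_conj hr0 hr1, theta_conj hr0 hr1,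
    theta_conj hr0 hr1]
  simp only [map_sub, map_neg, map_div₀, map_mul]

lemma R_conj (hr0 : 0 < r) (hr1 : r < 1) (z₀ a b : ℝ) (z : ℂ) :
    R r z₀ a b ((starRingEnd ℂ) z) = (starRingEnd ℂ) (R r z₀ a b z) := by
  simp [R, q_conj hr0 hr1]

lemma R_inv (z₀ a b : ℝ) (z : ℂ) : R r z₀ a b (1 / z) = R r z₀ a b z := by
  rw [R, R, q_inv]

lemma q_sq_mul (hr0 : 0 < r) (hr1 : r < 1) {x : ℝ} (hx : x ≠ 0) {z : ℂ} (hz : z ≠ 0)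
    (h : thetaPair r x z ≠ 0) : q r x ((r : ℂ) ^ 2 * z) = q r x z := by
  have hr : (r : ℂ) ≠ 0 := by exact_mod_cast hr0.ne'
  have hx' : (x : ℂ) ≠ 0 := by exact_mod_cast hx
  have h' : thetaPair r x ((r : ℂ) ^ 2 * z) ≠ 0 := by
    rw [thetaPair_sq_mul hr0 hr1 hx hz]
    positivity
  have e1 := qNum_eq hx 0 hz h
  have e2 := qNum_eq hx 0 (by positivity : (r : ℂ) ^ 2 * z ≠ 0) h'
  rw [qNum_sq_mul hr0 hr1 hx _ hz, e1, thetaPair_sq_mul hr0 hr1 hx hz] at e2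
  field_simp at e2
  linear_combination -e2

lemma R_sq_mul (hr0 : 0 < r) (hr1 : r < 1) {z₀ : ℝ} (h0 : z₀ ≠ 0) (a b : ℝ) {z : ℂ} (hz : z ≠ 0)
    (h : thetaPair r z₀ z ≠ 0) : R r z₀ a b ((r : ℂ) ^ 2 * z) = R r z₀ a b z := by
  rw [R, R, q_sq_mul hr0 hr1 h0 hz h]

lemma differentiableAt_q (hr0 : 0 < r) (hr1 : r < 1) {x : ℝ} (hx : x ≠ 0) {z : ℂ} (hz : z ≠ 0)
    (h : thetaPair r x z ≠ 0) : DifferentiableAt ℂ (q r x) z := by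
  have hx' : (x : ℂ) ≠ 0 := by exact_mod_cast hx
  have d := differentiableAt_thetaPair hr0 hr1 hx hz
  have d2 := ((differentiableAt_qNum hr0 hr1 hx 0 hz).div d h).div_const (x : ℂ)
  refine d2.congr_of_eventuallyEq ?_
  filter_upwards [d.continuousAt.eventually_ne h, isOpen_ne.mem_nhds hz] with w h1 h2
  rw [Pi.div_apply, qNum_eq hx 0 h2 h1]
  field_simp
  ring

lemma differentiableAt_R (hr0 : 0 < r) (hr1 : r < 1) {z₀ : ℝ} (h0 : z₀ ≠ 0) (a b : ℝ) {z : ℂ}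
    (hz : z ≠ 0) (h : thetaPair r z₀ z ≠ 0) : DifferentiableAt ℂ (R r z₀ a b) z :=
  ((differentiableAt_q hr0 hr1 h0 hz h).const_mul _).add_const _

/-! ### The logarithmic derivative of the Gauss map -/

/-- The logarithmic derivative `w θ'(w) / θ(w)`. -/
noncomputable def thetaLog (r : ℝ) (w : ℂ) : ℂ := w * deriv (theta r) w / theta r w

lemma mul_q_eq {x : ℝ} (hx : x ≠ 0) {z : ℂ} (hz : z ≠ 0) :
    x * q r x z = -thetaLog r (x / z) - thetaLog r (x * z) := by
  have hx' : (x : ℂ) ≠ 0 := by exact_mod_cast hx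
  rw [q, thetaLog, thetaLog]
  field_simp

lemma thetaLog_conj (hr0 : 0 < r) (hr1 : r < 1) (w : ℂ) :
    thetaLog r ((starRingEnd ℂ) w) = (starRingEnd ℂ) (thetaLog r w) := by
  simp [thetaLog, theta_conj hr0 hr1, deriv_theta_conj hr0 hr1]

lemma thetaLog_sq_mul (hr0 : 0 < r) (hr1 : r < 1) {w : ℂ} (hw : w ≠ 0) (h : theta r w ≠ 0) :
    thetaLog r ((r : ℂ) ^ 2 * w) = thetaLog r w - 1 := by
  have hr : (r : ℂ) ≠ 0 := by exact_mod_cast hr0.ne'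
  rw [thetaLog, thetaLog, deriv_theta_sq_mul hr0 hr1 hw, theta_sq_mul hr0 hr1 hw]
  field_simp
  ring

/-- The logarithmic derivative `z g'/g` of the Gauss map `g = const · θ(z₂z) / (z θ(z₁z))`. -/
noncomputable def gaussLog (r z₁ z₂ : ℝ) (z : ℂ) : ℂ :=
  thetaLog r (z₂ * z) - thetaLog r (z₁ * z) - 1

lemma gaussLog_add_inv {z₁ z₂ : ℝ} (h1 : z₁ ≠ 0) (h2 : z₂ ≠ 0) {z : ℂ} (hz : z ≠ 0) :
    gaussLog r z₁ z₂ z + gaussLog r z₁ z₂ (1 / z) = z₁ * q r z₁ z - z₂ * q r z₂ z - 2 := by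
  rw [gaussLog, gaussLog, mul_q_eq h1 hz, mul_q_eq h2 hz, mul_one_div, mul_one_div]
  ring

lemma gaussLog_conj (hr0 : 0 < r) (hr1 : r < 1) (z₁ z₂ : ℝ) (z : ℂ) :
    gaussLog r z₁ z₂ ((starRingEnd ℂ) z) = (starRingEnd ℂ) (gaussLog r z₁ z₂ z) := by
  have e : ∀ x : ℝ, (x : ℂ) * (starRingEnd ℂ) z = (starRingEnd ℂ) (x * z) := by simp
  simp only [gaussLog, e, thetaLog_conj hr0 hr1, map_sub, map_one]

lemma gaussLog_sq_mul (hr0 : 0 < r) (hr1 : r < 1) {z₁ z₂ : ℝ} (h1 : z₁ ≠ 0) (h2 : z₂ ≠ 0) {z : ℂ}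
    (hz : z ≠ 0) (h1' : theta r (z₁ * z) ≠ 0) (h2' : theta r (z₂ * z) ≠ 0) :
    gaussLog r z₁ z₂ ((r : ℂ) ^ 2 * z) = gaussLog r z₁ z₂ z := by
  have c1 : (z₁ : ℂ) ≠ 0 := by exact_mod_cast h1
  have c2 : (z₂ : ℂ) ≠ 0 := by exact_mod_cast h2
  rw [gaussLog, gaussLog, mul_left_comm, mul_left_comm (z₁ : ℂ),
    thetaLog_sq_mul hr0 hr1 (by positivity) h1', thetaLog_sq_mul hr0 hr1 (by positivity) h2']
  ring

lemma differentiableAt_gaussLog (hr0 : 0 < r) (hr1 : r < 1) {z₁ z₂ : ℝ} (h1 : z₁ ≠ 0) (h2 : z₂ ≠ 0)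
    {z : ℂ} (hz : z ≠ 0) (h1' : theta r (z₁ * z) ≠ 0) (h2' : theta r (z₂ * z) ≠ 0) :
    DifferentiableAt ℂ (gaussLog r z₁ z₂) z := by
  have h : ∀ x : ℝ, x ≠ 0 → theta r (x * z) ≠ 0 →
      DifferentiableAt ℂ (fun z : ℂ => thetaLog r (x * z)) z := by
    intro x hx hne
    have c : (x : ℂ) ≠ 0 := by exact_mod_cast hx
    have h2 : DifferentiableAt ℂ (fun z : ℂ => (x : ℂ) * z) z := by fun_prop
    have h4 : DifferentiableAt ℂ (fun z : ℂ => deriv (theta r) (x * z)) z :=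
      (differentiableAt_deriv_theta hr0 hr1 (by positivity : (x : ℂ) * z ≠ 0)).comp z h2
    exact (h2.mul h4).div (differentiableAt_theta_mul hr0 hr1 hx hz) hne
  exact ((h z₂ h2 h2').sub (h z₁ h1 h1')).sub_const 1

end

/-! ### Maximum principles on the annulus -/

lemma isOpen_annulus (r : ℝ) : IsOpen (annulus r) := by
  have h1 : IsOpen {z : ℂ | r < ‖z‖} := isOpen_lt continuous_const continuous_norm
  have h2 : IsOpen {z : ℂ | ‖z‖ < 1} := isOpen_lt continuous_norm continuous_const
  exact h1.inter h2

lemma closure_annulus_subset (r : ℝ) : closure (annulus r) ⊆ {z : ℂ | r ≤ ‖z‖ ∧ ‖z‖ ≤ 1} := by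
  refine closure_minimal (fun z hz => ⟨hz.1.le, hz.2.le⟩) ?_
  have h1 : IsClosed {z : ℂ | r ≤ ‖z‖} := isClosed_le continuous_const continuous_norm
  have h2 : IsClosed {z : ℂ | ‖z‖ ≤ 1} := isClosed_le continuous_norm continuous_const
  exact h1.inter h2

lemma isCompact_closedAnnulus (r : ℝ) : IsCompact {z : ℂ | r ≤ ‖z‖ ∧ ‖z‖ ≤ 1} := by
  refine (isCompact_closedBall (0 : ℂ) 1).of_isClosed_subset ?_ fun z hz => by simpa using hz.2
  have h1 : IsClosed {z : ℂ | r ≤ ‖z‖} := isClosed_le continuous_const continuous_norm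
  have h2 : IsClosed {z : ℂ | ‖z‖ ≤ 1} := isClosed_le continuous_norm continuous_const
  exact h1.inter h2

/-- If the real part of a holomorphic function is positive on both boundary circles of an annulus,
it is positive on the annulus. -/
lemma re_pos_of_re_pos_boundary {r : ℝ} {f : ℂ → ℂ}
    (hf : ∀ z : ℂ, r ≤ ‖z‖ → ‖z‖ ≤ 1 → DifferentiableAt ℂ f z)
    (hb : ∀ z : ℂ, (‖z‖ = 1 ∨ ‖z‖ = r) → r ≤ ‖z‖ → ‖z‖ ≤ 1 → 0 < (f z).re) {z : ℂ}
    (h1 : r ≤ ‖z‖) (h2 : ‖z‖ ≤ 1) : 0 < (f z).re := by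
  rcases h1.eq_or_lt with h | h1'
  · exact hb z (Or.inr h.symm) h1 h2
  rcases h2.eq_or_lt with h | h2'
  · exact hb z (Or.inl h) h1 h2
  have hr1 : r < 1 := h1'.trans h2'
  have hK := isCompact_closedAnnulus r
  have hS : IsCompact ({z : ℂ | r ≤ ‖z‖ ∧ ‖z‖ ≤ 1} ∩ {z : ℂ | ‖z‖ = 1 ∨ ‖z‖ = r}) := by
    refine hK.inter_right ?_
    have a1 : IsClosed {z : ℂ | ‖z‖ = 1} := isClosed_eq continuous_norm continuous_const
    have a2 : IsClosed {z : ℂ | ‖z‖ = r} := isClosed_eq continuous_norm continuous_const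
    exact a1.union a2
  have hcont : ContinuousOn (fun z => (f z).re)
      ({z : ℂ | r ≤ ‖z‖ ∧ ‖z‖ ≤ 1} ∩ {z : ℂ | ‖z‖ = 1 ∨ ‖z‖ = r}) := fun w hw =>
    (Complex.continuous_re.continuousAt.comp (hf w hw.1.1 hw.1.2).continuousAt).continuousWithinAt
  obtain ⟨p, hp, hmin⟩ := hS.exists_isMinOn ⟨1, ⟨by simpa using hr1.le, by simp⟩, by simp⟩ hcont
  have hδ := hb p hp.2 hp.1.1 hp.1.2
  have hd : DiffContOnCl ℂ (fun w => Complex.exp (-f w)) (annulus r) := by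
    refine DifferentiableOn.diffContOnCl fun w hw => ?_
    have hw' := closure_annulus_subset r hw
    exact (hf w hw'.1 hw'.2).neg.cexp.differentiableWithinAt
  have hbd : Bornology.IsBounded (annulus r) :=
    hK.isBounded.subset fun w hw => ⟨hw.1.le, hw.2.le⟩
  have key := Complex.norm_le_of_forall_mem_frontier_norm_le hbd hd
    (C := Real.exp (-(f p).re)) (fun w hw => ?_) (subset_closure (⟨h1', h2'⟩ : z ∈ annulus r))
  · rw [Complex.norm_exp, Real.exp_le_exp, Complex.neg_re] at key
    linarith
  · rw [(isOpen_annulus r).frontier_eq] at hw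
    have hw' := closure_annulus_subset r hw.1
    rw [Complex.norm_exp, Real.exp_le_exp, Complex.neg_re, neg_le_neg_iff]
    refine hmin ⟨hw', ?_⟩
    by_contra hcon
    simp only [Set.mem_ofPred_eq, not_or] at hcon
    exact hw.2 ⟨lt_of_le_of_ne hw'.1 (Ne.symm hcon.2), lt_of_le_of_ne hw'.2 hcon.1⟩

/-- Strong maximum principle for `|f(z)| |z|ᶜ`, the modulus of the multivalued function `f(z) zᶜ`:
if it is `1` on both boundary circles and `f` has a zero, it is less than `1` on the annulus. -/
lemma norm_mul_rpow_lt_one {r : ℝ} (hr0 : 0 < r) {f : ℂ → ℂ} (c : ℝ)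
    (hf : ∀ z : ℂ, r ≤ ‖z‖ → ‖z‖ ≤ 1 → DifferentiableAt ℂ f z)
    (hb : ∀ z : ℂ, (‖z‖ = 1 ∨ ‖z‖ = r) → ‖f z‖ * ‖z‖ ^ c = 1)
    {w : ℂ} (hw : w ∈ annulus r) (hfw : f w = 0) {z : ℂ} (hz : z ∈ annulus r) :
    ‖f z‖ * ‖z‖ ^ c < 1 := by
  by_contra! hcon
  have hcont : ContinuousOn (fun z => ‖f z‖ * ‖z‖ ^ c) {z : ℂ | r ≤ ‖z‖ ∧ ‖z‖ ≤ 1} := fun w hw =>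
    ((hf w hw.1 hw.2).continuousAt.norm.mul (continuousAt_id.norm.rpow_const
      (Or.inl (hr0.trans_le hw.1).ne'))).continuousWithinAt
  obtain ⟨p, hp, hmax⟩ := (isCompact_closedAnnulus r).exists_isMaxOn
    ⟨z, hz.1.le, hz.2.le⟩ hcont
  -- an interior point where the maximum is attained
  obtain ⟨p', hp', hp1, hmax'⟩ : ∃ p' ∈ annulus r, 1 ≤ ‖f p'‖ * ‖p'‖ ^ c ∧
      ∀ y ∈ annulus r, ‖f y‖ * ‖y‖ ^ c ≤ ‖f p'‖ * ‖p'‖ ^ c := by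
    have hzp : ‖f z‖ * ‖z‖ ^ c ≤ ‖f p‖ * ‖p‖ ^ c := hmax ⟨hz.1.le, hz.2.le⟩
    by_cases hpa : p ∈ annulus r
    · exact ⟨p, hpa, hcon.trans hzp, fun y hy => hmax ⟨hy.1.le, hy.2.le⟩⟩
    · have hpb : ‖f p‖ * ‖p‖ ^ c = 1 := by
        refine hb p ?_
        by_contra hcon'
        simp only [not_or] at hcon'
        exact hpa ⟨lt_of_le_of_ne hp.1 (Ne.symm hcon'.2), lt_of_le_of_ne hp.2 hcon'.1⟩
      refine ⟨z, hz, hcon, fun y hy => ?_⟩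
      have : ‖f y‖ * ‖y‖ ^ c ≤ ‖f p‖ * ‖p‖ ^ c := hmax ⟨hy.1.le, hy.2.le⟩
      exact this.trans (hpb.le.trans hcon)
  -- lift to the strip that covers the annulus, where `zᶜ` becomes single-valued
  have hstrip : ∀ v : ℂ, v.re ∈ Set.Ioo (Real.log r) 0 → Complex.exp v ∈ annulus r := by
    intro v hv
    constructor
    · rw [Complex.norm_exp, ← Real.log_lt_iff_lt_exp hr0]
      exact hv.1
    · rw [Complex.norm_exp, Real.exp_lt_one_iff]
      exact hv.2
  have hlog : ∀ y ∈ annulus r, (Complex.log y).re ∈ Set.Ioo (Real.log r) 0 := by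
    intro y hy
    rw [Complex.log_re]
    exact ⟨Real.log_lt_log hr0 hy.1, Real.log_neg (hr0.trans hy.1) hy.2⟩
  have hnorm : ∀ v : ℂ, ‖f (Complex.exp v) * Complex.exp (c * v)‖
      = ‖f (Complex.exp v)‖ * ‖Complex.exp v‖ ^ c := by
    intro v
    rw [norm_mul, Complex.norm_exp, Complex.norm_exp, ← Real.exp_mul, Complex.re_ofReal_mul,
      mul_comm c]
  have hexplog : ∀ y ∈ annulus r, Complex.exp (Complex.log y) = y := fun y hy =>
    Complex.exp_log (norm_pos_iff.mp (hr0.trans hy.1))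
  have hTo : IsOpen (Complex.re ⁻¹' Set.Ioo (Real.log r) 0) := isOpen_Ioo.preimage Complex.continuous_re
  have hTc : IsPreconnected (Complex.re ⁻¹' Set.Ioo (Real.log r) 0) :=
    ((convex_Ioo _ _).linear_preimage Complex.reLm).isPreconnected
  have hd : DifferentiableOn ℂ (fun v => f (Complex.exp v) * Complex.exp (c * v))
      (Complex.re ⁻¹' Set.Ioo (Real.log r) 0) := by
    intro v hv
    have hv' := hstrip v hv
    have h1 : DifferentiableAt ℂ (fun v => f (Complex.exp v)) v :=
      (hf _ hv'.1.le hv'.2.le).comp v Complex.differentiable_exp.differentiableAt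
    have h2 : DifferentiableAt ℂ (fun v : ℂ => Complex.exp (c * v)) v := by fun_prop
    exact (h1.mul h2).differentiableWithinAt
  have key := Complex.norm_eqOn_of_isPreconnected_of_isMaxOn hTc hTo hd (hlog p' hp')
    (fun v hv => by
      simp only [Function.comp_apply, Set.mem_ofPred_eq]
      rw [hnorm, hnorm, hexplog p' hp']
      exact hmax' _ (hstrip v hv)) (hlog w hw)
  simp only [Function.comp_apply, Function.const_apply] at key
  rw [hnorm, hnorm, hexplog p' hp', hexplog w hw, hfw, norm_zero, zero_mul] at key
  linarith

/-! ### Boundary behaviour -/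

/-- The hypotheses on the parameters: the poles and zeros `z₀`, `z₁`, `z₂`, the normalization of
`R`, its values on the boundary and the conditions `C1`, `C2`, `C3`. -/
structure IsAnnularData (r z₀ z₁ z₂ m a b : ℝ) : Prop where
  r_pos : 0 < r
  r_lt_one : r < 1
  mem₀ : z₀ ∈ Set.Ioo (-1) (-r)
  mem₁ : z₁ ∈ Set.Ioo (-1) (-r)
  mem₂ : z₂ ∈ Set.Ioo (-1) (-r)
  ne₁₀ : z₁ ≠ z₀
  ne₂₀ : z₂ ≠ z₀
  R₁ : R r z₀ a b z₁ = 1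
  R₂ : R r z₀ a b z₂ = 0
  bdry : ∀ z : ℂ, (‖z‖ = 1 ∨ ‖z‖ = r) → 0 < (R r z₀ a b z).re ∧ (R r z₀ a b z).re < 1
  C1 : (m : ℂ) + q r z₁ z₀ * z₁ - z₁ * deriv (R r z₀ a b) z₁
    = -(z₂ * deriv (R r z₀ a b) z₂)
  C2 : q r z₁ z₀ * z₁ - q r z₂ z₀ * z₂ - 2 = 0
  C3 : z₁ * z₂ * r ^ (2 * (m + 2)) = 1

namespace IsAnnularData

variable {r z₀ z₁ z₂ m a b : ℝ}

lemma ne_zero₀ (d : IsAnnularData r z₀ z₁ z₂ m a b) : z₀ ≠ 0 := ne_zero_of_mem_Ioo d.r_pos d.mem₀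
lemma ne_zero₁ (d : IsAnnularData r z₀ z₁ z₂ m a b) : z₁ ≠ 0 := ne_zero_of_mem_Ioo d.r_pos d.mem₁
lemma ne_zero₂ (d : IsAnnularData r z₀ z₁ z₂ m a b) : z₂ ≠ 0 := ne_zero_of_mem_Ioo d.r_pos d.mem₂

lemma a_ne_zero (d : IsAnnularData r z₀ z₁ z₂ m a b) : a ≠ 0 := by
  rintro rfl
  have h1 := d.R₁
  have h2 := d.R₂
  simp only [R, Complex.ofReal_zero, zero_mul, zero_add] at h1 h2
  rw [h1] at h2
  exact one_ne_zero h2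

/-- The product formula for `1 - R`. -/
lemma one_sub_R_eq (d : IsAnnularData r z₀ z₁ z₂ m a b) {z : ℂ} (hz : z ≠ 0)
    (h : thetaPair r z₀ z ≠ 0) :
    1 - R r z₀ a b z = -factor r z₀ a z₁ * (thetaPair r z₁ z / thetaPair r z₀ z) := by
  have := R_sub_R_eq d.r_pos d.r_lt_one a b d.mem₀ d.mem₁ d.ne₁₀ hz h
  rw [d.R₁] at this
  linear_combination -this

/-- The product formula for `R`. -/
lemma R_eq (d : IsAnnularData r z₀ z₁ z₂ m a b) {z : ℂ} (hz : z ≠ 0)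
    (h : thetaPair r z₀ z ≠ 0) :
    R r z₀ a b z = factor r z₀ a z₂ * (thetaPair r z₂ z / thetaPair r z₀ z) := by
  have := R_sub_R_eq d.r_pos d.r_lt_one a b d.mem₀ d.mem₂ d.ne₂₀ hz h
  rw [d.R₂] at this
  linear_combination this

/-- The elliptic function `z₁ q₁ - z₂ q₂ - 2` in terms of `R`; this uses `C2`. -/
lemma mul_q_sub_mul_q (d : IsAnnularData r z₀ z₁ z₂ m a b) {z : ℂ} (hz : z ≠ 0)
    (h0 : thetaPair r z₀ z ≠ 0) (h1 : thetaPair r z₁ z ≠ 0) (h2 : thetaPair r z₂ z ≠ 0) :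
    (z₁ * q r z₁ z - z₂ * q r z₂ z - 2) * (R r z₀ a b z * (1 - R r z₀ a b z))
      = -(z₁ * deriv (R r z₀ a b) z₁ * R r z₀ a b z
        + z₂ * deriv (R r z₀ a b) z₂ * (1 - R r z₀ a b z)) := by
  have e1 := q_sub_mul_R_sub d.r_pos d.r_lt_one a b d.mem₀ d.mem₁ d.ne₁₀ hz h0 h1
  have e2 := q_sub_mul_R_sub d.r_pos d.r_lt_one a b d.mem₀ d.mem₂ d.ne₂₀ hz h0 h2
  rw [d.R₁] at e1
  rw [d.R₂] at e2
  linear_combination (-(z₁ : ℂ) * R r z₀ a b z) * e1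
    - (z₂ : ℂ) * (1 - R r z₀ a b z) * e2 + (R r z₀ a b z * (1 - R r z₀ a b z)) * d.C2

/-- The relation between `q₁` and `R (z₁ q₁ - z₂ q₂ - 2)`; this uses `C1` and `C2`. -/
lemma add_mul_q_eq (d : IsAnnularData r z₀ z₁ z₂ m a b) {z : ℂ} (hz : z ≠ 0)
    (h0 : thetaPair r z₀ z ≠ 0) (h1 : thetaPair r z₁ z ≠ 0) (h2 : thetaPair r z₂ z ≠ 0) :
    m + z₁ * q r z₁ z = R r z₀ a b z * (z₁ * q r z₁ z - z₂ * q r z₂ z - 2) := by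
  have e1 := q_sub_mul_R_sub d.r_pos d.r_lt_one a b d.mem₀ d.mem₁ d.ne₁₀ hz h0 h1
  have e2 := q_sub_mul_R_sub d.r_pos d.r_lt_one a b d.mem₀ d.mem₂ d.ne₂₀ hz h0 h2
  rw [d.R₁] at e1
  rw [d.R₂] at e2
  linear_combination (-(z₁ : ℂ)) * e1 + (z₂ : ℂ) * e2 + d.C1 - R r z₀ a b z * d.C2

lemma thetaPair_ne_zero {x : ℝ} (hr0 : 0 < r) (hr1 : r < 1) (hx : x ∈ Set.Ioo (-1) (-r)) {z : ℂ}
    (hz : ‖z‖ = 1 ∨ ‖z‖ = r) : thetaPair r x z ≠ 0 := by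
  have hm : z ∈ dom r x := by
    rcases hz with h | h
    · exact mem_dom_of_mem_closure hr0 hx (by rw [h]; exact hr1.le) h.le
    · exact mem_dom_of_mem_closure hr0 hx h.ge (by rw [h]; exact hr1.le)
  rw [Ne, thetaPair_eq_zero_iff hr0 hr1 hx hm]
  rintro rfl
  have hx0 : x < 0 := by linarith [hx.2]
  rw [Complex.norm_real, Real.norm_eq_abs, abs_of_neg hx0] at hz
  rcases hz with h | h
  · linarith [hx.1]
  · linarith [hx.2]

/-- Inversion and complex conjugation agree on a boundary circle up to `z ↦ r² z`. -/
lemma conj_eq_of_mem_circle (hr0 : 0 < r) {z : ℂ} (hz : ‖z‖ = 1 ∨ ‖z‖ = r) :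
    (starRingEnd ℂ) z = 1 / z ∨ (starRingEnd ℂ) z = (r : ℂ) ^ 2 * (1 / z) := by
  have h := Complex.mul_conj' z
  rcases hz with h1 | h1
  · left
    have hz0 : z ≠ 0 := norm_pos_iff.mp (by rw [h1]; norm_num)
    rw [h1] at h
    rw [eq_div_iff hz0, mul_comm, h]
    norm_num
  · right
    have hz0 : z ≠ 0 := norm_pos_iff.mp (by rw [h1]; exact hr0)
    rw [h1] at h
    rw [mul_one_div, eq_div_iff hz0, mul_comm, h]

/-- On the boundary circles `R` is real, being invariant under inversion, `z ↦ r² z` and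
conjugation. -/
lemma R_real (d : IsAnnularData r z₀ z₁ z₂ m a b) {z : ℂ} (hz : ‖z‖ = 1 ∨ ‖z‖ = r) :
    ∃ ρ : ℝ, 0 < ρ ∧ ρ < 1 ∧ R r z₀ a b z = ρ := by
  have hz0 : z ≠ 0 := norm_pos_iff.mp (by
    rcases hz with h | h <;> rw [h]
    · norm_num
    · exact d.r_pos)
  have hc : R r z₀ a b ((starRingEnd ℂ) z) = R r z₀ a b z := by
    rcases conj_eq_of_mem_circle d.r_pos hz with h | h
    · rw [h, R_inv]
    · rw [h, R_sq_mul d.r_pos d.r_lt_one d.ne_zero₀ a b (one_div_ne_zero hz0), R_inv]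
      rw [thetaPair_inv]
      exact thetaPair_ne_zero d.r_pos d.r_lt_one d.mem₀ hz
  rw [R_conj d.r_pos d.r_lt_one] at hc
  obtain ⟨ρ, hρ⟩ := Complex.conj_eq_iff_real.mp hc
  have := d.bdry z hz
  rw [hρ, Complex.ofReal_re] at this
  exact ⟨ρ, this.1, this.2, hρ⟩

/-- On the boundary circles inversion agrees with conjugation up to the period `r²` of `gaussLog`. -/
lemma gaussLog_inv (d : IsAnnularData r z₀ z₁ z₂ m a b) {z : ℂ} (hz : ‖z‖ = 1 ∨ ‖z‖ = r) :
    gaussLog r z₁ z₂ (1 / z) = (starRingEnd ℂ) (gaussLog r z₁ z₂ z) := by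
  have hz0 : z ≠ 0 := norm_pos_iff.mp (by
    rcases hz with h | h <;> rw [h]
    · norm_num
    · exact d.r_pos)
  rw [← gaussLog_conj d.r_pos d.r_lt_one]
  rcases conj_eq_of_mem_circle d.r_pos hz with h | h
  · rw [h]
  · rw [h, gaussLog_sq_mul d.r_pos d.r_lt_one d.ne_zero₁ d.ne_zero₂ (one_div_ne_zero hz0)]
    · rw [mul_one_div]
      exact left_ne_zero_of_mul (thetaPair_ne_zero d.r_pos d.r_lt_one d.mem₁ hz)
    · rw [mul_one_div]
      exact left_ne_zero_of_mul (thetaPair_ne_zero d.r_pos d.r_lt_one d.mem₂ hz)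

/-- On the boundary circles `Re (z g'/g)` has constant sign, opposite to that of `a`. -/
lemma re_gaussLog_boundary (d : IsAnnularData r z₀ z₁ z₂ m a b) {z : ℂ}
    (hz : ‖z‖ = 1 ∨ ‖z‖ = r) : a * (gaussLog r z₁ z₂ z).re < 0 := by
  have hz0 : z ≠ 0 := norm_pos_iff.mp (by
    rcases hz with h | h <;> rw [h]
    · norm_num
    · exact d.r_pos)
  obtain ⟨ρ, hρ0, hρ1, hρ⟩ := d.R_real hz
  obtain ⟨s, hs, es⟩ := exists_mul_deriv_R d.r_pos d.r_lt_one a b d.mem₀ d.mem₁ d.ne₁₀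
  obtain ⟨t, ht, et⟩ := exists_mul_deriv_R d.r_pos d.r_lt_one a b d.mem₀ d.mem₂ d.ne₂₀
  have h := d.mul_q_sub_mul_q hz0 (thetaPair_ne_zero d.r_pos d.r_lt_one d.mem₀ hz)
    (thetaPair_ne_zero d.r_pos d.r_lt_one d.mem₁ hz)
    (thetaPair_ne_zero d.r_pos d.r_lt_one d.mem₂ hz)
  rw [← gaussLog_add_inv d.ne_zero₁ d.ne_zero₂ hz0, d.gaussLog_inv hz, Complex.add_conj, es, et,
    hρ] at h
  have h' : 2 * (gaussLog r z₁ z₂ z).re * (ρ * (1 - ρ)) = -(a * s * ρ + a * t * (1 - ρ)) := by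
    exact_mod_cast h
  have ha : 0 < a ^ 2 := by have := d.a_ne_zero; positivity
  have hpos : 0 < ρ * (1 - ρ) := mul_pos hρ0 (by linarith)
  have h'' : (a * (gaussLog r z₁ z₂ z).re) * (ρ * (1 - ρ))
      = -(a ^ 2 * (s * ρ + t * (1 - ρ)) / 2) := by
    linear_combination (a / 2) * h'
  have hsum : 0 < s * ρ + t * (1 - ρ) := by
    have : 0 < 1 - ρ := by linarith
    positivity
  by_contra! hcon
  have : 0 ≤ (a * (gaussLog r z₁ z₂ z).re) * (ρ * (1 - ρ)) := mul_nonneg hcon hpos.le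
  nlinarith [mul_pos ha hsum]

lemma differentiableAt_gaussLog' (d : IsAnnularData r z₀ z₁ z₂ m a b) {z : ℂ}
    (h1 : z ∈ dom r z₁) (h2 : z ∈ dom r z₂) : DifferentiableAt ℂ (gaussLog r z₁ z₂) z :=
  differentiableAt_gaussLog d.r_pos d.r_lt_one d.ne_zero₁ d.ne_zero₂ (ne_zero_of_mem_dom h1)
    (theta_mul_ne_zero d.r_pos d.r_lt_one h1) (theta_mul_ne_zero d.r_pos d.r_lt_one h2)

/-- `Re (z g'/g)` has no zeros on the closed annulus, by the maximum principle. -/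
lemma re_gaussLog (d : IsAnnularData r z₀ z₁ z₂ m a b) {z : ℂ} (h1 : r ≤ ‖z‖) (h2 : ‖z‖ ≤ 1) :
    a * (gaussLog r z₁ z₂ z).re < 0 := by
  have h := re_pos_of_re_pos_boundary (r := r) (f := fun z => ((-a : ℝ) : ℂ) * gaussLog r z₁ z₂ z)
    (fun w hw1 hw2 => (d.differentiableAt_gaussLog' (mem_dom_of_mem_closure d.r_pos d.mem₁ hw1 hw2)
      (mem_dom_of_mem_closure d.r_pos d.mem₂ hw1 hw2)).const_mul _)
    (fun w hw _ _ => by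
      rw [Complex.re_ofReal_mul]
      have := d.re_gaussLog_boundary hw
      linarith) h1 h2
  rw [Complex.re_ofReal_mul] at h
  linarith

lemma gaussLog_ne_zero (d : IsAnnularData r z₀ z₁ z₂ m a b) {z : ℂ} (h1 : r ≤ ‖z‖)
    (h2 : ‖z‖ ≤ 1) : gaussLog r z₁ z₂ z ≠ 0 := by
  intro h
  have := d.re_gaussLog h1 h2
  simp [h] at this

end IsAnnularData

/-! ### Positivity of the metric -/

/-- The numerator of the logarithmic derivative `z g'/g` of the Gauss map over the denominator
`θ(z₁z) θ(z₂z)`. -/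
noncomputable def gaussNum (r z₁ z₂ : ℝ) (z : ℂ) : ℂ :=
  z₂ * z * deriv (theta r) (z₂ * z) * theta r (z₁ * z)
    - z₁ * z * deriv (theta r) (z₁ * z) * theta r (z₂ * z) - theta r (z₁ * z) * theta r (z₂ * z)

lemma gaussNum_eq {r z₁ z₂ : ℝ} {z : ℂ} (h1 : theta r (z₁ * z) ≠ 0) (h2 : theta r (z₂ * z) ≠ 0) :
    gaussNum r z₁ z₂ z = gaussLog r z₁ z₂ z * (theta r (z₁ * z) * theta r (z₂ * z)) := by
  rw [gaussNum, gaussLog, thetaLog, thetaLog]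
  generalize theta r (z₁ * z) = s at *
  generalize theta r (z₂ * z) = t at *
  field_simp

lemma differentiableAt_gaussNum {r z₁ z₂ : ℝ} (hr0 : 0 < r) (hr1 : r < 1) (h1 : z₁ ≠ 0)
    (h2 : z₂ ≠ 0) {z : ℂ} (hz : z ≠ 0) : DifferentiableAt ℂ (gaussNum r z₁ z₂) z := by
  have h : ∀ x : ℝ, x ≠ 0 →
      DifferentiableAt ℂ (fun z : ℂ => deriv (theta r) (x * z)) z := by
    intro x hx
    have c : (x : ℂ) ≠ 0 := by exact_mod_cast hx
    have h2 : DifferentiableAt ℂ (fun z : ℂ => (x : ℂ) * z) z := by fun_prop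
    exact (differentiableAt_deriv_theta hr0 hr1 (by positivity : (x : ℂ) * z ≠ 0)).comp z h2
  have a1 := h z₁ h1
  have a2 := h z₂ h2
  have a3 := differentiableAt_theta_mul hr0 hr1 h1 hz
  have a4 := differentiableAt_theta_mul hr0 hr1 h2 hz
  unfold gaussNum
  fun_prop

lemma norm_theta_div_of_norm_eq_one {r : ℝ} (hr0 : 0 < r) (hr1 : r < 1) (x : ℝ) {z : ℂ}
    (hz : ‖z‖ = 1) : ‖theta r (x / z)‖ = ‖theta r (x * z)‖ := by
  have hz0 : z ≠ 0 := norm_pos_iff.mp (by rw [hz]; norm_num)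
  have h : (x : ℂ) / z = (starRingEnd ℂ) (x * z) := by
    rw [map_mul, Complex.conj_ofReal, div_eq_iff hz0, mul_assoc, Complex.conj_mul', hz]
    norm_num
  rw [h, theta_conj hr0 hr1, RCLike.norm_conj]

/-- On the inner circle `x/z` is the conjugate of `xz / r²`, and quasi-periodicity applies. -/
lemma norm_theta_div_of_norm_eq {r : ℝ} (hr0 : 0 < r) (hr1 : r < 1) {x : ℝ} (hx : x ≠ 0) {z : ℂ}
    (hz : ‖z‖ = r) : ‖theta r (x / z)‖ = |x| * r * ‖theta r (x * z)‖ := by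
  have hr : (r : ℂ) ≠ 0 := by exact_mod_cast hr0.ne'
  have hx' : (x : ℂ) ≠ 0 := by exact_mod_cast hx
  have hz0 : z ≠ 0 := norm_pos_iff.mp (by rw [hz]; exact hr0)
  have h : (x : ℂ) / z = (starRingEnd ℂ) (x * z) / (r : ℂ) ^ 2 := by
    rw [map_mul, Complex.conj_ofReal, div_eq_div_iff hz0 (by positivity), mul_assoc,
      Complex.conj_mul', hz]
  have hne : (starRingEnd ℂ) (x * z) ≠ 0 := by simp [hx, hz0]
  rw [h, theta_div_sq hr0 hr1 hne, theta_conj hr0 hr1, norm_mul, norm_neg, RCLike.norm_conj,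
    RCLike.norm_conj, norm_mul, hz, Complex.norm_real, Real.norm_eq_abs]

lemma norm_mem_of_circle {r : ℝ} (hr1 : r < 1) {z : ℂ} (hz : ‖z‖ = 1 ∨ ‖z‖ = r) :
    r ≤ ‖z‖ ∧ ‖z‖ ≤ 1 := by
  rcases hz with h | h <;> rw [h]
  · exact ⟨hr1.le, le_rfl⟩
  · exact ⟨le_rfl, hr1.le⟩

namespace IsAnnularData

variable {r z₀ z₁ z₂ m a b : ℝ}

lemma ne_zero_of_le (d : IsAnnularData r z₀ z₁ z₂ m a b) {z : ℂ} (h : r ≤ ‖z‖) : z ≠ 0 :=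
  norm_pos_iff.mp (d.r_pos.trans_le h)

lemma gaussNum_ne_zero (d : IsAnnularData r z₀ z₁ z₂ m a b) {z : ℂ} (h1 : r ≤ ‖z‖)
    (h2 : ‖z‖ ≤ 1) : gaussNum r z₁ z₂ z ≠ 0 := by
  have t1 := theta_mul_ne_zero d.r_pos d.r_lt_one (mem_dom_of_mem_closure d.r_pos d.mem₁ h1 h2)
  have t2 := theta_mul_ne_zero d.r_pos d.r_lt_one (mem_dom_of_mem_closure d.r_pos d.mem₂ h1 h2)
  rw [gaussNum_eq t1 t2]
  exact mul_ne_zero (d.gaussLog_ne_zero h1 h2) (mul_ne_zero t1 t2)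

lemma gaussNum_inv_eq (d : IsAnnularData r z₀ z₁ z₂ m a b) {z : ℂ} (hz : ‖z‖ = 1 ∨ ‖z‖ = r) :
    gaussNum r z₁ z₂ (1 / z) = (starRingEnd ℂ) (gaussLog r z₁ z₂ z)
      * (theta r (z₁ / z) * theta r (z₂ / z)) := by
  have n1 := left_ne_zero_of_mul (thetaPair_ne_zero d.r_pos d.r_lt_one d.mem₁ hz)
  have n2 := left_ne_zero_of_mul (thetaPair_ne_zero d.r_pos d.r_lt_one d.mem₂ hz)
  rw [gaussNum_eq (by rwa [mul_one_div]) (by rwa [mul_one_div]), d.gaussLog_inv hz, mul_one_div,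
    mul_one_div]

lemma gaussNum_inv_ne_zero (d : IsAnnularData r z₀ z₁ z₂ m a b) {z : ℂ}
    (hz : ‖z‖ = 1 ∨ ‖z‖ = r) : gaussNum r z₁ z₂ (1 / z) ≠ 0 := by
  have n1 := left_ne_zero_of_mul (thetaPair_ne_zero d.r_pos d.r_lt_one d.mem₁ hz)
  have n2 := left_ne_zero_of_mul (thetaPair_ne_zero d.r_pos d.r_lt_one d.mem₂ hz)
  obtain ⟨h1, h2⟩ := norm_mem_of_circle d.r_lt_one hz
  rw [d.gaussNum_inv_eq hz]
  exact mul_ne_zero ((map_ne_zero _).mpr (d.gaussLog_ne_zero h1 h2)) (mul_ne_zero n1 n2)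

lemma differentiableAt_gaussNum_inv (d : IsAnnularData r z₀ z₁ z₂ m a b) {z : ℂ} (hz : z ≠ 0) :
    DifferentiableAt ℂ (fun z => gaussNum r z₁ z₂ (1 / z)) z := by
  have h1 : DifferentiableAt ℂ (fun z : ℂ => 1 / z) z := by fun_prop (disch := assumption)
  exact (differentiableAt_gaussNum d.r_pos d.r_lt_one d.ne_zero₁ d.ne_zero₂
    (one_div_ne_zero hz)).comp z h1

/-- `gaussNum (1/z)` has a zero in the annulus: otherwise `1 / gaussLog (1/z)`, which vanishes at
`z₁`, would be a holomorphic function whose real part has a constant sign on the boundary. -/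
lemma exists_gaussNum_inv_eq_zero (d : IsAnnularData r z₀ z₁ z₂ m a b) :
    ∃ w ∈ annulus r, gaussNum r z₁ z₂ (1 / w) = 0 := by
  by_contra! hcon
  have hne : ∀ z : ℂ, r ≤ ‖z‖ → ‖z‖ ≤ 1 → gaussNum r z₁ z₂ (1 / z) ≠ 0 := by
    intro z h1 h2
    rcases h1.eq_or_lt with h | h1'
    · exact d.gaussNum_inv_ne_zero (Or.inr h.symm)
    rcases h2.eq_or_lt with h | h2'
    · exact d.gaussNum_inv_ne_zero (Or.inl h)
    exact hcon z ⟨h1', h2'⟩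
  have hz₁ : z₁ < 0 := by linarith [d.mem₁.2, d.r_pos]
  have e : ‖(z₁ : ℂ)‖ = -z₁ := by rw [Complex.norm_real, Real.norm_eq_abs, abs_of_neg hz₁]
  have h := re_pos_of_re_pos_boundary (r := r) (f := fun z => ((-a : ℝ) : ℂ) *
      (theta r (z₁ / z) * theta r (z₂ / z) / gaussNum r z₁ z₂ (1 / z))) (z := z₁)
    (fun w hw1 hw2 => by
      have hw0 := d.ne_zero_of_le hw1
      exact (((differentiableAt_theta_div d.r_pos d.r_lt_one d.ne_zero₁ hw0).mul
        (differentiableAt_theta_div d.r_pos d.r_lt_one d.ne_zero₂ hw0)).div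
        (d.differentiableAt_gaussNum_inv hw0) (hne w hw1 hw2)).const_mul _)
    (fun w hw hw1 hw2 => by
      have n1 := left_ne_zero_of_mul (thetaPair_ne_zero d.r_pos d.r_lt_one d.mem₁ hw)
      have n2 := left_ne_zero_of_mul (thetaPair_ne_zero d.r_pos d.r_lt_one d.mem₂ hw)
      have hg := d.gaussLog_ne_zero hw1 hw2
      rw [d.gaussNum_inv_eq hw, div_mul_cancel_right₀ (mul_ne_zero n1 n2), Complex.re_ofReal_mul,
        Complex.inv_re, Complex.conj_re, Complex.normSq_conj]
      have := d.re_gaussLog_boundary hw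
      have hN : 0 < Complex.normSq (gaussLog r z₁ z₂ w) := Complex.normSq_pos.mpr hg
      rw [mul_div_assoc']
      exact div_pos (by linarith) hN)
    (by rw [e]; linarith [d.mem₁.2]) (by rw [e]; linarith [d.mem₁.1])
  have c1 : (z₁ : ℂ) ≠ 0 := by exact_mod_cast d.ne_zero₁
  simp [div_self c1, theta_one d.r_pos d.r_lt_one] at h

/-- The inequality which makes the first fundamental form positive definite. It becomes an equality
on the boundary, by `C3` on the inner circle. -/
lemma norm_gaussNum_inv_lt (d : IsAnnularData r z₀ z₁ z₂ m a b) {z : ℂ} (hz : z ∈ annulus r) :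
    ‖gaussNum r z₁ z₂ (1 / z)‖ * ‖z‖ ^ (2 * m + 2) < ‖gaussNum r z₁ z₂ z‖ := by
  obtain ⟨w, hw, hw0⟩ := d.exists_gaussNum_inv_eq_zero
  have h := norm_mul_rpow_lt_one (f := fun z => gaussNum r z₁ z₂ (1 / z) / gaussNum r z₁ z₂ z)
    d.r_pos (2 * m + 2)
    (fun v h1 h2 => (d.differentiableAt_gaussNum_inv (d.ne_zero_of_le h1)).div
      (differentiableAt_gaussNum d.r_pos d.r_lt_one d.ne_zero₁ d.ne_zero₂ (d.ne_zero_of_le h1))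
      (d.gaussNum_ne_zero h1 h2))
    (fun v hv => by
      have t1 := right_ne_zero_of_mul (thetaPair_ne_zero d.r_pos d.r_lt_one d.mem₁ hv)
      have t2 := right_ne_zero_of_mul (thetaPair_ne_zero d.r_pos d.r_lt_one d.mem₂ hv)
      obtain ⟨h1, h2⟩ := norm_mem_of_circle d.r_lt_one hv
      have hg := d.gaussLog_ne_zero h1 h2
      rw [d.gaussNum_inv_eq hv, gaussNum_eq t1 t2]
      simp only [norm_div, norm_mul, RCLike.norm_conj]
      have p1 : ‖gaussLog r z₁ z₂ v‖ ≠ 0 := norm_ne_zero_iff.mpr hg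
      have p2 := norm_ne_zero_iff.mpr t1
      have p3 := norm_ne_zero_iff.mpr t2
      have q1 := norm_theta_div_of_norm_eq_one d.r_pos d.r_lt_one z₁ (z := v)
      have q2 := norm_theta_div_of_norm_eq_one d.r_pos d.r_lt_one z₂ (z := v)
      have q3 := norm_theta_div_of_norm_eq d.r_pos d.r_lt_one d.ne_zero₁ (z := v)
      have q4 := norm_theta_div_of_norm_eq d.r_pos d.r_lt_one d.ne_zero₂ (z := v)
      generalize ‖theta r (z₁ * v)‖ = s at *
      generalize ‖theta r (z₂ * v)‖ = t at *
      rcases hv with hv | hv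
      · rw [q1 hv, q2 hv, hv, Real.one_rpow]
        field_simp
      · rw [q3 hv, q4 hv, hv]
        have h3 : |z₁| * |z₂| * (r ^ 2 * r ^ (2 * m + 2)) = 1 := by
          rw [← abs_mul, abs_of_pos (mul_pos_of_neg_of_neg (by linarith [d.mem₁.2, d.r_pos])
            (by linarith [d.mem₂.2, d.r_pos])), ← Real.rpow_natCast r 2, ← Real.rpow_add d.r_pos,
            ← d.C3]
          congr 2
          push_cast
          ring
        rw [← h3]
        field_simp) hw (by simp only [hw0, zero_div]) hz
  have hg := d.gaussNum_ne_zero hz.1.le hz.2.le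
  rw [norm_div, div_mul_eq_mul_div, div_lt_one (norm_pos_iff.mpr hg)] at h
  exact h

end IsAnnularData

/-! ### The surface attached to conformal data -/

/-- The `ℝ`-linear form `v ↦ Re (κ v)`. -/
noncomputable def reMul (κ : ℂ) : ℂ →L[ℝ] ℝ := Complex.reCLM.comp (ContinuousLinearMap.mul ℝ ℂ κ)

@[simp] lemma reMul_apply (κ v : ℂ) : reMul κ v = (κ * v).re := by simp [reMul]

section

variable {g F : ℂ → ℂ} {u : ℂ → ℝ} {z g' F' : ℂ}

/-- The velocity of the surface along a curve with `g`-velocity `γ` and `F`-velocity `φ`;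
`E` stands for `exp (2u)` and `f` for the value of `F`. -/
noncomputable def velocity (E : ℝ) (f γ φ : ℂ) : E3 :=
  let N : ℝ := 1 + E ^ 2 * (f.re ^ 2 + f.im ^ 2)
  let e : ℝ := (f * γ).re
  let N' : ℝ := 4 * E ^ 2 * e * (f.re ^ 2 + f.im ^ 2) + 2 * E ^ 2 * (f.re * φ.re + f.im * φ.im)
  let k' : ℝ := 4 * E ^ 2 * e / N - E ^ 2 * N' / N ^ 2
  !₂[γ.re - k' * f.re - E ^ 2 / N * φ.re, γ.im + k' * f.im + E ^ 2 / N * φ.im,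
    2 * E * e / N - E * N' / N ^ 2]

/-- The surface in real coordinates, rational in `exp (2u)`. -/
lemma surface_eq (g : ℂ → ℂ) (u : ℂ → ℝ) (F : ℂ → ℂ) (z : ℂ) :
    surface g u F z =
      !₂[(g z).re - Real.exp (2 * u z) ^ 2
            / (1 + Real.exp (2 * u z) ^ 2 * ((F z).re ^ 2 + (F z).im ^ 2)) * (F z).re,
        (g z).im + Real.exp (2 * u z) ^ 2
            / (1 + Real.exp (2 * u z) ^ 2 * ((F z).re ^ 2 + (F z).im ^ 2)) * (F z).im,
        Real.exp (2 * u z) / (1 + Real.exp (2 * u z) ^ 2 * ((F z).re ^ 2 + (F z).im ^ 2))] := by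
  have h1 : Real.exp (4 * u z) = Real.exp (2 * u z) ^ 2 := by
    rw [← Real.exp_nat_mul]
    congr 1
    push_cast
    ring
  have h2 : ‖F z‖ ^ 2 = (F z).re ^ 2 + (F z).im ^ 2 := by
    rw [← Complex.normSq_eq_norm_sq, Complex.normSq_apply]
    ring
  have h3 : ∀ (h E : ℝ) (c f : ℂ), (!₂[(c - ((h * E : ℝ) : ℂ) * (starRingEnd ℂ) f).re,
      (c - ((h * E : ℝ) : ℂ) * (starRingEnd ℂ) f).im, h] : E3)
      = !₂[c.re - h * E * f.re, c.im + h * E * f.im, h] := by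
    intro h E c f
    rw [Complex.sub_re, Complex.sub_im, Complex.re_ofReal_mul, Complex.im_ofReal_mul,
      Complex.conj_re, Complex.conj_im, mul_neg, sub_neg_eq_add]
  rw [surface, h1, h2, h3, div_mul_eq_mul_div, ← pow_two]

lemma one_add_pos (E x y : ℝ) : 0 < 1 + E ^ 2 * (x ^ 2 + y ^ 2) := by positivity

lemma hasDerivAt_surface_line (hg : HasDerivAt g g' z) (hF : HasDerivAt F F' z)
    (hu : HasFDerivAt u (reMul (F z * g')) z) (v : ℂ) :
    HasDerivAt (fun t : ℝ => surface g u F (z + t * v))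
      (velocity (Real.exp (2 * u z)) (F z) (g' * v) (F' * v)) 0 := by
  have hl : HasDerivAt (fun t : ℝ => z + t * v) v 0 := by
    simpa using (((hasDerivAt_id (0 : ℝ)).ofReal_comp).mul_const v).const_add z
  have hz : z + ((0 : ℝ) : ℂ) * v = z := by simp
  have dg : HasDerivAt (fun t : ℝ => g (z + t * v)) (g' * v) 0 := by
    have := (by rwa [hz] : HasDerivAt g g' (z + ((0 : ℝ) : ℂ) * v)).comp (0 : ℝ) hl
    exact this
  have dF : HasDerivAt (fun t : ℝ => F (z + t * v)) (F' * v) 0 := by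
    have := (by rwa [hz] : HasDerivAt F F' (z + ((0 : ℝ) : ℂ) * v)).comp (0 : ℝ) hl
    exact this
  have du : HasDerivAt (fun t : ℝ => u (z + t * v)) ((F z * (g' * v)).re) 0 := by
    have h : HasFDerivAt u (reMul (F z * g')) (z + ((0 : ℝ) : ℂ) * v) := by rw [hz]; exact hu
    have := h.comp_hasDerivAt (0 : ℝ) hl
    rw [reMul_apply, mul_assoc] at this
    exact this
  have dgr := (Complex.reCLM.hasFDerivAt.comp_hasDerivAt (0 : ℝ) dg)
  have dgi := (Complex.imCLM.hasFDerivAt.comp_hasDerivAt (0 : ℝ) dg)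
  have dFr := (Complex.reCLM.hasFDerivAt.comp_hasDerivAt (0 : ℝ) dF)
  have dFi := (Complex.imCLM.hasFDerivAt.comp_hasDerivAt (0 : ℝ) dF)
  have dE := (du.const_mul 2).exp
  simp only [Complex.reCLM_apply, Complex.imCLM_apply, Function.comp_def] at dgr dgi dFr dFi
  have dN := ((dE.fun_pow 2).fun_mul ((dFr.fun_pow 2).fun_add (dFi.fun_pow 2))).const_add 1
  have hN := (one_add_pos (Real.exp (2 * u (z + ((0 : ℝ) : ℂ) * v)))
    (F (z + ((0 : ℝ) : ℂ) * v)).re (F (z + ((0 : ℝ) : ℂ) * v)).im).ne'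
  have dk := (dE.fun_pow 2).fun_div dN hN
  have d0 := dgr.fun_sub (dk.fun_mul dFr)
  have d1 := dgi.fun_add (dk.fun_mul dFi)
  have d2 := dE.fun_div dN hN
  simp only [hz] at d0 d1 d2 hN
  rw [hasDerivAt_iff_hasFDerivAt, ← hasFDerivWithinAt_univ, hasFDerivWithinAt_euclidean]
  simp only [surface_eq, velocity]
  intro i
  rw [hasFDerivWithinAt_univ, hasFDerivAt_iff_hasDerivAt]
  generalize Real.exp (2 * u z) = E at *
  generalize F z = f at *
  generalize hn : 1 + E ^ 2 * (f.re ^ 2 + f.im ^ 2) = N at *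
  fin_cases i
  · refine d0.congr_deriv ?_
    simp
    field_simp
    ring
  · refine d1.congr_deriv ?_
    simp
    field_simp
    ring
  · refine d2.congr_deriv ?_
    simp
    field_simp
    ring

/-- At a point `p` at the height of the surface, the hyperbolic length of the velocity is given by
`e^{-4u} |e^{4u} (dF + F² dg) - conj dg|²`. -/
lemma hypNormSq_velocity {E : ℝ} (hE : 0 < E) (f γ φ : ℂ) (p : E3)
    (hp : p 2 = E / (1 + E ^ 2 * (f.re ^ 2 + f.im ^ 2))) :
    hypNormSq p (velocity E f γ φ) = (E ^ 2)⁻¹ *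
      ‖((E ^ 2 : ℝ) : ℂ) * (φ + f ^ 2 * γ) - (starRingEnd ℂ) γ‖ ^ 2 := by
  have hN := (one_add_pos E f.re f.im).ne'
  rw [hypNormSq, hp, EuclideanSpace.real_norm_sq_eq, Fin.sum_univ_three,
    ← Complex.normSq_eq_norm_sq, Complex.normSq_apply]
  simp only [velocity]
  obtain ⟨x, y⟩ := f
  obtain ⟨s, t⟩ := γ
  obtain ⟨c, d⟩ := φ
  simp [pow_two] at hN ⊢
  field_simp
  ring

end

section

variable {g F : ℂ → ℂ} {u : ℂ → ℝ} {U : Set ℂ}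

lemma contDiffOn_surface (hU : IsOpen U) (hg : DifferentiableOn ℂ g U)
    (hF : DifferentiableOn ℂ F U) (hu : ContDiffOn ℝ ∞ u U) :
    ContDiffOn ℝ ∞ (surface g u F) U := by
  have cg : ContDiffOn ℝ ∞ g U := (hg.contDiffOn hU).restrict_scalars ℝ
  have cF : ContDiffOn ℝ ∞ F U := (hF.contDiffOn hU).restrict_scalars ℝ
  have cgr : ContDiffOn ℝ ∞ (fun z => (g z).re) U := Complex.reCLM.contDiff.comp_contDiffOn cg
  have cgi : ContDiffOn ℝ ∞ (fun z => (g z).im) U := Complex.imCLM.contDiff.comp_contDiffOn cg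
  have cFr : ContDiffOn ℝ ∞ (fun z => (F z).re) U := Complex.reCLM.contDiff.comp_contDiffOn cF
  have cFi : ContDiffOn ℝ ∞ (fun z => (F z).im) U := Complex.imCLM.contDiff.comp_contDiffOn cF
  have cE : ContDiffOn ℝ ∞ (fun z => Real.exp (2 * u z)) U := (contDiffOn_const.mul hu).exp
  have cN := contDiffOn_const (c := (1 : ℝ)).add
    ((cE.pow 2).mul ((cFr.pow 2).add (cFi.pow 2)))
  have hN : ∀ z ∈ U, 1 + Real.exp (2 * u z) ^ 2 * ((F z).re ^ 2 + (F z).im ^ 2) ≠ 0 :=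
    fun z _ => (one_add_pos _ _ _).ne'
  have ck := (cE.pow 2).div cN hN
  rw [contDiffOn_euclidean]
  intro i
  simp only [surface_eq]
  fin_cases i
  · exact cgr.sub (ck.mul cFr)
  · exact cgi.add (ck.mul cFi)
  · exact cE.div cN hN

lemma fderiv_surface {z g' F' : ℂ} (hd : DifferentiableAt ℝ (surface g u F) z)
    (hg : HasDerivAt g g' z) (hF : HasDerivAt F F' z)
    (hu : HasFDerivAt u (reMul (F z * g')) z) (v : ℂ) :
    fderiv ℝ (surface g u F) z v = velocity (Real.exp (2 * u z)) (F z) (g' * v) (F' * v) := by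
  have hl : HasDerivAt (fun t : ℝ => z + t * v) v 0 := by
    simpa using (((hasDerivAt_id (0 : ℝ)).ofReal_comp).mul_const v).const_add z
  have h1 : HasFDerivAt (surface g u F) (fderiv ℝ (surface g u F) z) (z + ((0 : ℝ) : ℂ) * v) := by
    simpa using hd.hasFDerivAt
  have h2 := HasFDerivAt.comp_hasDerivAt (f := fun t : ℝ => z + t * v) (0 : ℝ) h1 hl
  exact h2.unique (hasDerivAt_surface_line hg hF hu v)

/-- The induced metric of the surface is the first fundamental form of the data. -/
lemma inducedMetric_surface {z g' F' : ℂ} (hd : DifferentiableAt ℝ (surface g u F) z)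
    (hg : HasDerivAt g g' z) (hF : HasDerivAt F F' z)
    (hu : HasFDerivAt u (reMul (F z * g')) z) (v : ℂ) :
    inducedMetric (surface g u F) z v = dataMetric g u F z v := by
  rw [inducedMetric, fderiv_surface hd hg hF hu, hypNormSq_velocity (Real.exp_pos _), dataMetric,
    hg.deriv, hF.deriv]
  · have h1 : Real.exp (4 * u z) = Real.exp (2 * u z) ^ 2 := by
      rw [← Real.exp_nat_mul]
      congr 1
      push_cast
      ring
    have h2 : Real.exp (-4 * u z) = (Real.exp (2 * u z) ^ 2)⁻¹ := by
      rw [← h1, ← Real.exp_neg]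
      congr 1
      ring
    rw [h1, h2, add_mul, mul_assoc (F z ^ 2)]
  · rw [surface_eq]
    simp

/-- The first fundamental form is `|dA - conj dB|²` with holomorphic `A` and `B`, so `A - conj B`
is a local isometry to the Euclidean plane. -/
lemma exists_flat_coordinate (hU : IsOpen U) (hg : DifferentiableOn ℂ g U)
    (hF : DifferentiableOn ℂ F U)
    (hu : ∀ z ∈ U, HasFDerivAt u (reMul (F z * deriv g z)) z) {z : ℂ} (hz : z ∈ U) :
    ∃ V : Set ℂ, IsOpen V ∧ z ∈ V ∧ V ⊆ U ∧ ∃ φ : ℂ → ℂ, ContDiffOn ℝ ∞ φ V ∧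
      ∀ w ∈ V, ∀ v : ℂ, ‖fderiv ℝ φ w v‖ ^ 2 = dataMetric g u F w v := by
  obtain ⟨ε, hε, hV⟩ := Metric.isOpen_iff.mp hU z hz
  have dg := hg.mono hV
  have dF := hF.mono hV
  have dg' := dg.deriv Metric.isOpen_ball
  have dF' := dF.deriv Metric.isOpen_ball
  obtain ⟨Φ, hΦz, hΦ⟩ := (dF.mul dg').isExactOn_ball.with_val_at z (u z)
  -- `u` is the real part of `Φ`, since both have the same differential
  have hre : ∀ w ∈ Metric.ball z ε, (Φ w).re = u w := by
    intro w hw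
    have hd : ∀ y ∈ Metric.ball z ε,
        HasFDerivAt (fun y => (Φ y).re - u y) (0 : ℂ →L[ℝ] ℝ) y := by
      intro y hy
      have h1 := Complex.reCLM.hasFDerivAt.comp y ((hΦ y hy).hasFDerivAt.restrictScalars ℝ)
      refine (h1.sub (hu y (hV hy))).congr_fderiv ?_
      ext v
      simp [mul_comm]
    have h2 := (convex_ball z ε).is_const_of_fderivWithin_eq_zero (𝕜 := ℝ)
      (f := fun y => (Φ y).re - u y)
      (fun y hy => (hd y hy).differentiableAt.differentiableWithinAt)
      (fun y hy => by
        rw [fderivWithin_of_isOpen Metric.isOpen_ball hy, (hd y hy).fderiv]) hw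
      (Metric.mem_ball_self hε)
    simp only [hΦz, Complex.ofReal_re, sub_self] at h2
    linarith
  have dΦ : DifferentiableOn ℂ Φ (Metric.ball z ε) := fun w hw =>
    (hΦ w hw).differentiableAt.differentiableWithinAt
  -- `A' = e^{2Φ} (F' + F² g')` and `B' = e^{-2Φ} g'`
  have dA' : DifferentiableOn ℂ (fun w => Complex.exp (2 * Φ w) * (deriv F w + F w ^ 2 * deriv g w))
      (Metric.ball z ε) := ((dΦ.const_mul 2).cexp).mul (dF'.add ((dF.pow 2).mul dg'))
  have dB' : DifferentiableOn ℂ (fun w => Complex.exp (-(2 * Φ w)) * deriv g w)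
      (Metric.ball z ε) := ((dΦ.const_mul 2).neg.cexp).mul dg'
  obtain ⟨A, hA⟩ := dA'.isExactOn_ball
  obtain ⟨B, hB⟩ := dB'.isExactOn_ball
  have cA : ContDiffOn ℝ ∞ A (Metric.ball z ε) := by
    have : DifferentiableOn ℂ A (Metric.ball z ε) := fun w hw =>
      (hA w hw).differentiableAt.differentiableWithinAt
    exact (this.contDiffOn Metric.isOpen_ball).restrict_scalars ℝ
  have cB : ContDiffOn ℝ ∞ B (Metric.ball z ε) := by
    have : DifferentiableOn ℂ B (Metric.ball z ε) := fun w hw =>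
      (hB w hw).differentiableAt.differentiableWithinAt
    exact (this.contDiffOn Metric.isOpen_ball).restrict_scalars ℝ
  refine ⟨Metric.ball z ε, Metric.isOpen_ball, Metric.mem_ball_self hε, hV,
    fun w => A w - (starRingEnd ℂ) (B w),
    cA.sub (Complex.conjCLE.contDiff.comp_contDiffOn cB), fun w hw v => ?_⟩
  have h1 := (hA w hw).hasFDerivAt.restrictScalars ℝ
  have h2 := (Complex.conjCLE.hasFDerivAt (x := B w)).comp w
    ((hB w hw).hasFDerivAt.restrictScalars ℝ)
  have h3 : HasFDerivAt (fun w => A w - (starRingEnd ℂ) (B w)) _ w := h1.sub h2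
  rw [h3.fderiv, dataMetric, ← hre w hw]
  have e1 : ((Real.exp (4 * (Φ w).re) : ℝ) : ℂ)
      = Complex.exp (2 * Φ w) * (starRingEnd ℂ) (Complex.exp (2 * Φ w)) := by
    rw [← Complex.exp_conj, ← Complex.exp_add, Complex.ofReal_exp]
    congr 1
    push_cast
    simp only [map_mul, Complex.conj_ofNat]
    rw [← mul_add, Complex.add_conj]
    push_cast
    ring
  have e2 : Real.exp (-4 * (Φ w).re) = ‖(starRingEnd ℂ) (Complex.exp (-(2 * Φ w)))‖ ^ 2 := by
    rw [RCLike.norm_conj, Complex.norm_exp, ← Real.exp_nat_mul]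
    congr 1
    simp
    ring
  have e3 : (starRingEnd ℂ) (Complex.exp (-(2 * Φ w))) * (starRingEnd ℂ) (Complex.exp (2 * Φ w))
      = 1 := by
    rw [← map_mul, ← Complex.exp_add]
    simp
  rw [e2, ← mul_pow, ← norm_mul, e1]
  congr 2
  simp only [sub_apply, ContinuousLinearMap.comp_apply,
    ContinuousLinearMap.coe_restrictScalars', ContinuousLinearMap.toSpanSingleton_apply,
    ContinuousLinearEquiv.coe_coe, Complex.conjCLE_apply, smul_eq_mul, map_mul]
  linear_combination (-(Complex.exp (2 * Φ w) * (deriv F w + F w ^ 2 * deriv g w) * v)) * e3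

lemma isFlatImmersionOn_surface (hU : IsOpen U) (hg : DifferentiableOn ℂ g U)
    (hF : DifferentiableOn ℂ F U) (hus : ContDiffOn ℝ ∞ u U)
    (hu : ∀ z ∈ U, HasFDerivAt u (reMul (F z * deriv g z)) z)
    (hpos : ∀ z ∈ U, ∀ v : ℂ, v ≠ 0 → 0 < dataMetric g u F z v) :
    IsFlatImmersionOn (surface g u F) U := by
  have hs := contDiffOn_surface hU hg hF hus
  have hm : ∀ z ∈ U, ∀ v, inducedMetric (surface g u F) z v = dataMetric g u F z v := by
    intro z hz v
    have hUz := hU.mem_nhds hz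
    exact inducedMetric_surface ((hs.differentiableOn (by simp)).differentiableAt hUz)
      (hg.differentiableAt hUz).hasDerivAt (hF.differentiableAt hUz).hasDerivAt (hu z hz) v
  refine ⟨fun z _ => ?_, hs, fun z hz => ?_, fun z hz => ?_⟩
  · rw [surface_eq]
    simp only [Matrix.cons_val]
    have := one_add_pos (Real.exp (2 * u z)) (F z).re (F z).im
    positivity
  · rw [injective_iff_map_eq_zero]
    intro v hv
    by_contra hne
    have := hpos z hz v hne
    rw [← hm z hz, inducedMetric, hv, hypNormSq] at this
    simp at this
  · obtain ⟨V, h1, h2, h3, φ, h4, h5⟩ := exists_flat_coordinate hU hg hF hu hz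
    exact ⟨V, h1, h2, h3, φ, h4, fun w hw v => by rw [h5 w hw, hm w (h3 hw)]⟩

end

/-! ### Conical singularities -/

/-- If near `S` the height of the surface over its limit point is comparable to the distance from
that point, the surface lies in a half-cone with vertex `P` and has no tangent plane there. -/
lemma hasIsolatedSingularity_of_cone {ψ : ℂ → E3} {U S : Set ℂ} {P : E3}
    (hT : Tendsto ψ (𝓝ˢ S ⊓ 𝓟 U) (𝓝 P)) {σ c : ℝ} (hc : 0 < c)
    (hcone : ∀ᶠ z in 𝓝ˢ S ⊓ 𝓟 U, c * ‖ψ z - P‖ ≤ σ * (ψ z 2 - P 2)) :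
    HasIsolatedSingularity ψ U S P := by
  refine ⟨hT, fun φ Ψ _ _ _ _ hmap hΨ hΨd hinj => ?_⟩
  have hball : Metric.ball (0 : ℂ) 1 ∈ 𝓝 (0 : ℂ) := Metric.ball_mem_nhds 0 one_pos
  have hd : DifferentiableAt ℝ Ψ 0 := (hΨd.differentiableOn (by simp)).differentiableAt hball
  have hev : ∀ᶠ w in 𝓝[≠] (0 : ℂ), Ψ w = ψ (φ w) := by
    filter_upwards [mem_nhdsWithin_of_mem_nhds hball, self_mem_nhdsWithin] with w h1 h2
    exact hΨ w ⟨h1, h2⟩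
  have hφ : Tendsto φ (𝓝[≠] 0) (𝓝ˢ S ⊓ 𝓟 U) := hmap.le
  have hP : Ψ 0 = P := by
    refine tendsto_nhds_unique (hd.continuousAt.tendsto.mono_left nhdsWithin_le_nhds)
      (f := Ψ) (l := 𝓝[≠] (0 : ℂ)) ?_
    exact (hT.comp hφ).congr' (by filter_upwards [hev] with w hw using hw.symm)
  have hcone' : ∀ᶠ w in 𝓝[≠] (0 : ℂ), c * ‖Ψ w - Ψ 0‖ ≤ σ * (Ψ w 2 - Ψ 0 2) := by
    filter_upwards [hφ.eventually hcone, hev] with w h1 h2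
    rw [h2, hP]
    exact h1
  -- the cone condition passes to the differential, and for both `v` and `-v` it forces zero
  have hdir : ∀ v : ℂ, c * ‖fderiv ℝ Ψ 0 v‖ ≤ σ * (fderiv ℝ Ψ 0 v) 2 := by
    intro v
    rcases eq_or_ne v 0 with rfl | hv
    · simp
    have hl : HasDerivAt (fun t : ℝ => (t : ℂ) * v) v 0 := by
      simpa using (((hasDerivAt_id (0 : ℝ)).ofReal_comp).mul_const v)
    have h1 : HasFDerivAt Ψ (fderiv ℝ Ψ 0) (((0 : ℝ) : ℂ) * v) := by
      simpa using hd.hasFDerivAt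
    have h2 := (h1.comp_hasDerivAt (0 : ℝ) hl).tendsto_slope_zero_right
    have h3 : Tendsto (fun t : ℝ => (t : ℂ) * v) (𝓝[>] 0) (𝓝[≠] 0) := by
      refine tendsto_nhdsWithin_iff.mpr ⟨?_, ?_⟩
      · have := hl.continuousAt.tendsto.mono_left (nhdsWithin_le_nhds (s := Set.Ioi 0))
        simpa using this
      · filter_upwards [self_mem_nhdsWithin] with t ht
        have ht' : (t : ℝ) ≠ 0 := (Set.mem_Ioi.mp ht).ne'
        simp [ht', hv]
    have h4 : Tendsto (fun y : E3 => σ * y 2 - c * ‖y‖) (𝓝 (fderiv ℝ Ψ 0 v))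
        (𝓝 (σ * (fderiv ℝ Ψ 0 v) 2 - c * ‖fderiv ℝ Ψ 0 v‖)) := by
      apply Continuous.tendsto
      fun_prop
    have h5 := h4.comp h2
    have h6 : 0 ≤ σ * (fderiv ℝ Ψ 0 v) 2 - c * ‖fderiv ℝ Ψ 0 v‖ := by
      refine ge_of_tendsto h5 ?_
      filter_upwards [h3.eventually hcone', self_mem_nhdsWithin] with t h7 h8
      have ht : 0 < t := h8
      have h9 : 0 ≤ t⁻¹ * (σ * (Ψ (t * v) 2 - Ψ 0 2) - c * ‖Ψ (t * v) - Ψ 0‖) :=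
        mul_nonneg (by positivity) (by linarith)
      simp only [Function.comp_apply, zero_add, Complex.ofReal_zero, zero_mul, norm_smul,
        Real.norm_eq_abs, abs_of_pos (inv_pos.mpr ht), PiLp.smul_apply, PiLp.sub_apply,
        smul_eq_mul]
      linarith
    linarith
  have h1 := hdir 1
  have h2 := hdir (-1)
  rw [map_neg, norm_neg, PiLp.neg_apply] at h2
  have h3 : ‖fderiv ℝ Ψ 0 1‖ = 0 := by
    have := norm_nonneg (fderiv ℝ Ψ 0 1)
    nlinarith
  have h4 : fderiv ℝ Ψ 0 1 = fderiv ℝ Ψ 0 0 := by rw [map_zero]; exact norm_eq_zero.mp h3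
  exact one_ne_zero (hinj h4)

/-- A `C¹` map that is constant on the circle `|z| = ρ`, and whose height has a radial derivative
of constant sign there, has a conical singularity at the circle. Here `τ` and `σ` are the signs of
`|z| - ρ` on `U` and of the height over the limit point. -/
lemma hasIsolatedSingularity_of_radial {ψ ψ' : ℂ → E3} {U : Set ℂ} {P : E3} {ρ σ τ : ℝ}
    (hρ : 0 < ρ) (hU : ∀ z ∈ U, 0 < τ * (‖z‖ - ρ)) (hτ : |τ| = 1)
    (hψ : ∀ z ∈ U, ψ z = ψ' z)
    (hd : ∀ p : ℂ, ‖p‖ = ρ → ContDiffAt ℝ 1 ψ' p) (hP : ∀ p : ℂ, ‖p‖ = ρ → ψ' p = P)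
    (hrad : ∀ p : ℂ, ‖p‖ = ρ → 0 < σ * τ * (fderiv ℝ ψ' p p) 2) :
    HasIsolatedSingularity ψ U {z : ℂ | ‖z‖ = ρ} P := by
  have hS : IsCompact {z : ℂ | ‖z‖ = ρ} := by
    have : {z : ℂ | ‖z‖ = ρ} = Metric.sphere 0 ρ := by ext; simp
    rw [this]
    exact isCompact_sphere 0 ρ
  have hloc : ∀ p : ℂ, ‖p‖ = ρ → ∃ c : ℝ, 0 < c ∧ ∀ᶠ z in 𝓝 p, z ∈ U →
      c * ‖ψ' z - P‖ ≤ σ * (ψ' z 2 - P 2) := by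
    intro p hp
    have hp0 : p ≠ 0 := norm_pos_iff.mp (by rw [hp]; exact hρ)
    set L := fderiv ℝ ψ' p with hL
    have hs : HasStrictFDerivAt ψ' L p := (hd p hp).hasStrictFDerivAt one_ne_zero
    set δ := σ * τ * (L p) 2 with hδ
    have hδpos : 0 < δ := hrad p hp
    -- the error term in the height, `|σ| ε |s| (ρ + 1)`, is then at most half of `|s| δ / 2`
    have hε : 0 < δ / (4 * (|σ| + 1) * (ρ + 1)) := by positivity
    set ε := δ / (4 * (|σ| + 1) * (ρ + 1)) with hεdef
    -- `z` is compared with its radial projection to the circle, where `ψ'` takes the value `P`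
    have hζ : Tendsto (fun z : ℂ => (z, ((ρ / ‖z‖ : ℝ) : ℂ) * z)) (𝓝 p) (𝓝 (p, p)) := by
      have h1 : ContinuousAt (fun z : ℂ => (z, ((ρ / ‖z‖ : ℝ) : ℂ) * z)) p := by
        have : ‖p‖ ≠ 0 := norm_ne_zero_iff.mpr hp0
        fun_prop (disch := assumption)
      have h2 : ((ρ / ‖p‖ : ℝ) : ℂ) * p = p := by rw [hp, div_self hρ.ne']; simp
      have := h1.tendsto
      rwa [h2] at this
    have hev1 := hζ.eventually (hs.isLittleO.def hε)
    have hev2 : ∀ᶠ z in 𝓝 p, δ / 2 < σ * τ * (L z) 2 := by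
      have hc : Continuous fun z : ℂ => σ * τ * (L z) 2 := by fun_prop
      exact hc.continuousAt.eventually_const_lt (by simp only [← hδ]; linarith)
    have hev3 : ∀ᶠ z in 𝓝 p, ‖z‖ < ρ + 1 :=
      continuous_norm.continuousAt.eventually_lt_const (by simp only [hp]; linarith)
    have hC : 0 < (‖L‖ + ε) * (ρ + 1) := by positivity
    refine ⟨(δ / 4) / ((‖L‖ + ε) * (ρ + 1)), by positivity, ?_⟩
    filter_upwards [hev1, hev2, hev3, isOpen_ne.mem_nhds hp0] with z h1 h2 h3 hz0 hzU
    have hz : 0 < ‖z‖ := norm_pos_iff.mpr hz0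
    have hn : ‖((ρ / ‖z‖ : ℝ) : ℂ) * z‖ = ρ := by
      rw [norm_mul, Complex.norm_real, Real.norm_eq_abs, abs_of_pos (by positivity)]
      field_simp
    set s : ℝ := 1 - ρ / ‖z‖ with hsdef
    have hdiff : z - ((ρ / ‖z‖ : ℝ) : ℂ) * z = s • z := by
      rw [hsdef, Complex.real_smul]
      push_cast
      ring
    have hτs : τ * s = |s| := by
      have h4 : 0 < τ * s := by
        have := hU z hzU
        have e : τ * s = τ * (‖z‖ - ρ) / ‖z‖ := by rw [hsdef]; field_simp
        rw [e]
        positivity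
      rw [← abs_of_pos h4, abs_mul, hτ, one_mul]
    have hτ2 : τ * τ = 1 := by rw [← abs_mul_abs_self, hτ, one_mul]
    rw [hP _ hn, hdiff, map_smul, norm_smul, Real.norm_eq_abs] at h1
    have hLz := L.le_opNorm z
    have hb1 : ‖ψ' z - P‖ ≤ |s| * ((‖L‖ + ε) * (ρ + 1)) := by
      have h5 : ‖ψ' z - P‖ ≤ ‖ψ' z - P - s • L z‖ + ‖s • L z‖ := by
        simpa using norm_add_le (ψ' z - P - s • L z) (s • L z)
      rw [norm_smul, Real.norm_eq_abs] at h5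
      have h6 : ‖L z‖ ≤ ‖L‖ * (ρ + 1) := hLz.trans (by gcongr)
      have h7 : ε * (|s| * ‖z‖) ≤ ε * (|s| * (ρ + 1)) := by gcongr
      have h8 : |s| * ‖L z‖ ≤ |s| * (‖L‖ * (ρ + 1)) := by gcongr
      linarith
    have hb2 : |s| * (δ / 4) ≤ σ * (ψ' z 2 - P 2) := by
      have h5 : |(ψ' z - P - s • L z) 2| ≤ ε * (|s| * (ρ + 1)) := by
        have h6 := PiLp.norm_apply_le (ψ' z - P - s • L z) 2
        rw [Real.norm_eq_abs] at h6
        exact h6.trans (h1.trans (by gcongr))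
      have h6 : |σ * (ψ' z - P - s • L z) 2| ≤ |s| * (δ / 4) := by
        rw [abs_mul]
        calc |σ| * |(ψ' z - P - s • L z) 2| ≤ (|σ| + 1) * (ε * (|s| * (ρ + 1))) := by
              gcongr
              linarith
          _ = |s| * (δ / 4) := by
              rw [hεdef]
              field_simp
      have h7 : σ * (ψ' z 2 - P 2) = σ * (ψ' z - P - s • L z) 2 + |s| * (σ * τ * (L z) 2) := by
        rw [← hτs]
        simp only [PiLp.sub_apply, PiLp.smul_apply, smul_eq_mul]
        linear_combination (-(s * σ * (L z) 2)) * hτ2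
      have h8 : |s| * (δ / 2) ≤ |s| * (σ * τ * (L z) 2) := by gcongr
      have h9 := neg_abs_le (σ * (ψ' z - P - s • L z) 2)
      linarith
    calc (δ / 4) / ((‖L‖ + ε) * (ρ + 1)) * ‖ψ' z - P‖
        ≤ (δ / 4) / ((‖L‖ + ε) * (ρ + 1)) * (|s| * ((‖L‖ + ε) * (ρ + 1))) := by gcongr
      _ = |s| * (δ / 4) := by field_simp
      _ ≤ _ := hb2
  -- the constant can be chosen uniformly, by compactness of the circle
  have hglob : ∃ c : ℝ, 0 < c ∧ ∀ᶠ z in 𝓝ˢ {z : ℂ | ‖z‖ = ρ}, z ∈ U →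
      c * ‖ψ' z - P‖ ≤ σ * (ψ' z 2 - P 2) := by
    refine hS.induction_on (p := fun T => ∃ c : ℝ, 0 < c ∧ ∀ᶠ z in 𝓝ˢ T, z ∈ U →
      c * ‖ψ' z - P‖ ≤ σ * (ψ' z 2 - P 2)) ⟨1, one_pos, by simp⟩ ?_ ?_ ?_
    · rintro s t hst ⟨c, hc, h⟩
      exact ⟨c, hc, h.filter_mono (nhdsSet_mono hst)⟩
    · rintro s t ⟨c, hc, h⟩ ⟨c', hc', h'⟩
      refine ⟨min c c', lt_min hc hc', ?_⟩
      rw [nhdsSet_union, eventually_sup]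
      constructor
      · filter_upwards [h] with z hz hzU
        exact (mul_le_mul_of_nonneg_right (min_le_left _ _) (norm_nonneg _)).trans (hz hzU)
      · filter_upwards [h'] with z hz hzU
        exact (mul_le_mul_of_nonneg_right (min_le_right _ _) (norm_nonneg _)).trans (hz hzU)
    · intro p hp
      obtain ⟨c, hc, h⟩ := hloc p hp
      refine ⟨_, mem_nhdsWithin_of_mem_nhds (eventually_eventually_nhds.mpr h), c, hc, ?_⟩
      rw [eventually_nhdsSet_iff_forall]
      exact fun q hq => hq
  obtain ⟨c, hc, hcev⟩ := hglob
  refine hasIsolatedSingularity_of_cone (σ := σ) ?_ hc ?_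
  · have h1 : Tendsto ψ' (𝓝ˢ {z : ℂ | ‖z‖ = ρ}) (𝓝 P) := by
      intro W hW
      rw [mem_map, mem_nhdsSet_iff_forall]
      intro p hp
      have := (hd p hp).continuousAt.tendsto
      rw [hP p hp] at this
      exact this hW
    refine (h1.mono_left inf_le_left).congr' ?_
    filter_upwards [mem_inf_of_right (mem_principal_self U)] with z hz using (hψ z hz).symm
  · filter_upwards [mem_inf_of_left hcev, mem_inf_of_right (mem_principal_self U)] with z h1 h2
    rw [hψ z h2]
    exact h1 h2

/-! ### Explicit formulas for the Gauss map and the potential -/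

lemma hasFDerivAt_log_norm {f : ℂ → ℂ} {z f' : ℂ} (hf : HasDerivAt f f' z) (h0 : f z ≠ 0) :
    HasFDerivAt (fun w => Real.log ‖f w‖) (reMul (f' / f z)) z := by
  have h1 : HasDerivAt (fun w => Complex.log (f w / f z)) (f' / f z) z := by
    have := (hf.div_const (f z)).clog (by rw [div_self h0]; exact Complex.one_mem_slitPlane)
    rwa [div_self h0, div_one] at this
  have h2 := Complex.reCLM.hasFDerivAt.comp z (h1.hasFDerivAt.restrictScalars ℝ)
  have h3 : (fun w => Real.log ‖f w‖) =ᶠ[𝓝 z]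
      fun w => (Complex.reCLM ∘ fun w => Complex.log (f w / f z)) w + Real.log ‖f z‖ := by
    filter_upwards [hf.continuousAt.eventually_ne h0] with w hw
    simp only [Function.comp_apply, Complex.reCLM_apply, Complex.log_re, norm_div]
    rw [Real.log_div (norm_ne_zero_iff.mpr hw) (norm_ne_zero_iff.mpr h0)]
    ring
  refine ((h2.add_const (Real.log ‖f z‖)).congr_of_eventuallyEq h3).congr_fderiv ?_
  ext v
  simp [mul_comm]

/-- A neighbourhood of the closed annulus without `z₀`, on which all functions involved are
holomorphic. -/
def mainDomain (r z₀ z₁ z₂ : ℝ) : Set ℂ := (dom r z₀ ∩ dom r z₁ ∩ dom r z₂) \ {(z₀ : ℂ)}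

/-- The Gauss map `s θ(z₂z) / (z θ(z₁z))`; `s` is determined up to sign. -/
noncomputable def gaussFn (r z₁ z₂ : ℝ) (s z : ℂ) : ℂ :=
  s * theta r (z₂ * z) / (z * theta r (z₁ * z))

/-- The quotient `Q₁ / (1 - R)`, simplified by means of the product formula for `1 - R`. -/
noncomputable def potQuot (r z₀ z₁ a : ℝ) (z : ℂ) : ℂ :=
  thetaPair r z₀ z / (-factor r z₀ a z₁ * theta r (z₁ * z) ^ 2)

/-- The potential `½ log |Q₁ / (1 - R) · zᵐ|`. -/
noncomputable def potFn (r z₀ z₁ m a : ℝ) (z : ℂ) : ℝ :=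
  1 / 2 * (Real.log ‖potQuot r z₀ z₁ a z‖ + m * Real.log ‖z‖)

lemma hasDerivAt_thetaPair_log {r : ℝ} (hr0 : 0 < r) (hr1 : r < 1) {x : ℝ} (hx : x ≠ 0) {z : ℂ}
    (hz : z ≠ 0) (h : thetaPair r x z ≠ 0) : HasDerivAt (thetaPair r x)
      (thetaPair r x z * (thetaLog r (x * z) - thetaLog r (x / z)) / z) z := by
  refine (hasDerivAt_thetaPair hr0 hr1 hx hz).congr_deriv ?_
  have h1 := left_ne_zero_of_mul h
  have h2 := right_ne_zero_of_mul h
  rw [thetaPair, thetaLog, thetaLog]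
  generalize theta r (x / z) = s at *
  generalize theta r (x * z) = t at *
  field_simp

lemma hasDerivAt_theta_mul_log {r : ℝ} (hr0 : 0 < r) (hr1 : r < 1) {x : ℝ} (hx : x ≠ 0) {z : ℂ}
    (hz : z ≠ 0) (h : theta r (x * z) ≠ 0) : HasDerivAt (fun z : ℂ => theta r (x * z))
      (theta r (x * z) * thetaLog r (x * z) / z) z := by
  refine (hasDerivAt_theta_mul hr0 hr1 hx hz).congr_deriv ?_
  rw [thetaLog]
  generalize theta r (x * z) = t at *
  field_simp

lemma differentiableAt_thetaLog {r : ℝ} (hr0 : 0 < r) (hr1 : r < 1) {w : ℂ} (hw : w ≠ 0)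
    (h : theta r w ≠ 0) : DifferentiableAt ℂ (thetaLog r) w :=
  (differentiableAt_id.mul (differentiableAt_deriv_theta hr0 hr1 hw)).div
    (differentiableAt_theta hr0 hr1 hw) h

/-- Continuous functions that agree near `z` off three points agree at `z`. -/
lemma eq_of_eq_off_three {X : Type*} [TopologicalSpace X] [T2Space X] {f h : ℂ → X} {z : ℂ}
    {V : Set ℂ} (hV : V ∈ 𝓝 z) (c₀ c₁ c₂ : ℂ) (hf : ContinuousAt f z) (hh : ContinuousAt h z)
    (H : ∀ w ∈ V, w ≠ c₀ → w ≠ c₁ → w ≠ c₂ → f w = h w) : f z = h z := by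
  have hne : ∀ c : ℂ, ∀ᶠ w in 𝓝[≠] z, w ≠ c := by
    intro c
    rcases eq_or_ne z c with rfl | h
    · exact self_mem_nhdsWithin
    · exact mem_nhdsWithin_of_mem_nhds (isOpen_ne.mem_nhds h)
  refine tendsto_nhds_unique_of_eventuallyEq (hf.tendsto.mono_left nhdsWithin_le_nhds)
    (hh.tendsto.mono_left nhdsWithin_le_nhds) (l := 𝓝[≠] z) ?_
  filter_upwards [hne c₀, hne c₁, hne c₂, mem_nhdsWithin_of_mem_nhds hV] with w h0 h1 h2 h3
  exact H w h3 h0 h1 h2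

namespace IsAnnularData

variable {r z₀ z₁ z₂ m a b : ℝ}

lemma isOpen_mainDomain (r z₀ z₁ z₂ : ℝ) : IsOpen (mainDomain r z₀ z₁ z₂) :=
  (((isOpen_dom r z₀).inter (isOpen_dom r z₁)).inter (isOpen_dom r z₂)).sdiff isClosed_singleton

lemma annulus_subset_mainDomain (d : IsAnnularData r z₀ z₁ z₂ m a b) :
    annulus r \ {(z₀ : ℂ)} ⊆ mainDomain r z₀ z₁ z₂ := fun _ hz =>
  ⟨⟨⟨mem_dom_of_mem_closure d.r_pos d.mem₀ hz.1.1.le hz.1.2.le,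
    mem_dom_of_mem_closure d.r_pos d.mem₁ hz.1.1.le hz.1.2.le⟩,
    mem_dom_of_mem_closure d.r_pos d.mem₂ hz.1.1.le hz.1.2.le⟩, hz.2⟩

/-- The parameters do not lie on the boundary circles. -/
lemma ne_of_mem_circle (hr0 : 0 < r) {x : ℝ} (hx : x ∈ Set.Ioo (-1) (-r)) {z : ℂ}
    (hz : ‖z‖ = 1 ∨ ‖z‖ = r) : z ≠ x := by
  rintro rfl
  have hx0 : x < 0 := by linarith [hx.2]
  rw [Complex.norm_real, Real.norm_eq_abs, abs_of_neg hx0] at hz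
  rcases hz with h | h
  · linarith [hx.1]
  · linarith [hx.2]

lemma mem_mainDomain_of_circle (d : IsAnnularData r z₀ z₁ z₂ m a b) {z : ℂ}
    (hz : ‖z‖ = 1 ∨ ‖z‖ = r) : z ∈ mainDomain r z₀ z₁ z₂ := by
  obtain ⟨h1, h2⟩ := norm_mem_of_circle d.r_lt_one hz
  exact ⟨⟨⟨mem_dom_of_mem_closure d.r_pos d.mem₀ h1 h2,
    mem_dom_of_mem_closure d.r_pos d.mem₁ h1 h2⟩,
    mem_dom_of_mem_closure d.r_pos d.mem₂ h1 h2⟩, ne_of_mem_circle d.r_pos d.mem₀ hz⟩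

lemma thetaPair₀_ne_zero (d : IsAnnularData r z₀ z₁ z₂ m a b) {z : ℂ}
    (hz : z ∈ mainDomain r z₀ z₁ z₂) : thetaPair r z₀ z ≠ 0 := by
  rw [Ne, thetaPair_eq_zero_iff d.r_pos d.r_lt_one d.mem₀ hz.1.1.1]
  exact hz.2

lemma thetaPair₁_ne_zero (d : IsAnnularData r z₀ z₁ z₂ m a b) {z : ℂ}
    (hz : z ∈ mainDomain r z₀ z₁ z₂) (h : z ≠ z₁) : thetaPair r z₁ z ≠ 0 := by
  rwa [Ne, thetaPair_eq_zero_iff d.r_pos d.r_lt_one d.mem₁ hz.1.1.2]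

lemma thetaPair₂_ne_zero (d : IsAnnularData r z₀ z₁ z₂ m a b) {z : ℂ}
    (hz : z ∈ mainDomain r z₀ z₁ z₂) (h : z ≠ z₂) : thetaPair r z₂ z ≠ 0 := by
  rwa [Ne, thetaPair_eq_zero_iff d.r_pos d.r_lt_one d.mem₂ hz.1.2]

lemma ne_zero_of_mem {z : ℂ} (hz : z ∈ mainDomain r z₀ z₁ z₂) : z ≠ 0 :=
  ne_zero_of_mem_dom hz.1.1.1

lemma theta₁_ne_zero (d : IsAnnularData r z₀ z₁ z₂ m a b) {z : ℂ}
    (hz : z ∈ mainDomain r z₀ z₁ z₂) : theta r (z₁ * z) ≠ 0 :=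
  theta_mul_ne_zero d.r_pos d.r_lt_one hz.1.1.2

lemma theta₂_ne_zero (d : IsAnnularData r z₀ z₁ z₂ m a b) {z : ℂ}
    (hz : z ∈ mainDomain r z₀ z₁ z₂) : theta r (z₂ * z) ≠ 0 :=
  theta_mul_ne_zero d.r_pos d.r_lt_one hz.1.2

lemma factor₁_ne_zero (d : IsAnnularData r z₀ z₁ z₂ m a b) : factor r z₀ a z₁ ≠ 0 :=
  factor_ne_zero d.r_pos d.r_lt_one d.mem₀ d.mem₁ d.ne₁₀ d.a_ne_zero

lemma factor₂_ne_zero (d : IsAnnularData r z₀ z₁ z₂ m a b) : factor r z₀ a z₂ ≠ 0 :=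
  factor_ne_zero d.r_pos d.r_lt_one d.mem₀ d.mem₂ d.ne₂₀ d.a_ne_zero

/-- Identities between continuous functions may be checked off `z₁` and `z₂`. -/
lemma eq_of_eq_off {X : Type*} [TopologicalSpace X] [T2Space X] {f h : ℂ → X} {z : ℂ}
    (hz : z ∈ mainDomain r z₀ z₁ z₂) (hf : ContinuousAt f z) (hh : ContinuousAt h z)
    (H : ∀ w ∈ mainDomain r z₀ z₁ z₂, w ≠ z₁ → w ≠ z₂ → f w = h w) : f z = h z :=
  eq_of_eq_off_three ((isOpen_mainDomain r z₀ z₁ z₂).mem_nhds hz) z₀ z₁ z₂ hf hh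
    fun w hw _ => H w hw

lemma hasDerivAt_gaussFn (d : IsAnnularData r z₀ z₁ z₂ m a b) (s : ℂ) {z : ℂ}
    (h1 : z ∈ dom r z₁) (h2 : z ∈ dom r z₂) :
    HasDerivAt (gaussFn r z₁ z₂ s) (gaussFn r z₁ z₂ s z * gaussLog r z₁ z₂ z / z) z := by
  have hz0 := ne_zero_of_mem_dom h1
  have t1 := theta_mul_ne_zero d.r_pos d.r_lt_one h1
  have t2 := theta_mul_ne_zero d.r_pos d.r_lt_one h2
  have d1 := hasDerivAt_theta_mul_log d.r_pos d.r_lt_one d.ne_zero₁ hz0 t1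
  have d2 := hasDerivAt_theta_mul_log d.r_pos d.r_lt_one d.ne_zero₂ hz0 t2
  refine ((d2.const_mul s).fun_div ((hasDerivAt_id' z).fun_mul d1) (mul_ne_zero hz0 t1)).congr_deriv
    ?_
  rw [gaussFn, gaussLog]
  generalize theta r (z₁ * z) = p at *
  generalize theta r (z₂ * z) = q at *
  field_simp
  ring

lemma gaussFn_ne_zero (d : IsAnnularData r z₀ z₁ z₂ m a b) {s : ℂ} (hs : s ≠ 0) {z : ℂ}
    (h1 : z ∈ dom r z₁) (h2 : z ∈ dom r z₂) : gaussFn r z₁ z₂ s z ≠ 0 :=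
  div_ne_zero (mul_ne_zero hs (theta_mul_ne_zero d.r_pos d.r_lt_one h2))
    (mul_ne_zero (ne_zero_of_mem_dom h1) (theta_mul_ne_zero d.r_pos d.r_lt_one h1))

lemma potQuot_ne_zero (d : IsAnnularData r z₀ z₁ z₂ m a b) {z : ℂ}
    (hz : z ∈ mainDomain r z₀ z₁ z₂) : potQuot r z₀ z₁ a z ≠ 0 :=
  div_ne_zero (d.thetaPair₀_ne_zero hz)
    (mul_ne_zero (neg_ne_zero.mpr d.factor₁_ne_zero) (pow_ne_zero 2 (d.theta₁_ne_zero hz)))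

lemma hasDerivAt_potQuot (d : IsAnnularData r z₀ z₁ z₂ m a b) {z : ℂ}
    (hz : z ∈ mainDomain r z₀ z₁ z₂) :
    HasDerivAt (potQuot r z₀ z₁ a) (potQuot r z₀ z₁ a z
      * (thetaLog r (z₀ * z) - thetaLog r (z₀ / z) - 2 * thetaLog r (z₁ * z)) / z) z := by
  have hz0 := ne_zero_of_mem hz
  have t1 := d.theta₁_ne_zero hz
  have hf := d.factor₁_ne_zero
  have d0 := hasDerivAt_thetaPair_log d.r_pos d.r_lt_one d.ne_zero₀ hz0 (d.thetaPair₀_ne_zero hz)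
  have d1 := hasDerivAt_theta_mul_log d.r_pos d.r_lt_one d.ne_zero₁ hz0 t1
  refine (d0.fun_div ((d1.fun_pow 2).const_mul (-factor r z₀ a z₁))
    (mul_ne_zero (neg_ne_zero.mpr hf) (pow_ne_zero 2 t1))).congr_deriv ?_
  rw [potQuot]
  generalize theta r (z₁ * z) = p at *
  field_simp
  push_cast
  ring

lemma hasDerivAt_R (d : IsAnnularData r z₀ z₁ z₂ m a b) {z : ℂ}
    (hz : z ∈ mainDomain r z₀ z₁ z₂) :
    HasDerivAt (R r z₀ a b) (deriv (R r z₀ a b) z) z :=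
  (differentiableAt_R d.r_pos d.r_lt_one d.ne_zero₀ a b (ne_zero_of_mem hz)
    (d.thetaPair₀_ne_zero hz)).hasDerivAt

lemma mul_deriv_R_eq₂ (d : IsAnnularData r z₀ z₁ z₂ m a b) {z : ℂ}
    (hz : z ∈ mainDomain r z₀ z₁ z₂) (h2 : z ≠ z₂) :
    z * deriv (R r z₀ a b) z = R r z₀ a b z * ((thetaLog r (z₂ * z) - thetaLog r (z₂ / z))
      - (thetaLog r (z₀ * z) - thetaLog r (z₀ / z))) := by
  have hz0 := ne_zero_of_mem hz
  have n0 := d.thetaPair₀_ne_zero hz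
  have n2 := d.thetaPair₂_ne_zero hz h2
  have d0 := hasDerivAt_thetaPair_log d.r_pos d.r_lt_one d.ne_zero₀ hz0 n0
  have d2 := hasDerivAt_thetaPair_log d.r_pos d.r_lt_one d.ne_zero₂ hz0 n2
  have ev : R r z₀ a b =ᶠ[𝓝 z] fun w =>
      factor r z₀ a z₂ * (thetaPair r z₂ w / thetaPair r z₀ w) := by
    filter_upwards [(isOpen_mainDomain r z₀ z₁ z₂).mem_nhds hz] with w hw
    exact d.R_eq (ne_zero_of_mem hw) (d.thetaPair₀_ne_zero hw)
  rw [(((d2.fun_div d0 n0).const_mul _).congr_of_eventuallyEq ev).deriv, d.R_eq hz0 n0]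
  field_simp

lemma mul_deriv_R_eq₁ (d : IsAnnularData r z₀ z₁ z₂ m a b) {z : ℂ}
    (hz : z ∈ mainDomain r z₀ z₁ z₂) (h1 : z ≠ z₁) :
    -(z * deriv (R r z₀ a b) z) = (1 - R r z₀ a b z) * ((thetaLog r (z₁ * z) - thetaLog r (z₁ / z))
      - (thetaLog r (z₀ * z) - thetaLog r (z₀ / z))) := by
  have hz0 := ne_zero_of_mem hz
  have n0 := d.thetaPair₀_ne_zero hz
  have n1 := d.thetaPair₁_ne_zero hz h1
  have d0 := hasDerivAt_thetaPair_log d.r_pos d.r_lt_one d.ne_zero₀ hz0 n0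
  have d1 := hasDerivAt_thetaPair_log d.r_pos d.r_lt_one d.ne_zero₁ hz0 n1
  have ev : R r z₀ a b =ᶠ[𝓝 z] fun w =>
      1 - -factor r z₀ a z₁ * (thetaPair r z₁ w / thetaPair r z₀ w) := by
    filter_upwards [(isOpen_mainDomain r z₀ z₁ z₂).mem_nhds hz] with w hw
    rw [← d.one_sub_R_eq (ne_zero_of_mem hw) (d.thetaPair₀_ne_zero hw)]
    ring
  rw [((((d1.fun_div d0 n0).const_mul _).const_sub 1).congr_of_eventuallyEq ev).deriv,
    d.one_sub_R_eq hz0 n0]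
  field_simp

lemma one_sub_R_ne_zero (d : IsAnnularData r z₀ z₁ z₂ m a b) {z : ℂ}
    (hz : z ∈ mainDomain r z₀ z₁ z₂) (h1 : z ≠ z₁) : 1 - R r z₀ a b z ≠ 0 := by
  rw [d.one_sub_R_eq (ne_zero_of_mem hz) (d.thetaPair₀_ne_zero hz)]
  exact mul_ne_zero (neg_ne_zero.mpr d.factor₁_ne_zero)
    (div_ne_zero (d.thetaPair₁_ne_zero hz h1) (d.thetaPair₀_ne_zero hz))

lemma gaussLog_sub_inv (z₁ z₂ : ℝ) (z : ℂ) :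
    gaussLog r z₁ z₂ z - gaussLog r z₁ z₂ (1 / z)
      = (thetaLog r (z₂ * z) - thetaLog r (z₂ / z)) - (thetaLog r (z₁ * z) - thetaLog r (z₁ / z)) := by
  rw [gaussLog, gaussLog, mul_one_div, mul_one_div]
  ring

/-- The logarithmic derivative of `R / (1 - R)`, a constant multiple of
`θ(z₂z)θ(z₂/z) / (θ(z₁z)θ(z₁/z))`. -/
lemma mul_deriv_R (d : IsAnnularData r z₀ z₁ z₂ m a b) {z : ℂ}
    (hz : z ∈ mainDomain r z₀ z₁ z₂) (h1 : z ≠ z₁) (h2 : z ≠ z₂) :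
    z * deriv (R r z₀ a b) z = R r z₀ a b z * (1 - R r z₀ a b z)
      * (gaussLog r z₁ z₂ z - gaussLog r z₁ z₂ (1 / z)) := by
  have e1 := d.mul_deriv_R_eq₁ hz h1
  have e2 := d.mul_deriv_R_eq₂ hz h2
  rw [gaussLog_sub_inv]
  linear_combination (1 - R r z₀ a b z) * e2 - R r z₀ a b z * e1

lemma differentiableAt_thetaLog_div₀ (d : IsAnnularData r z₀ z₁ z₂ m a b) {z : ℂ}
    (hz : z ∈ mainDomain r z₀ z₁ z₂) : DifferentiableAt ℂ (fun z : ℂ => thetaLog r (z₀ / z)) z := by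
  have hz0 := ne_zero_of_mem hz
  have c : (z₀ : ℂ) ≠ 0 := by exact_mod_cast d.ne_zero₀
  have h : DifferentiableAt ℂ (fun z : ℂ => (z₀ : ℂ) / z) z := by fun_prop (disch := assumption)
  exact (differentiableAt_thetaLog d.r_pos d.r_lt_one (div_ne_zero c hz0)
    (left_ne_zero_of_mul (d.thetaPair₀_ne_zero hz))).comp z h

lemma differentiableAt_thetaLog_mul (d : IsAnnularData r z₀ z₁ z₂ m a b) {x : ℝ} (hx : x ≠ 0) {z : ℂ}
    (hz : z ∈ dom r x) : DifferentiableAt ℂ (fun z : ℂ => thetaLog r (x * z)) z := by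
  have hz0 := ne_zero_of_mem_dom hz
  have c : (x : ℂ) ≠ 0 := by exact_mod_cast hx
  have h : DifferentiableAt ℂ (fun z : ℂ => (x : ℂ) * z) z := by fun_prop
  exact (differentiableAt_thetaLog d.r_pos d.r_lt_one (mul_ne_zero c hz0)
    (theta_mul_ne_zero d.r_pos d.r_lt_one hz)).comp z h

/-- The logarithmic derivatives of the potential and of the Gauss map differ by the factor `2R`;
so `du + i*du = F dg` for `F = R / g`. -/
lemma potential_log_eq (d : IsAnnularData r z₀ z₁ z₂ m a b) {z : ℂ}
    (hz : z ∈ mainDomain r z₀ z₁ z₂) :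
    thetaLog r (z₀ * z) - thetaLog r (z₀ / z) - 2 * thetaLog r (z₁ * z) + m
      = 2 * R r z₀ a b z * gaussLog r z₁ z₂ z := by
  refine eq_of_eq_off (f := fun z : ℂ =>
      thetaLog r (z₀ * z) - thetaLog r (z₀ / z) - 2 * thetaLog r (z₁ * z) + m)
    (h := fun z => 2 * R r z₀ a b z * gaussLog r z₁ z₂ z) hz ?_ ?_ ?_
  · exact ((((d.differentiableAt_thetaLog_mul d.ne_zero₀ hz.1.1.1).sub
      (d.differentiableAt_thetaLog_div₀ hz)).sub
      ((d.differentiableAt_thetaLog_mul d.ne_zero₁ hz.1.1.2).const_mul 2)).add_const _).continuousAt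
  · exact (((d.hasDerivAt_R hz).differentiableAt.const_mul 2).mul
      (d.differentiableAt_gaussLog' hz.1.1.2 hz.1.2)).continuousAt
  · intro w hw h1 h2
    have hw0 := ne_zero_of_mem hw
    have e1 := d.mul_deriv_R_eq₁ hw h1
    have e := d.mul_deriv_R hw h1 h2
    have hne := d.one_sub_R_ne_zero hw h1
    have e3 := d.add_mul_q_eq hw0 (d.thetaPair₀_ne_zero hw) (d.thetaPair₁_ne_zero hw h1)
      (d.thetaPair₂_ne_zero hw h2)
    rw [← gaussLog_add_inv d.ne_zero₁ d.ne_zero₂ hw0, mul_q_eq d.ne_zero₁ hw0] at e3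
    have e4 : (thetaLog r (z₁ * w) - thetaLog r (z₁ / w))
        - (thetaLog r (z₀ * w) - thetaLog r (z₀ / w))
        = -(R r z₀ a b w * (gaussLog r z₁ z₂ w - gaussLog r z₁ z₂ (1 / w))) := by
      apply mul_left_cancel₀ hne
      linear_combination -e1 - e
    linear_combination e3 - e4

/-- The left-hand side is the numerator of `F' + F² g'` for `F = R / g`. -/
lemma mul_deriv_R_sub (d : IsAnnularData r z₀ z₁ z₂ m a b) {z : ℂ}
    (hz : z ∈ mainDomain r z₀ z₁ z₂) :
    z * deriv (R r z₀ a b) z - R r z₀ a b z * (1 - R r z₀ a b z) * gaussLog r z₁ z₂ z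
      = factor r z₀ a z₁ * factor r z₀ a z₂ * theta r (z₁ * z) * theta r (z₂ * z)
        * gaussNum r z₁ z₂ (1 / z) / thetaPair r z₀ z ^ 2 := by
  have hz0 := ne_zero_of_mem hz
  refine eq_of_eq_off (f := fun z => z * deriv (R r z₀ a b) z
      - R r z₀ a b z * (1 - R r z₀ a b z) * gaussLog r z₁ z₂ z)
    (h := fun z => factor r z₀ a z₁ * factor r z₀ a z₂ * theta r (z₁ * z) * theta r (z₂ * z)
        * gaussNum r z₁ z₂ (1 / z) / thetaPair r z₀ z ^ 2) hz ?_ ?_ ?_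
  · have dR := (d.hasDerivAt_R hz).differentiableAt
    have dR' : DifferentiableAt ℂ (deriv (R r z₀ a b)) z := by
      have : DifferentiableOn ℂ (R r z₀ a b) (mainDomain r z₀ z₁ z₂) := fun w hw =>
        (d.hasDerivAt_R hw).differentiableAt.differentiableWithinAt
      have hO := isOpen_mainDomain r z₀ z₁ z₂
      exact (this.deriv hO).differentiableAt (hO.mem_nhds hz)
    exact ((differentiableAt_id.mul dR').sub ((dR.mul (dR.const_sub 1)).mul
      (d.differentiableAt_gaussLog' hz.1.1.2 hz.1.2))).continuousAt
  · have d1 := differentiableAt_theta_mul d.r_pos d.r_lt_one d.ne_zero₁ hz0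
    have d2 := differentiableAt_theta_mul d.r_pos d.r_lt_one d.ne_zero₂ hz0
    have d3 := d.differentiableAt_gaussNum_inv hz0
    have d0 := differentiableAt_thetaPair d.r_pos d.r_lt_one d.ne_zero₀ hz0
    exact ((((d1.const_mul _).mul d2).mul d3).div (d0.pow 2)
      (pow_ne_zero 2 (d.thetaPair₀_ne_zero hz))).continuousAt
  · intro w hw h1 h2
    have hw0 := ne_zero_of_mem hw
    have n0 := d.thetaPair₀_ne_zero hw
    have n1 := left_ne_zero_of_mul (d.thetaPair₁_ne_zero hw h1)
    have n2 := left_ne_zero_of_mul (d.thetaPair₂_ne_zero hw h2)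
    rw [gaussNum_eq (z := 1 / w) (by rwa [mul_one_div]) (by rwa [mul_one_div]), mul_one_div,
      mul_one_div, d.mul_deriv_R hw h1 h2, d.R_eq hw0 n0]
    have e := d.one_sub_R_eq hw0 n0
    rw [d.R_eq hw0 n0] at e
    rw [e, thetaPair.eq_def r z₁ w, thetaPair.eq_def r z₂ w]
    field_simp
    ring

end IsAnnularData

/-! ### Identification of the data -/

lemma isPreconnected_annulus {r : ℝ} (hr0 : 0 < r) : IsPreconnected (annulus r) := by
  have h : annulus r = Complex.exp '' (Complex.re ⁻¹' Set.Ioo (Real.log r) 0) := by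
    ext z
    constructor
    · intro hz
      have hz0 : z ≠ 0 := norm_pos_iff.mp (hr0.trans hz.1)
      refine ⟨Complex.log z, ?_, Complex.exp_log hz0⟩
      rw [Set.mem_preimage, Complex.log_re]
      exact ⟨Real.log_lt_log hr0 hz.1, Real.log_neg (hr0.trans hz.1) hz.2⟩
    · rintro ⟨w, hw, rfl⟩
      refine ⟨?_, ?_⟩
      · rw [Complex.norm_exp, ← Real.log_lt_iff_lt_exp hr0]
        exact hw.1
      · rw [Complex.norm_exp, Real.exp_lt_one_iff]
        exact hw.2
  rw [h]
  exact ((convex_Ioo _ _).linear_preimage Complex.reLm).isPreconnected.image _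
    Complex.continuous_exp.continuousOn

namespace IsAnnularData

variable {r z₀ z₁ z₂ m a b : ℝ}

lemma gaussFn_sq (d : IsAnnularData r z₀ z₁ z₂ m a b) {s : ℂ}
    (hs : s ^ 2 = factor r z₀ a z₂ / -factor r z₀ a z₁) {z : ℂ}
    (hz : z ∈ mainDomain r z₀ z₁ z₂) (h1 : z ≠ z₁) (h2 : z ≠ z₂) :
    gaussFn r z₁ z₂ s z ^ 2
      = R r z₀ a b z / (1 - R r z₀ a b z) * (Q r z₁ z / Q r z₂ z) * (z ^ 2)⁻¹ := by
  have hz0 := ne_zero_of_mem hz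
  have n0 := d.thetaPair₀_ne_zero hz
  have n1 := left_ne_zero_of_mul (d.thetaPair₁_ne_zero hz h1)
  have n2 := left_ne_zero_of_mul (d.thetaPair₂_ne_zero hz h2)
  have t1 := d.theta₁_ne_zero hz
  have t2 := d.theta₂_ne_zero hz
  have f1 := d.factor₁_ne_zero
  rw [d.one_sub_R_eq hz0 n0, d.R_eq hz0 n0, Q, Q, gaussFn, div_pow, mul_pow, hs,
    thetaPair.eq_def r z₁ z, thetaPair.eq_def r z₂ z]
  generalize theta r (z₁ * z) = p1 at *
  generalize theta r (z₂ * z) = p2 at *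
  generalize theta r (z₁ / z) = q1 at *
  generalize theta r (z₂ / z) = q2 at *
  field_simp

lemma potQuot_eq (d : IsAnnularData r z₀ z₁ z₂ m a b) {z : ℂ}
    (hz : z ∈ mainDomain r z₀ z₁ z₂) (h1 : z ≠ z₁) :
    potQuot r z₀ z₁ a z = Q r z₁ z / (1 - R r z₀ a b z) := by
  have hz0 := ne_zero_of_mem hz
  have n0 := d.thetaPair₀_ne_zero hz
  have n1 := left_ne_zero_of_mul (d.thetaPair₁_ne_zero hz h1)
  have t1 := d.theta₁_ne_zero hz
  have f1 := d.factor₁_ne_zero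
  rw [d.one_sub_R_eq hz0 n0, Q, potQuot, thetaPair.eq_def r z₁ z]
  generalize theta r (z₁ * z) = p1 at *
  generalize theta r (z₁ / z) = q1 at *
  field_simp

lemma exp_two_mul_potFn (d : IsAnnularData r z₀ z₁ z₂ m a b) {z : ℂ}
    (hz : z ∈ mainDomain r z₀ z₁ z₂) :
    Real.exp (2 * potFn r z₀ z₁ m a z) = ‖potQuot r z₀ z₁ a z‖ * ‖z‖ ^ m := by
  have h1 := norm_pos_iff.mpr (d.potQuot_ne_zero hz)
  have h2 := norm_pos_iff.mpr (ne_zero_of_mem hz)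
  have e : 2 * potFn r z₀ z₁ m a z
      = Real.log ‖potQuot r z₀ z₁ a z‖ + m * Real.log ‖z‖ := by rw [potFn]; ring
  rw [e, Real.exp_add, Real.exp_log h1, Real.rpow_def_of_pos h2, mul_comm m]

lemma potFn_eq (d : IsAnnularData r z₀ z₁ z₂ m a b) {z : ℂ}
    (hz : z ∈ mainDomain r z₀ z₁ z₂) (h1 : z ≠ z₁) :
    potFn r z₀ z₁ m a z
      = 1 / 2 * Real.log (‖Q r z₁ z / (1 - R r z₀ a b z)‖ * ‖z‖ ^ m) := by
  rw [← d.potQuot_eq hz h1, ← d.exp_two_mul_potFn hz, Real.log_exp]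
  ring

lemma contDiffAt_potFn (d : IsAnnularData r z₀ z₁ z₂ m a b) {z : ℂ}
    (hz : z ∈ mainDomain r z₀ z₁ z₂) : ContDiffAt ℝ ∞ (potFn r z₀ z₁ m a) z := by
  have hO := (isOpen_mainDomain r z₀ z₁ z₂)
  have hq : DifferentiableOn ℂ (potQuot r z₀ z₁ a) (mainDomain r z₀ z₁ z₂) := fun w hw =>
    (d.hasDerivAt_potQuot hw).differentiableAt.differentiableWithinAt
  have c1 : ContDiffAt ℝ ∞ (potQuot r z₀ z₁ a) z :=
    ((hq.contDiffOn hO).restrict_scalars ℝ).contDiffAt (hO.mem_nhds hz)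
  have h1 := d.potQuot_ne_zero hz
  have hz0 := ne_zero_of_mem hz
  exact contDiffAt_const.mul (((c1.norm ℝ h1).log (norm_ne_zero_iff.mpr h1)).add
    (contDiffAt_const.mul ((contDiffAt_id.norm ℝ hz0).log (norm_ne_zero_iff.mpr hz0))))

lemma harmonicAt_potFn (d : IsAnnularData r z₀ z₁ z₂ m a b) {z : ℂ}
    (hz : z ∈ mainDomain r z₀ z₁ z₂) :
    InnerProductSpace.HarmonicAt (potFn r z₀ z₁ m a) z := by
  have hO := (isOpen_mainDomain r z₀ z₁ z₂)
  have hq : DifferentiableOn ℂ (potQuot r z₀ z₁ a) (mainDomain r z₀ z₁ z₂) := fun w hw =>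
    (d.hasDerivAt_potQuot hw).differentiableAt.differentiableWithinAt
  have h1 := (hq.analyticAt (hO.mem_nhds hz)).harmonicAt_log_norm (d.potQuot_ne_zero hz)
  have h2 := (analyticAt_id (𝕜 := ℂ) (z := z)).harmonicAt_log_norm (ne_zero_of_mem hz)
  exact (h1.add (h2.const_smul (c := m))).const_smul (c := (1 / 2 : ℝ))

/-- The differential of the potential is `Re (F dg)` with `F = R / g`. -/
lemma hasFDerivAt_potFn (d : IsAnnularData r z₀ z₁ z₂ m a b) {s : ℂ} (hs : s ≠ 0) {z : ℂ}
    (hz : z ∈ mainDomain r z₀ z₁ z₂) :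
    HasFDerivAt (potFn r z₀ z₁ m a) (reMul (R r z₀ a b z / gaussFn r z₁ z₂ s z
      * (gaussFn r z₁ z₂ s z * gaussLog r z₁ z₂ z / z))) z := by
  have hz0 := ne_zero_of_mem hz
  have hp := d.potQuot_ne_zero hz
  have hG := d.gaussFn_ne_zero hs hz.1.1.2 hz.1.2
  have h1 := hasFDerivAt_log_norm (d.hasDerivAt_potQuot hz) hp
  have h2 := hasFDerivAt_log_norm (hasDerivAt_id' z) hz0
  have h3 := (h1.add (h2.const_mul m)).const_mul (1 / 2)
  refine h3.congr_fderiv ?_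
  ext v
  have e := d.potential_log_eq hz
  have e1 : R r z₀ a b z / gaussFn r z₁ z₂ s z * (gaussFn r z₁ z₂ s z * gaussLog r z₁ z₂ z / z) * v
      = ((1 / 2 : ℝ) : ℂ) * (potQuot r z₀ z₁ a z
        * (thetaLog r (z₀ * z) - thetaLog r (z₀ / z) - 2 * thetaLog r (z₁ * z)) / z
          / potQuot r z₀ z₁ a z * v + (m : ℂ) * (1 / z * v)) := by
    have e2 : thetaLog r (z₀ * z) - thetaLog r (z₀ / z) - 2 * thetaLog r (z₁ * z)
        = 2 * R r z₀ a b z * gaussLog r z₁ z₂ z - m := by linear_combination e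
    rw [e2]
    push_cast
    field_simp
    ring
  simp only [smul_apply, add_apply, reMul_apply, smul_eq_mul]
  rw [e1, Complex.re_ofReal_mul, Complex.add_re, Complex.re_ofReal_mul]

lemma mem_annulus {x : ℝ} (hr0 : 0 < r) (hx : x ∈ Set.Ioo (-1) (-r)) : (x : ℂ) ∈ annulus r := by
  have hx0 : x < 0 := by linarith [hx.2]
  have e : ‖(x : ℂ)‖ = -x := by rw [Complex.norm_real, Real.norm_eq_abs, abs_of_neg hx0]
  exact ⟨by rw [e]; linarith [hx.2], by rw [e]; linarith [hx.1]⟩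

lemma mem_dom_of_annulus {x : ℝ} (hr0 : 0 < r) (hx : x ∈ Set.Ioo (-1) (-r)) {z : ℂ}
    (hz : z ∈ annulus r) : z ∈ dom r x :=
  mem_dom_of_mem_closure hr0 hx hz.1.le hz.2.le

/-- Every admissible Gauss map is the explicit one, for one of the two signs of `s`. -/
lemma exists_eq_gaussFn (d : IsAnnularData r z₀ z₁ z₂ m a b) {g : ℂ → ℂ}
    (hg : IsGaussMap r z₀ z₁ z₂ a b g) :
    ∃ s : ℂ, s ≠ 0 ∧ s ^ 2 = factor r z₀ a z₂ / -factor r z₀ a z₁ ∧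
      ∀ z ∈ annulus r, g z = gaussFn r z₁ z₂ s z := by
  obtain ⟨s, hs⟩ := IsAlgClosed.exists_pow_nat_eq (factor r z₀ a z₂ / -factor r z₀ a z₁)
    (n := 2) (by norm_num)
  have hs0 : s ≠ 0 := by
    rintro rfl
    have : factor r z₀ a z₂ / -factor r z₀ a z₁ ≠ 0 :=
      div_ne_zero d.factor₂_ne_zero (neg_ne_zero.mpr d.factor₁_ne_zero)
    exact this (by rw [← hs]; norm_num)
  have hd : DifferentiableOn ℂ (gaussFn r z₁ z₂ s) (annulus r) := fun z hz =>
    (d.hasDerivAt_gaussFn s (mem_dom_of_annulus d.r_pos d.mem₁ hz)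
      (mem_dom_of_annulus d.r_pos d.mem₂ hz)).differentiableAt.differentiableWithinAt
  have hO := isOpen_annulus r
  have hsq : Set.EqOn (g ^ 2) (gaussFn r z₁ z₂ s ^ 2) (annulus r) := by
    intro z hz
    refine eq_of_eq_off_three (hO.mem_nhds hz) z₀ z₁ z₂
      ((hg.1.differentiableAt (hO.mem_nhds hz)).pow 2).continuousAt
      ((hd.differentiableAt (hO.mem_nhds hz)).pow 2).continuousAt fun w hw h0 h1 h2 => ?_
    rw [Pi.pow_apply, Pi.pow_apply, hg.2 w hw h0 h1 h2,
      d.gaussFn_sq hs (d.annulus_subset_mainDomain ⟨hw, h0⟩) h1 h2]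
  have hne : ∀ z ∈ annulus r, gaussFn r z₁ z₂ s z ≠ 0 := fun z hz =>
    d.gaussFn_ne_zero hs0 (mem_dom_of_annulus d.r_pos d.mem₁ hz)
      (mem_dom_of_annulus d.r_pos d.mem₂ hz)
  rcases (isPreconnected_annulus d.r_pos).eq_or_eq_neg_of_sq_eq hg.1.continuousOn hd.continuousOn
    hsq (hne _) with h | h
  · exact ⟨s, hs0, hs, h⟩
  · refine ⟨-s, neg_ne_zero.mpr hs0, by rw [neg_sq, hs], fun z hz => ?_⟩
    rw [h hz, Pi.neg_apply, gaussFn, gaussFn]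
    ring

lemma isGaussMap_gaussFn (d : IsAnnularData r z₀ z₁ z₂ m a b) {s : ℂ}
    (hs : s ^ 2 = factor r z₀ a z₂ / -factor r z₀ a z₁) :
    IsGaussMap r z₀ z₁ z₂ a b (gaussFn r z₁ z₂ s) :=
  ⟨fun _ hz => (d.hasDerivAt_gaussFn s (mem_dom_of_annulus d.r_pos d.mem₁ hz)
    (mem_dom_of_annulus d.r_pos d.mem₂ hz)).differentiableAt.differentiableWithinAt,
    fun _ hz h0 h1 h2 => d.gaussFn_sq hs (d.annulus_subset_mainDomain ⟨hz, h0⟩) h1 h2⟩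

lemma isPotential_potFn (d : IsAnnularData r z₀ z₁ z₂ m a b) :
    IsPotential r z₀ z₁ a b m (potFn r z₀ z₁ m a) :=
  ⟨fun _ hz => (d.contDiffAt_potFn
    (d.annulus_subset_mainDomain hz)).continuousAt.continuousWithinAt,
    fun _ hz h0 h1 => d.potFn_eq (d.annulus_subset_mainDomain ⟨hz, h0⟩) h1⟩

lemma isOpen_puncturedAnnulus (r z₀ : ℝ) : IsOpen (annulus r \ {(z₀ : ℂ)}) :=
  (isOpen_annulus r).sdiff isClosed_singleton

lemma eq_potFn (d : IsAnnularData r z₀ z₁ z₂ m a b) {u : ℂ → ℝ}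
    (hu : IsPotential r z₀ z₁ a b m u) {z : ℂ} (hz : z ∈ annulus r \ {(z₀ : ℂ)}) :
    u z = potFn r z₀ z₁ m a z := by
  have hO := isOpen_puncturedAnnulus r z₀
  refine eq_of_eq_off_three (hO.mem_nhds hz) z₀ z₁ z₁ (hu.1.continuousAt (hO.mem_nhds hz))
    (d.contDiffAt_potFn (d.annulus_subset_mainDomain hz)).continuousAt fun w hw h0 h1 _ => ?_
  rw [hu.2 w hw.1 h0 h1, d.potFn_eq (d.annulus_subset_mainDomain hw) h1]

/-! ### The metric and the conformal data -/

/-- The function `F = R / g`, for which `du + i*du = F dg`. -/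
noncomputable def dualFn (r z₀ z₁ z₂ a b : ℝ) (s z : ℂ) : ℂ :=
  R r z₀ a b z / gaussFn r z₁ z₂ s z

lemma hasDerivAt_dualFn (d : IsAnnularData r z₀ z₁ z₂ m a b) {s : ℂ} (hs : s ≠ 0) {z : ℂ}
    (hz : z ∈ mainDomain r z₀ z₁ z₂) :
    HasDerivAt (dualFn r z₀ z₁ z₂ a b s)
      ((z * deriv (R r z₀ a b) z - R r z₀ a b z * gaussLog r z₁ z₂ z)
        / (z * gaussFn r z₁ z₂ s z)) z := by
  have hz0 := ne_zero_of_mem hz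
  have hG := d.gaussFn_ne_zero hs hz.1.1.2 hz.1.2
  refine ((d.hasDerivAt_R hz).fun_div (d.hasDerivAt_gaussFn s hz.1.1.2 hz.1.2) hG).congr_deriv ?_
  field_simp

/-- Of the two parts of the first fundamental form, `conj dg` has the larger modulus; so the form is
positive definite. -/
lemma norm_dual_lt (d : IsAnnularData r z₀ z₁ z₂ m a b) {s : ℂ} (hs0 : s ≠ 0)
    (hs : s ^ 2 = factor r z₀ a z₂ / -factor r z₀ a z₁) {z : ℂ}
    (hz : z ∈ annulus r \ {(z₀ : ℂ)}) :
    Real.exp (2 * potFn r z₀ z₁ m a z) ^ 2 * ‖deriv (dualFn r z₀ z₁ z₂ a b s) z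
      + dualFn r z₀ z₁ z₂ a b s z ^ 2 * deriv (gaussFn r z₁ z₂ s) z‖
      < ‖deriv (gaussFn r z₁ z₂ s) z‖ := by
  have hm := d.annulus_subset_mainDomain hz
  have hz0 := ne_zero_of_mem hm
  have hG := d.gaussFn_ne_zero hs0 hm.1.1.2 hm.1.2
  have n0 := d.thetaPair₀_ne_zero hm
  have t1 := d.theta₁_ne_zero hm
  have t2 := d.theta₂_ne_zero hm
  have f1 := d.factor₁_ne_zero
  have f2 := d.factor₂_ne_zero
  have key := d.norm_gaussNum_inv_lt hz.1
  have hpos : 0 < ‖z‖ := norm_pos_iff.mpr hz0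
  have e1 : deriv (dualFn r z₀ z₁ z₂ a b s) z
      + dualFn r z₀ z₁ z₂ a b s z ^ 2 * deriv (gaussFn r z₁ z₂ s) z
      = factor r z₀ a z₁ * factor r z₀ a z₂ * theta r (z₁ * z) * theta r (z₂ * z)
        * gaussNum r z₁ z₂ (1 / z) / thetaPair r z₀ z ^ 2 / (z * gaussFn r z₁ z₂ s z) := by
    rw [(d.hasDerivAt_dualFn hs0 hm).deriv, (d.hasDerivAt_gaussFn s hm.1.1.2 hm.1.2).deriv,
      dualFn, ← d.mul_deriv_R_sub hm]
    generalize gaussFn r z₁ z₂ s z = G at *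
    field_simp
    ring
  have e2 : ‖gaussFn r z₁ z₂ s z‖ ^ 2 = ‖factor r z₀ a z₂‖ / ‖factor r z₀ a z₁‖
      * ‖theta r (z₂ * z)‖ ^ 2 / (‖z‖ ^ 2 * ‖theta r (z₁ * z)‖ ^ 2) := by
    rw [← norm_pow, gaussFn, div_pow, mul_pow, hs]
    simp only [norm_div, norm_mul, norm_neg, norm_pow, mul_pow]
  have e3 : (‖z‖ ^ m) ^ 2 * ‖z‖ ^ 2 = ‖z‖ ^ (2 * m + 2) := by
    rw [← Real.rpow_natCast (‖z‖ ^ m), ← Real.rpow_mul hpos.le, ← Real.rpow_natCast ‖z‖ 2,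
      ← Real.rpow_add hpos]
    congr 1
    push_cast
    ring
  rw [e1, (d.hasDerivAt_gaussFn s hm.1.1.2 hm.1.2).deriv, d.exp_two_mul_potFn hm, potQuot]
  rw [gaussNum_eq t1 t2] at key
  simp only [norm_div, norm_mul, norm_neg, norm_pow] at key ⊢
  rw [← e3] at key
  have p0 : 0 < ‖thetaPair r z₀ z‖ := norm_pos_iff.mpr n0
  have p1 : 0 < ‖theta r (z₁ * z)‖ := norm_pos_iff.mpr t1
  have p2 : 0 < ‖theta r (z₂ * z)‖ := norm_pos_iff.mpr t2
  have p3 : 0 < ‖factor r z₀ a z₁‖ := norm_pos_iff.mpr f1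
  have p4 : 0 < ‖factor r z₀ a z₂‖ := norm_pos_iff.mpr f2
  have p5 : 0 < ‖gaussFn r z₁ z₂ s z‖ := norm_pos_iff.mpr hG
  generalize ‖thetaPair r z₀ z‖ = A0 at *
  generalize ‖theta r (z₁ * z)‖ = A1 at *
  generalize ‖theta r (z₂ * z)‖ = A2 at *
  generalize ‖factor r z₀ a z₁‖ = k1 at *
  generalize ‖factor r z₀ a z₂‖ = k2 at *
  generalize ‖gaussFn r z₁ z₂ s z‖ = G at *
  generalize ‖gaussLog r z₁ z₂ z‖ = D at *
  generalize ‖z‖ ^ m = ρm at *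
  generalize ‖z‖ = ρ at *
  generalize ‖gaussNum r z₁ z₂ (1 / z)‖ = X at *
  -- the factor that turns the inequality, after elimination of `G²` by `e2`, into `key`
  refine lt_of_mul_lt_mul_left (a := G * ρ * A1 ^ 3 * ρ ^ 2 * k1 / (k2 * A2)) ?_ (by positivity)
  have l1 : G * ρ * A1 ^ 3 * ρ ^ 2 * k1 / (k2 * A2) * ((A0 / (k1 * A1 ^ 2) * ρm) ^ 2
      * (k1 * k2 * A1 * A2 * X / A0 ^ 2 / (ρ * G))) = X * (ρm ^ 2 * ρ ^ 2) := by
    field_simp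
  have l2 : G * ρ * A1 ^ 3 * ρ ^ 2 * k1 / (k2 * A2) * (G * D / ρ) = D * (A1 * A2) := by
    have : G * ρ * A1 ^ 3 * ρ ^ 2 * k1 / (k2 * A2) * (G * D / ρ)
        = G ^ 2 * (A1 ^ 3 * ρ ^ 2 * k1 / (k2 * A2) * D) := by field_simp
    rw [this, e2]
    field_simp
  rw [l1, l2]
  exact key

end IsAnnularData

/-! ### The boundary circles -/

/-- Where `F = ρ / g` and `e^{4u} ρ (1 - ρ) = |g|²`, the surface meets the vertical axis. -/
lemma surface_eq_of_relation {g F : ℂ → ℂ} {u : ℂ → ℝ} {z : ℂ} {ρ : ℝ} (hρ0 : 0 < ρ)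
    (hρ1 : ρ < 1) (hg : g z ≠ 0) (hF : F z = ρ / g z)
    (h : Real.exp (2 * u z) ^ 2 * (ρ * (1 - ρ)) = ‖g z‖ ^ 2) :
    surface g u F z = !₂[0, 0, Real.exp (2 * u z) * (1 - ρ)] := by
  have hn : 0 < Complex.normSq (g z) := Complex.normSq_pos.mpr hg
  rw [← Complex.normSq_eq_norm_sq] at h
  have h1 : (F z).re = ρ * (g z).re / Complex.normSq (g z) := by
    rw [hF, Complex.div_re]; simp
  have h2 : (F z).im = -(ρ * (g z).im / Complex.normSq (g z)) := by
    rw [hF, Complex.div_im]; simp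
  have h3 : (F z).re ^ 2 + (F z).im ^ 2 = ρ ^ 2 / Complex.normSq (g z) := by
    rw [h1, h2]
    field_simp
    rw [Complex.normSq_apply]
    ring
  have hρ : 0 < 1 - ρ := by linarith
  have h4 : 1 + Real.exp (2 * u z) ^ 2 * (ρ ^ 2 / Complex.normSq (g z)) = 1 / (1 - ρ) := by
    rw [← h]
    have : Real.exp (2 * u z) ≠ 0 := (Real.exp_pos _).ne'
    field_simp
    ring
  rw [surface_eq, h3, h4, h1, h2]
  have e1 : Real.exp (2 * u z) ^ 2 / (1 / (1 - ρ)) = Complex.normSq (g z) / ρ := by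
    rw [← h]
    field_simp
  rw [e1]
  ext i
  fin_cases i
  · simp
    field_simp
    ring
  · simp
    field_simp
    ring
  · simp

/-- The derivative of the height at a boundary point. Here `G` stands for `g`, `ρ` for `R`, `D` for
`z g'/g`, and the direction is the radial one `v = z`; the derivative of `F = R / g` in that direction
has been expressed through `z R' = R (1 - R) (D - conj D)`. -/
lemma velocity_two {E ρ : ℝ} {G D : ℂ} (hE : 0 < E) (hρ0 : 0 < ρ) (hρ1 : ρ < 1) (hG : G ≠ 0)
    (h : E ^ 2 * (ρ * (1 - ρ)) = ‖G‖ ^ 2) :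
    velocity E (ρ / G) (G * D) ((ρ * (1 - ρ) * (D - (starRingEnd ℂ) D) - ρ * D) / G) 2
      = 4 * E * ρ * (1 - ρ) ^ 2 * D.re := by
  have hn : 0 < Complex.normSq G := Complex.normSq_pos.mpr hG
  rw [← Complex.normSq_eq_norm_sq] at h
  have hρ : 0 < 1 - ρ := by linarith
  have h3 : ((ρ : ℂ) / G).re ^ 2 + ((ρ : ℂ) / G).im ^ 2 = ρ ^ 2 / Complex.normSq G := by
    have := Complex.normSq_apply ((ρ : ℂ) / G)
    rw [Complex.normSq_div, Complex.normSq_ofReal] at this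
    rw [pow_two, pow_two, ← this, pow_two]
  have h4 : 1 + E ^ 2 * (ρ ^ 2 / Complex.normSq G) = 1 / (1 - ρ) := by
    rw [← h]
    field_simp
    ring
  have h5 : ((ρ : ℂ) / G * (G * D)).re = ρ * D.re := by
    rw [← Complex.re_ofReal_mul]
    congr 1
    field_simp
  have h6 : ((ρ : ℂ) / G).re * ((ρ * (1 - ρ) * (D - (starRingEnd ℂ) D) - ρ * D) / G).re
      + ((ρ : ℂ) / G).im * ((ρ * (1 - ρ) * (D - (starRingEnd ℂ) D) - ρ * D) / G).im
      = -(ρ ^ 2 / Complex.normSq G * D.re) := by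
    have e : ∀ x y : ℂ, x.re * y.re + x.im * y.im = (y * (starRingEnd ℂ) x).re := by
      intro x y
      simp
      ring
    have e2 : (ρ * (1 - ρ) * (D - (starRingEnd ℂ) D) - ρ * D) / G * (starRingEnd ℂ) ((ρ : ℂ) / G)
        = ((ρ ^ 2 / Complex.normSq G : ℝ) : ℂ) * ((1 - ρ) * (D - (starRingEnd ℂ) D) - D) := by
      have hc : (starRingEnd ℂ) G ≠ 0 := (map_ne_zero _).mpr hG
      rw [map_div₀, Complex.conj_ofReal]
      push_cast
      rw [Complex.normSq_eq_conj_mul_self]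
      field_simp
    rw [e, e2, Complex.re_ofReal_mul]
    have e3 : ((1 - ρ : ℂ) * (D - (starRingEnd ℂ) D) - D).re = -D.re := by
      have : (1 - ρ : ℂ) = ((1 - ρ : ℝ) : ℂ) := by push_cast; rfl
      rw [Complex.sub_re, this, Complex.re_ofReal_mul]
      simp
    rw [e3]
    ring
  simp only [velocity, Matrix.cons_val]
  rw [h3, h4, h5, mul_assoc 2 (E ^ 2), h6, ← h]
  field_simp
  ring

namespace IsAnnularData

variable {r z₀ z₁ z₂ m a b : ℝ}

/-- On the boundary circles `R` takes a value `ρ` in the real interval `(0, 1)`, the relation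
`e^{4u} ρ (1 - ρ) = |g|²` holds, on the inner circle because of `C3`, and `e^{2u} (1 - ρ)` is
constant. -/
lemma circle_values (d : IsAnnularData r z₀ z₁ z₂ m a b) {s : ℂ}
    (hs : s ^ 2 = factor r z₀ a z₂ / -factor r z₀ a z₁) {z : ℂ} (hz : ‖z‖ = 1 ∨ ‖z‖ = r) :
    ∃ ρ : ℝ, 0 < ρ ∧ ρ < 1 ∧ R r z₀ a b z = ρ ∧
      Real.exp (2 * potFn r z₀ z₁ m a z) ^ 2 * (ρ * (1 - ρ)) = ‖gaussFn r z₁ z₂ s z‖ ^ 2 ∧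
      (‖z‖ = 1 → Real.exp (2 * potFn r z₀ z₁ m a z) * (1 - ρ) = 1) ∧
      (‖z‖ = r → Real.exp (2 * potFn r z₀ z₁ m a z) * (1 - ρ) = |z₁| * r ^ (m + 1)) := by
  obtain ⟨ρ, hρ0, hρ1, hρ⟩ := d.R_real hz
  have hm := d.mem_mainDomain_of_circle hz
  have h1 := ne_of_mem_circle d.r_pos d.mem₁ hz
  have h2 := ne_of_mem_circle d.r_pos d.mem₂ hz
  have hρ' : 0 < 1 - ρ := by linarith
  have eR : ‖(1 : ℂ) - ρ‖ = 1 - ρ := by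
    rw [← Complex.ofReal_one, ← Complex.ofReal_sub, Complex.norm_real, Real.norm_eq_abs,
      abs_of_pos hρ']
  have eR' : ‖(ρ : ℂ)‖ = ρ := by rw [Complex.norm_real, Real.norm_eq_abs, abs_of_pos hρ0]
  have t1 := norm_ne_zero_iff.mpr (d.theta₁_ne_zero hm)
  have t2 := norm_ne_zero_iff.mpr (d.theta₂_ne_zero hm)
  have eG : ‖gaussFn r z₁ z₂ s z‖ ^ 2
      = ρ / (1 - ρ) * (‖Q r z₁ z‖ / ‖Q r z₂ z‖) * (‖z‖ ^ 2)⁻¹ := by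
    rw [← norm_pow, d.gaussFn_sq hs hm h1 h2, hρ]
    simp only [norm_mul, norm_div, norm_inv, norm_pow, eR, eR']
  have eE : Real.exp (2 * potFn r z₀ z₁ m a z) * (1 - ρ) = ‖Q r z₁ z‖ * ‖z‖ ^ m := by
    rw [d.exp_two_mul_potFn hm, d.potQuot_eq hm h1, hρ, norm_div, eR]
    field_simp
  have eE2 : Real.exp (2 * potFn r z₀ z₁ m a z) ^ 2 * (ρ * (1 - ρ))
      = (‖Q r z₁ z‖ * ‖z‖ ^ m) ^ 2 * ρ / (1 - ρ) := by
    rw [← eE]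
    field_simp
  refine ⟨ρ, hρ0, hρ1, hρ, ?_, fun h => ?_, fun h => ?_⟩
  · rw [eE2, eG]
    rcases hz with h | h
    · rw [Q, Q, norm_div, norm_div, norm_theta_div_of_norm_eq_one d.r_pos d.r_lt_one _ h,
        norm_theta_div_of_norm_eq_one d.r_pos d.r_lt_one _ h, h, Real.one_rpow, div_self t1,
        div_self t2]
      ring
    · rw [Q, Q, norm_div, norm_div, norm_theta_div_of_norm_eq d.r_pos d.r_lt_one d.ne_zero₁ h,
        norm_theta_div_of_norm_eq d.r_pos d.r_lt_one d.ne_zero₂ h, h, mul_div_cancel_right₀ _ t1,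
        mul_div_cancel_right₀ _ t2]
      have hr := d.r_pos
      have n1 := abs_pos.mpr d.ne_zero₁
      have n2 := abs_pos.mpr d.ne_zero₂
      have e3 : |z₁| * |z₂| * (r ^ 4 * (r ^ m) ^ 2) = 1 := by
        rw [← abs_mul, abs_of_pos (mul_pos_of_neg_of_neg (by linarith [d.mem₁.2])
          (by linarith [d.mem₂.2])), ← Real.rpow_natCast (r ^ m), ← Real.rpow_mul hr.le,
          ← Real.rpow_natCast r 4, ← Real.rpow_add hr, ← d.C3]
        congr 2
        push_cast
        ring
      field_simp
      linear_combination e3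
  · rw [eE, Q, norm_div, norm_theta_div_of_norm_eq_one d.r_pos d.r_lt_one _ h, h, Real.one_rpow,
      div_self t1, one_mul]
  · rw [eE, Q, norm_div, norm_theta_div_of_norm_eq d.r_pos d.r_lt_one d.ne_zero₁ h, h,
      mul_div_assoc, div_self t1, Real.rpow_add d.r_pos, Real.rpow_one]
    ring

lemma contDiffAt_surface (d : IsAnnularData r z₀ z₁ z₂ m a b) {s : ℂ} (hs0 : s ≠ 0) {z : ℂ}
    (hz : z ∈ mainDomain r z₀ z₁ z₂) :
    ContDiffAt ℝ ∞ (surface (gaussFn r z₁ z₂ s) (potFn r z₀ z₁ m a)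
      (dualFn r z₀ z₁ z₂ a b s)) z :=
  (contDiffOn_surface (isOpen_mainDomain r z₀ z₁ z₂)
    (fun _ hw => (d.hasDerivAt_gaussFn s hw.1.1.2 hw.1.2).differentiableAt.differentiableWithinAt)
    (fun _ hw => (d.hasDerivAt_dualFn hs0 hw).differentiableAt.differentiableWithinAt)
    (fun _ hw => (d.contDiffAt_potFn hw).contDiffWithinAt)).contDiffAt
    ((isOpen_mainDomain r z₀ z₁ z₂).mem_nhds hz)

/-- The radial derivative of the height on the boundary circles has the sign of `-a`. -/
lemma radial_deriv (d : IsAnnularData r z₀ z₁ z₂ m a b) {s : ℂ} (hs0 : s ≠ 0)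
    (hs : s ^ 2 = factor r z₀ a z₂ / -factor r z₀ a z₁) {z : ℂ} (hz : ‖z‖ = 1 ∨ ‖z‖ = r) :
    0 < -a * (fderiv ℝ (surface (gaussFn r z₁ z₂ s) (potFn r z₀ z₁ m a)
      (dualFn r z₀ z₁ z₂ a b s)) z z) 2 := by
  obtain ⟨ρ, hρ0, hρ1, hρ, hrel, -, -⟩ := d.circle_values hs hz
  have hm := d.mem_mainDomain_of_circle hz
  have hz0 := ne_zero_of_mem hm
  have hG := d.gaussFn_ne_zero hs0 hm.1.1.2 hm.1.2
  have h1 := ne_of_mem_circle d.r_pos d.mem₁ hz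
  have h2 := ne_of_mem_circle d.r_pos d.mem₂ hz
  rw [fderiv_surface ((d.contDiffAt_surface hs0 hm).differentiableAt (by simp))
    (d.hasDerivAt_gaussFn s hm.1.1.2 hm.1.2) (d.hasDerivAt_dualFn hs0 hm)
    (d.hasFDerivAt_potFn hs0 hm), dualFn, d.mul_deriv_R hm h1 h2, d.gaussLog_inv hz, hρ]
  have e1 : gaussFn r z₁ z₂ s z * gaussLog r z₁ z₂ z / z * z
      = gaussFn r z₁ z₂ s z * gaussLog r z₁ z₂ z := by field_simp
  have e2 : (ρ * (1 - ρ) * (gaussLog r z₁ z₂ z - (starRingEnd ℂ) (gaussLog r z₁ z₂ z))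
      - ρ * gaussLog r z₁ z₂ z) / (z * gaussFn r z₁ z₂ s z) * z
      = (ρ * (1 - ρ) * (gaussLog r z₁ z₂ z - (starRingEnd ℂ) (gaussLog r z₁ z₂ z))
      - ρ * gaussLog r z₁ z₂ z) / gaussFn r z₁ z₂ s z := by
    generalize gaussFn r z₁ z₂ s z = G at *
    field_simp
  rw [e1, e2, velocity_two (Real.exp_pos _) hρ0 hρ1 hG hrel]
  have hρ' : 0 < 1 - ρ := by linarith
  have hneg := d.re_gaussLog_boundary hz
  have hpos : 0 < 4 * Real.exp (2 * potFn r z₀ z₁ m a z) * ρ * (1 - ρ) ^ 2 := by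
    have := Real.exp_pos (2 * potFn r z₀ z₁ m a z)
    positivity
  nlinarith

lemma surface_circle (d : IsAnnularData r z₀ z₁ z₂ m a b) {s : ℂ} (hs0 : s ≠ 0)
    (hs : s ^ 2 = factor r z₀ a z₂ / -factor r z₀ a z₁) {z : ℂ} (hz : ‖z‖ = 1 ∨ ‖z‖ = r) :
    surface (gaussFn r z₁ z₂ s) (potFn r z₀ z₁ m a) (dualFn r z₀ z₁ z₂ a b s) z
      = if ‖z‖ = 1 then !₂[0, 0, 1] else !₂[0, 0, |z₁| * r ^ (m + 1)] := by
  obtain ⟨ρ, hρ0, hρ1, hρ, hrel, v1, v2⟩ := d.circle_values hs hz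
  have hm := d.mem_mainDomain_of_circle hz
  rw [surface_eq_of_relation hρ0 hρ1 (d.gaussFn_ne_zero hs0 hm.1.1.2 hm.1.2)
    (by rw [dualFn, hρ]) hrel]
  split_ifs with h
  · rw [v1 h]
  · rw [v2 (hz.resolve_left h)]

/-! ### Conclusion -/

variable {g : ℂ → ℂ} {u : ℂ → ℝ}

lemma isConformalData (d : IsAnnularData r z₀ z₁ z₂ m a b) {s : ℂ} (hs0 : s ≠ 0)
    (hs : s ^ 2 = factor r z₀ a z₂ / -factor r z₀ a z₁)
    (hg : ∀ z ∈ annulus r, g z = gaussFn r z₁ z₂ s z)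
    (hu : ∀ z ∈ annulus r \ {(z₀ : ℂ)}, u z = potFn r z₀ z₁ m a z) :
    IsConformalData (annulus r \ {(z₀ : ℂ)}) g u (dualFn r z₀ z₁ z₂ a b s) ∧
      IsFlatImmersionOn (surface g u (dualFn r z₀ z₁ z₂ a b s)) (annulus r \ {(z₀ : ℂ)}) := by
  set U := annulus r \ {(z₀ : ℂ)} with hUdef
  have hO : IsOpen U := isOpen_puncturedAnnulus r z₀
  have hsub := d.annulus_subset_mainDomain
  have eg : ∀ z ∈ U, g =ᶠ[𝓝 z] gaussFn r z₁ z₂ s := fun z hz => by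
    filter_upwards [hO.mem_nhds hz] with w hw using hg w hw.1
  have eu : ∀ z ∈ U, u =ᶠ[𝓝 z] potFn r z₀ z₁ m a := fun z hz => by
    filter_upwards [hO.mem_nhds hz] with w hw using hu w hw
  have dg : ∀ z ∈ U, HasDerivAt g (gaussFn r z₁ z₂ s z * gaussLog r z₁ z₂ z / z) z := fun z hz =>
    (d.hasDerivAt_gaussFn s (hsub hz).1.1.2 (hsub hz).1.2).congr_of_eventuallyEq (eg z hz)
  have dgU : DifferentiableOn ℂ g U := fun z hz =>
    (dg z hz).differentiableAt.differentiableWithinAt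
  have dF : DifferentiableOn ℂ (dualFn r z₀ z₁ z₂ a b s) U := fun z hz =>
    (d.hasDerivAt_dualFn hs0 (hsub hz)).differentiableAt.differentiableWithinAt
  have du : ∀ z ∈ U, HasFDerivAt u (reMul (dualFn r z₀ z₁ z₂ a b s z * deriv g z)) z := by
    intro z hz
    rw [(dg z hz).deriv]
    exact (d.hasFDerivAt_potFn hs0 (hsub hz)).congr_of_eventuallyEq (eu z hz)
  have cu : ContDiffOn ℝ ∞ u U := fun z hz =>
    ((d.contDiffAt_potFn (hsub hz)).congr_of_eventuallyEq (eu z hz)).contDiffWithinAt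
  have hg' : ∀ z ∈ U, deriv g z ≠ 0 := by
    intro z hz
    rw [(dg z hz).deriv]
    exact div_ne_zero (mul_ne_zero (d.gaussFn_ne_zero hs0 (hsub hz).1.1.2 (hsub hz).1.2)
      (d.gaussLog_ne_zero hz.1.1.le hz.1.2.le)) (ne_zero_of_mem (hsub hz))
  have an : AnalyticOnNhd ℂ g U := fun z hz => dgU.analyticAt (hO.mem_nhds hz)
  -- `g` is holomorphic on `U`, so the conditions at poles are vacuous
  have hpoles : poles g U = ∅ := by
    ext z
    simp only [poles, Set.mem_ofPred_eq, Set.mem_empty_iff_false, iff_false, not_and, not_lt]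
    exact fun hz => (an z hz).meromorphicOrderAt_nonneg
  have hpos : ∀ z ∈ U, ∀ v : ℂ, v ≠ 0 → 0 < dataMetric g u (dualFn r z₀ z₁ z₂ a b s) z v := by
    intro z hz v hv
    have key := d.norm_dual_lt hs0 hs hz
    rw [← (eg z hz).deriv_eq, ← hu z hz] at key
    have h1 : Real.exp (4 * u z) = Real.exp (2 * u z) ^ 2 := by
      rw [← Real.exp_nat_mul]
      congr 1
      push_cast
      ring
    rw [dataMetric, h1]
    refine mul_pos (Real.exp_pos _) (pow_pos (norm_pos_iff.mpr fun h => ?_) 2)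
    rw [sub_eq_zero] at h
    have h2 := congrArg norm h
    rw [RCLike.norm_conj, norm_mul, norm_mul, norm_mul, Complex.norm_real, Real.norm_eq_abs,
      abs_of_pos (by positivity), ← mul_assoc] at h2
    have h3 := mul_right_cancel₀ (norm_ne_zero_iff.mpr hv) h2
    linarith
  refine ⟨⟨an.meromorphicNFOn, ?_, ?_, ?_, dF, ?_, ?_, ?_, ?_⟩,
    isFlatImmersionOn_surface hO dgU dF cu du hpos⟩
  · rintro ⟨c, hc⟩
    rw [hpoles, Set.sdiff_empty] at hc
    have hz : (z₁ : ℂ) ∈ U := ⟨mem_annulus d.r_pos d.mem₁, by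
      simpa using d.ne₁₀⟩
    refine hg' z₁ hz ?_
    have : g =ᶠ[𝓝 (z₁ : ℂ)] fun _ => c := by
      filter_upwards [hO.mem_nhds hz] with w hw using hc w hw
    rw [this.deriv_eq, deriv_const]
  · intro z hz
    rw [InnerProductSpace.harmonicAt_congr_nhds (eu z hz.1)]
    exact d.harmonicAt_potFn (hsub hz.1)
  · intro p hp
    rw [hpoles] at hp
    exact hp.elim
  · intro z hz v
    rw [(du z hz.1).fderiv, reMul_apply, reMul_apply, ← mul_assoc _ (deriv g z) v]
    have e : dualFn r z₀ z₁ z₂ a b s z * deriv g z * (Complex.I * v)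
        = Complex.I * (dualFn r z₀ z₁ z₂ a b s z * deriv g z * v) := by ring
    rw [e, Complex.I_mul_re, neg_neg, mul_comm Complex.I]
    exact Complex.re_add_im _
  · rintro p hp ⟨hb, -⟩
    have h1 : ¬ meromorphicOrderAt g p < 0 := not_lt.mpr (an p hp).meromorphicOrderAt_nonneg
    rw [IsBranchPoint, branchNumber, if_neg h1] at hb
    have h2 : meromorphicOrderAt (deriv g) p = 0 :=
      ((an p hp).deriv.meromorphicNFAt.meromorphicOrderAt_eq_zero_iff).mpr (hg' p hp)
    rw [h2] at hb
    exact lt_irrefl _ hb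
  · exact fun z hz => hpos z hz.1
  · intro p hp
    rw [hpoles] at hp
    exact hp.elim

lemma hasIsolatedSingularity (d : IsAnnularData r z₀ z₁ z₂ m a b) {s : ℂ} (hs0 : s ≠ 0)
    (hs : s ^ 2 = factor r z₀ a z₂ / -factor r z₀ a z₁)
    (hg : ∀ z ∈ annulus r, g z = gaussFn r z₁ z₂ s z)
    (hu : ∀ z ∈ annulus r \ {(z₀ : ℂ)}, u z = potFn r z₀ z₁ m a z) :
    HasIsolatedSingularity (surface g u (dualFn r z₀ z₁ z₂ a b s)) (annulus r \ {(z₀ : ℂ)})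
        {z : ℂ | ‖z‖ = 1} !₂[0, 0, 1] ∧
      HasIsolatedSingularity (surface g u (dualFn r z₀ z₁ z₂ a b s)) (annulus r \ {(z₀ : ℂ)})
        {z : ℂ | ‖z‖ = r} !₂[0, 0, |z₁| * r ^ (m + 1)] := by
  have hψ : ∀ z ∈ annulus r \ {(z₀ : ℂ)}, surface g u (dualFn r z₀ z₁ z₂ a b s) z
      = surface (gaussFn r z₁ z₂ s) (potFn r z₀ z₁ m a) (dualFn r z₀ z₁ z₂ a b s) z := by
    intro z hz
    rw [surface, surface, hg z hz.1, hu z hz]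
  have hd : ∀ p : ℂ, (‖p‖ = 1 ∨ ‖p‖ = r) → ContDiffAt ℝ 1 (surface (gaussFn r z₁ z₂ s)
      (potFn r z₀ z₁ m a) (dualFn r z₀ z₁ z₂ a b s)) p := fun p hp =>
    (d.contDiffAt_surface hs0 (d.mem_mainDomain_of_circle hp)).of_le (by exact_mod_cast le_top)
  constructor
  · refine hasIsolatedSingularity_of_radial (τ := -1) (σ := a) one_pos
      (fun z hz => by linarith [hz.1.2]) (by simp) hψ (fun p hp => hd p (Or.inl hp))
      (fun p hp => by rw [d.surface_circle hs0 hs (Or.inl hp), if_pos hp]) fun p hp => ?_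
    have := d.radial_deriv hs0 hs (Or.inl hp)
    linarith
  · refine hasIsolatedSingularity_of_radial (τ := 1) (σ := -a) d.r_pos
      (fun z hz => by linarith [hz.1.1]) (by simp) hψ (fun p hp => hd p (Or.inr hp))
      (fun p hp => by
        rw [d.surface_circle hs0 hs (Or.inr hp), if_neg (by rw [hp]; exact d.r_lt_one.ne)])
      fun p hp => ?_
    have := d.radial_deriv hs0 hs (Or.inr hp)
    linarith

end IsAnnularData

end FlatSurface

theorem proposition3p1 (r : ℝ) (hr0 : 0 < r) (hr1 : r < 1)
    (z₀ z₁ z₂ m a b : ℝ)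
    (hz₀ : z₀ ∈ Set.Ioo (-1) (-r)) (hz₁ : z₁ ∈ Set.Ioo (-1) (-r)) (hz₂ : z₂ ∈ Set.Ioo (-1) (-r))
    (hz₁₀ : z₁ ≠ z₀) (hz₂₀ : z₂ ≠ z₀)
    (hR₁ : R r z₀ a b z₁ = 1) (hR₂ : R r z₀ a b z₂ = 0)
    (hRbdry : ∀ z : ℂ, (‖z‖ = 1 ∨ ‖z‖ = r) → 0 < (R r z₀ a b z).re ∧ (R r z₀ a b z).re < 1)
    (C1 : (m : ℂ) + q r z₁ z₀ * z₁ - z₁ * deriv (R r z₀ a b) z₁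
      = -(z₂ * deriv (R r z₀ a b) z₂))
    (C2 : q r z₁ z₀ * z₁ - q r z₂ z₀ * z₂ - 2 = 0)
    (C3 : z₁ * z₂ * r ^ (2 * (m + 2)) = 1) :
    (∃ g : ℂ → ℂ, IsGaussMap r z₀ z₁ z₂ a b g) ∧
    (∃ u : ℂ → ℝ, IsPotential r z₀ z₁ a b m u) ∧
    ∀ (g : ℂ → ℂ) (u : ℂ → ℝ), IsGaussMap r z₀ z₁ z₂ a b g → IsPotential r z₀ z₁ a b m u →
      ∃ F : ℂ → ℂ,
        IsConformalData (annulus r \ {(z₀ : ℂ)}) g u F ∧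
        IsFlatImmersionOn (surface g u F) (annulus r \ {(z₀ : ℂ)}) ∧
        HasIsolatedSingularity (surface g u F) (annulus r \ {(z₀ : ℂ)})
          {z : ℂ | ‖z‖ = 1} !₂[0, 0, 1] ∧
        HasIsolatedSingularity (surface g u F) (annulus r \ {(z₀ : ℂ)})
          {z : ℂ | ‖z‖ = r} !₂[0, 0, |z₁| * r ^ (m + 1)] := by
  have d : IsAnnularData r z₀ z₁ z₂ m a b :=
    ⟨hr0, hr1, hz₀, hz₁, hz₂, hz₁₀, hz₂₀, hR₁, hR₂, hRbdry, C1, C2, C3⟩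
  refine ⟨?_, ⟨_, d.isPotential_potFn⟩, fun g u hg hu => ?_⟩
  · obtain ⟨s, hs⟩ := IsAlgClosed.exists_pow_nat_eq (factor r z₀ a z₂ / -factor r z₀ a z₁)
      (n := 2) (by norm_num)
    exact ⟨_, d.isGaussMap_gaussFn hs⟩
  · obtain ⟨s, hs0, hs, hgs⟩ := d.exists_eq_gaussFn hg
    have hus := fun z hz => d.eq_potFn hu (z := z) hz
    obtain ⟨h1, h2⟩ := d.isConformalData hs0 hs hgs hus
    obtain ⟨h3, h4⟩ := d.hasIsolatedSingularity hs0 hs hgs hus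
    exact ⟨_, h1, h2, h3, h4⟩
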